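/- Consider the following isometries of $\mathbb{R}^3$, and for each of the six groups below the flat $3$-manifold obtained as the quotient of $\mathbb{R}^3$ by the group generated by the three listed isometries: - $\mathcal{G}_1$: $(x+1,y,z)$, $(x,y+1,z)$, $(x,y,z+1)$; - $\mathcal{G}_2$: $(x+1,y,z)$, $(x,y+1,z)$, $(-x,-y,z+1)$; - $\mathcal{B}_1$: $(x+1,y,z)$, $(x,y+1,z)$, $(-x,y,z+1)$; - $\mathcal{B}_2$: $(x+1,y,z)$, $(x-\tfrac12,y+1,z)$, $(-x,y,z+1)$; - $\mathcal{B}_3$: $(x+1,y,z)$, $(-x,y+1,z)$, $(-x,-y,z+1)$; - $\mathcal{B}_4$: $(x+1,y,z)$, $(-x,y+1,z)$, $(-x+\tfrac12,-y,z+1)$, where each triple is the image of $(x,y,z)$. For a positive integer $m$ put, with sums over ordered factorizations into three positive integers, $$\omega(m)=\sum_{abc=m}a^2b,\qquad \sigma_2(m)=\sum_{abc=m}a,\qquad d_3(m)=\sum_{abc=m}1,$$ and let these functions be $0$ at rational numbers that are not integers. For $X$ one of the six manifolds and a positive integer $n$, let $c_{X,\mathcal{B}_3}(n)$ be the number of conjugacy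 classes of subgroups of index $n$ in $\pi_1(\mathcal{B}_3)$ that are isomorphic to $\pi_1(X)$. This number is finite and is equal to the number of equivalence classes of connected $n$-fold coverings $p:N\to\mathcal{B}_3$ with $N$ homeomorphic to $X$, where $p_1:N_1\to\mathcal{B}_3$ and $p_2:N_2\to\mathcal{B}_3$ are equivalent if $p_1=p_2\circ h$ for some homeomorphism $h:N_1\to N_2$. Moreover, for every $n\ge 1$, $$c_{\mathcal{G}_1,\mathcal{B}_3}(n)=\tfrac14\Big(\omega(\tfrac n4)+3\sigma_2(\tfrac n4)+9\sigma_2(\tfrac n8)\Big),$$ $$c_{\mathcal{G}_2,\mathcal{B}_3}(n)=\tfrac12\Big(\sigma_2(\tfrac n2)+2\sigma_2(\tfrac n4)-3\sigma_2(\tfrac n8)+d_3(\tfrac n2)-d_3(\tfrac n4)+d_3(\tfrac n8)-3d_3(\tfrac n{16})+2d_3(\tfrac n{32})\Big),$$ $$c_{\mathcal{B}_1,\mathcal{B}_3}(n)=\sigma_2(\tfrac n2)-\sigma_2(\tfrac n8)+d_3(\tfrac n2)-d_3(\tfrac n8),$$ $$c_{\mathcal{B}_2,\mathcal{B}_3}(n)=2\sigma_2(\tfrac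 n4)-2\sigma_2(\tfrac n8)+d_3(\tfrac n4)-d_3(\tfrac n{16}),$$ $$c_{\mathcal{B}_3,\mathcal{B}_3}(n)=d_3(n)-d_3(\tfrac n2)-d_3(\tfrac n4)+d_3(\tfrac n8),$$ $$c_{\mathcal{B}_4,\mathcal{B}_3}(n)=2d_3(\tfrac n2)-4d_3(\tfrac n4)+2d_3(\tfrac n8).$$ -/

import Mathlib

noncomputable section

/-! ### Arithmetic functions -/

/-- `ω(n) = ∑_{abc = n} a² b`, the sum over ordered factorizations into positive integers. -/
def omega (n : ℕ) : ℕ :=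
  ∑ p ∈ n.divisorsAntidiagonal, ∑ q ∈ p.2.divisorsAntidiagonal, p.1 ^ 2 * q.1

/-- `σ₂(n) = ∑_{abc = n} a` (this is not the sum of the squares of the divisors). -/
def sigma2 (n : ℕ) : ℕ :=
  ∑ p ∈ n.divisorsAntidiagonal, ∑ _q ∈ p.2.divisorsAntidiagonal, p.1

/-- `d₃(n) = ∑_{abc = n} 1`. -/
def d3 (n : ℕ) : ℕ :=
  ∑ p ∈ n.divisorsAntidiagonal, ∑ _q ∈ p.2.divisorsAntidiagonal, 1

/-- `f(n/k)`, with the convention that it vanishes when `n/k` is not an integer. -/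
def atQuot (f : ℕ → ℕ) (n k : ℕ) : ℚ :=
  if k ∣ n then (f (n / k) : ℚ) else 0

/-! ### Flat 3-manifolds as quotients of Euclidean space by Bieberbach groups -/

/-- Euclidean 3-space. -/
abbrev E3 : Type := EuclideanSpace ℝ (Fin 3)

/-- The isometry `(x, y, z) ↦ (s₀ x + t₀, s₁ y + t₁, s₂ z + t₂)` of Euclidean 3-space, where the
signs `sᵢ` are `1` or `-1`. -/
def signedShift (s : Fin 3 → ℤˣ) (t : Fin 3 → ℝ) : E3 ≃ᵢ E3 :=
  IsometryEquiv.mk'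
    (fun v => WithLp.toLp 2 fun i => ((s i : ℤ) : ℝ) * v i + t i)
    (fun v => WithLp.toLp 2 fun i => ((s i : ℤ) : ℝ) * (v i - t i))
    (fun v => by
      ext i
      have h : ((s i : ℤ) : ℝ) * ((s i : ℤ) : ℝ) = 1 := by
        rcases Int.units_eq_one_or (s i) with h | h <;> simp [h]
      show ((s i : ℤ) : ℝ) * (((s i : ℤ) : ℝ) * (v i - t i)) + t i = v i
      rw [← mul_assoc, h]
      ring)
    (Isometry.of_dist_eq fun v w => by
      rw [EuclideanSpace.dist_eq, EuclideanSpace.dist_eq]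
      congr 1
      refine Finset.sum_congr rfl fun i _ => ?_
      rcases Int.units_eq_one_or (s i) with h | h
      · simp [h]
      · simp [h, Real.dist_eq, add_comm])

/-- The isometries of a space act on it by evaluation. -/
instance isometryAction (X : Type*) [PseudoEMetricSpace X] : MulAction (X ≃ᵢ X) X where
  smul g x := g x
  one_smul _ := rfl
  mul_smul _ _ _ := rfl

/-- `𝒢₁`: the group generated by the three unit translations. -/
def groupG1 : Subgroup (E3 ≃ᵢ E3) :=
  Subgroup.closure
    {signedShift ![1, 1, 1] ![1, 0, 0],
     signedShift ![1, 1, 1] ![0, 1, 0],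
     signedShift ![1, 1, 1] ![0, 0, 1]}

/-- `𝒢₂`: generated by `(x+1, y, z)`, `(x, y+1, z)` and `(-x, -y, z+1)`. -/
def groupG2 : Subgroup (E3 ≃ᵢ E3) :=
  Subgroup.closure
    {signedShift ![1, 1, 1] ![1, 0, 0],
     signedShift ![1, 1, 1] ![0, 1, 0],
     signedShift ![-1, -1, 1] ![0, 0, 1]}

/-- `ℬ₁`: generated by `(x+1, y, z)`, `(x, y+1, z)` and `(-x, y, z+1)`. -/
def groupB1 : Subgroup (E3 ≃ᵢ E3) :=
  Subgroup.closure
    {signedShift ![1, 1, 1] ![1, 0, 0],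
     signedShift ![1, 1, 1] ![0, 1, 0],
     signedShift ![-1, 1, 1] ![0, 0, 1]}

/-- `ℬ₂`: generated by `X = (x+1, y, z)`, `Y = (x-1/2, y+1, z)` and `Z = (-x, y, z+1)`, so that
`X Y = Y X`, `Z X Z⁻¹ = X⁻¹` and `Z Y Z⁻¹ = X Y`. -/
def groupB2 : Subgroup (E3 ≃ᵢ E3) :=
  Subgroup.closure
    {signedShift ![1, 1, 1] ![1, 0, 0],
     signedShift ![1, 1, 1] ![-1 / 2, 1, 0],
     signedShift ![-1, 1, 1] ![0, 0, 1]}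

/-- `ℬ₃`: generated by `S₁ = (x+1, y, z)`, `S₂ = (-x, y+1, z)` and `S₃ = (-x, -y, z+1)`. -/
def groupB3 : Subgroup (E3 ≃ᵢ E3) :=
  Subgroup.closure
    {signedShift ![1, 1, 1] ![1, 0, 0],
     signedShift ![-1, 1, 1] ![0, 1, 0],
     signedShift ![-1, -1, 1] ![0, 0, 1]}

/-- `ℬ₄`: generated by `S₁ = (x+1, y, z)`, `S₂ = (-x, y+1, z)` and `(-x+1/2, -y, z+1)`. -/
def groupB4 : Subgroup (E3 ≃ᵢ E3) :=
  Subgroup.closure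
    {signedShift ![1, 1, 1] ![1, 0, 0],
     signedShift ![-1, 1, 1] ![0, 1, 0],
     signedShift ![-1, -1, 1] ![1 / 2, 0, 1]}

/-- The orbit space `ℝ³ / Γ`, with the quotient topology. -/
abbrev FlatManifold (Γ : Subgroup (E3 ≃ᵢ E3)) : Type :=
  MulAction.orbitRel.Quotient Γ E3

abbrev G1 : Type := FlatManifold groupG1
abbrev G2 : Type := FlatManifold groupG2
abbrev B1 : Type := FlatManifold groupB1
abbrev B2 : Type := FlatManifold groupB2
abbrev B3 : Type := FlatManifold groupB3
abbrev B4 : Type := FlatManifold groupB4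

/-! ### Conjugacy classes of subgroups -/

/-- Conjugacy of subgroups: `K = g H g⁻¹` for some `g`. -/
def subgroupConj (G : Type) [Group G] : Setoid (Subgroup G) where
  r H K := ∃ g : G, K = H.map (MulAut.conj g).toMonoidHom
  iseqv :=
    { refl := fun H => ⟨1, by ext x; simp⟩
      symm := by
        rintro H _ ⟨g, rfl⟩
        refine ⟨g⁻¹, ?_⟩
        ext x
        simp [Subgroup.mem_map, mul_assoc]
      trans := by
        rintro H _ _ ⟨g, rfl⟩ ⟨k, rfl⟩
        refine ⟨k * g, ?_⟩
        ext x
        simp [Subgroup.mem_map, mul_assoc] }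

/-- The conjugacy classes of subgroups of index `n` in `G` that are isomorphic to `A`. -/
def subgroupClasses (A G : Type) [Group A] [Group G] (n : ℕ) :
    Set (Quotient (subgroupConj G)) :=
  Quotient.mk (subgroupConj G) '' {H : Subgroup G | H.index = n ∧ Nonempty (H ≃* A)}

/-! ### Equivalence classes of coverings -/

/-- A connected `n`-fold covering of `M`. -/
structure FoldCovering (M : Type) [TopologicalSpace M] (n : ℕ) where
  /-- the covering space -/
  total : Type
  [top : TopologicalSpace total]
  connected : ConnectedSpace total
  /-- the covering map -/
  proj : total → M
  isCoveringMap : IsCoveringMap proj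
  card_fiber : ∀ m : M, Nat.card (proj ⁻¹' {m}) = n

attribute [instance] FoldCovering.top

/-- Two coverings are equivalent if `p₁ = p₂ ∘ h` for a homeomorphism `h` of the covering
spaces. -/
def coveringEquiv (M : Type) [TopologicalSpace M] (n : ℕ) : Setoid (FoldCovering M n) where
  r c₁ c₂ := ∃ h : c₁.total ≃ₜ c₂.total, c₁.proj = c₂.proj ∘ h
  iseqv :=
    { refl := fun c => ⟨Homeomorph.refl _, rfl⟩
      symm := by
        rintro c₁ c₂ ⟨h, e⟩
        exact ⟨h.symm, by rw [e]; ext x; simp⟩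
      trans := by
        rintro c₁ c₂ c₃ ⟨h, e⟩ ⟨k, e'⟩
        exact ⟨h.trans k, by rw [e, e']; rfl⟩ }

/-- The equivalence classes of `n`-fold coverings of `M` by spaces homeomorphic to `X`. -/
def coveringClasses (X M : Type) [TopologicalSpace X] [TopologicalSpace M] (n : ℕ) :
    Set (Quotient (coveringEquiv M n)) :=
  Quotient.mk (coveringEquiv M n) '' {c : FoldCovering M n | Nonempty (c.total ≃ₜ X)}

/-! ### The numbers `c_{X,M}(n)` -/

/-- The set `S` is finite and has exactly `q` elements. -/
def HasCount {α : Type*} (S : Set α) (q : ℚ) : Prop :=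
  S.Finite ∧ (S.ncard : ℚ) = q

/-- `c_{X,M}(n) = q`: the number `q` counts both the conjugacy classes of subgroups of index `n`
in `π₁(M)` that are isomorphic to `π₁(X)` (for all base points), and the equivalence classes of
`n`-fold coverings of `M` by `X`. -/
structure ClassNumberEq (X M : Type) [TopologicalSpace X] [TopologicalSpace M] (n : ℕ) (q : ℚ) :
    Prop where
  subgroups : ∀ (x : X) (m : M),
    HasCount (subgroupClasses (FundamentalGroup X x) (FundamentalGroup M m) n) q
  coverings : HasCount (coveringClasses X M n) q

end

noncomputable section

/-! ### Counting along relations and group actions -/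

/-! The fundamental group of the manifold is the group Γ of normal forms S₁^a S₂^b S₃^c, modelled by
`B3Group`: triples of integers with a multiplication twisted by signs. It acts freely and properly
discontinuously on ℝ³, which is simply connected. Hence n-fold connected coverings correspond to
conjugacy classes of subgroups H of index n, the covering space being ℝ³/H
(`hasCount_coveringClasses_iff`).

A subgroup of finite index has a Hermite basis (A,0,0), s = (u,B,0), t = (v,w,C), and its index is
ABC (`HasBasis.index_eq`). The diagonal is invariant under conjugation. The off-diagonal entries
obey only the congruence saying that t normalizes ⟨(A,0,0), s⟩. The parities of B, C and w fix the
linear parts of s and t. Where these leave two possible manifolds, the congruence forces one of u,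
v, v - u to be 0 or A/2 modulo A, and this residue decides between them. In each case an affine map
carries a model subgroup to H (`HasBasis.hasType`), and the six models are pairwise non-isomorphic
(`model_injective`). So "H is isomorphic to π₁(X)" and "ℝ³/H is homeomorphic to X" are the same
arithmetic condition on the basis, and both counts in `ClassNumberEq` reduce to one.

For a fixed diagonal and type, conjugation by (p,q,r) is made explicit in `conj_iff_of_even` and
`conj_iff_of_odd`. After normalization the classes are the orbits of one or two commuting
involutions on a finite set of residues, and Burnside's lemma counts them. The answers are sums of
products f(A) g(B) h(C). Summing over ABC = n gives Dirichlet convolutions of the functions n ↦ n^k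
and of `delta2`, convolution with which replaces n by n/2. The stated formulas are then polynomial
identities in the ring of arithmetic functions. -/

/-- A relation which is compatible with two setoids and total on both sides of two sets matches
the classes of the elements of these sets. -/
theorem hasCount_iff_of_rel {α β : Type*} (s : Setoid α) (t : Setoid β) {A : Set α} {B : Set β}
    (R : α → β → Prop) (hA : ∀ a ∈ A, ∃ b ∈ B, R a b) (hB : ∀ b ∈ B, ∃ a ∈ A, R a b)
    (hR : ∀ a b a' b', R a b → R a' b' → (s a a' ↔ t b b')) (q : ℚ) :
    HasCount (Quotient.mk s '' A) q ↔ HasCount (Quotient.mk t '' B) q := by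
  choose f hf using hA
  -- A class goes to the class of a partner of a chosen representative in `A`; by `hR` the choice is
  -- harmless and the map is bijective.
  let e : (Quotient.mk s '' A) → (Quotient.mk t '' B) := fun x =>
    ⟨Quotient.mk t (f x.2.choose x.2.choose_spec.1), _,
      (hf x.2.choose x.2.choose_spec.1).1, rfl⟩
  have he : Function.Bijective e := by
    constructor
    · intro x y hxy
      have h := Quotient.exact (congrArg Subtype.val hxy)
      have h' := (hR _ _ _ _ (hf x.2.choose x.2.choose_spec.1).2
        (hf y.2.choose y.2.choose_spec.1).2).2 h
      apply Subtype.ext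
      rw [← x.2.choose_spec.2, ← y.2.choose_spec.2]
      exact Quotient.sound h'
    · rintro ⟨_, b, hb, rfl⟩
      obtain ⟨a, ha, hab⟩ := hB b hb
      let x : (Quotient.mk s '' A) := ⟨Quotient.mk s a, a, ha, rfl⟩
      refine ⟨x, Subtype.ext (Quotient.sound ?_)⟩
      exact (hR _ _ _ _ (hf x.2.choose x.2.choose_spec.1).2 hab).1
        (Quotient.exact x.2.choose_spec.2)
  have h1 := Nat.card_congr (Equiv.ofBijective e he)
  have h2 := Equiv.finite_iff (Equiv.ofBijective e he)
  unfold HasCount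
  rw [← Set.finite_coe_iff, ← Set.finite_coe_iff, h2, ← Nat.card_coe_set_eq,
    ← Nat.card_coe_set_eq, h1]

/-- Burnside's lemma for the group generated by two commuting involutions `α` and `β`, for the
orbits given as the fibres of a map. -/
theorem four_mul_card_range {T Q : Type*} [Fintype T] [DecidableEq T] (f : T → Q) (α β : T → T)
    (hα : Function.Involutive α) (hβ : Function.Involutive β) (hc : ∀ t, α (β t) = β (α t))
    (h : ∀ t t', f t = f t' ↔ t' = t ∨ t' = α t ∨ t' = β t ∨ t' = α (β t)) :
    4 * (Set.range f).ncard = Fintype.card T + (Finset.univ.filter fun t => α t = t).card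
      + (Finset.univ.filter fun t => β t = t).card
      + (Finset.univ.filter fun t => α (β t) = t).card := by
  classical
  have hr : (Set.range f).ncard = (Finset.univ.image f).card := by
    rw [← Set.ncard_coe_finset]; simp
  -- The weight of `t` is the number of words 1, α, β, αβ fixing it, the order of its stabilizer. It
  -- is constant on the orbit, and weight times orbit size is 4.
  let w : T → ℕ := fun t => 1 + (if α t = t then 1 else 0) + (if β t = t then 1 else 0)
    + (if α (β t) = t then 1 else 0)
  have hsum : ∑ t, w t = Fintype.card T + (Finset.univ.filter fun t => α t = t).card
      + (Finset.univ.filter fun t => β t = t).card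
      + (Finset.univ.filter fun t => α (β t) = t).card := by
    simp only [w, Finset.sum_add_distrib, Finset.card_filter]
    simp
  rw [← hsum, hr, ← Finset.sum_fiberwise_of_maps_to (s := Finset.univ) (t := Finset.univ.image f)
    (g := f) (by simp), mul_comm, ← smul_eq_mul]
  symm
  apply Finset.sum_eq_card_nsmul
  intro q hq
  obtain ⟨t, -, rfl⟩ := Finset.mem_image.1 hq
  have hfib : (Finset.univ.filter fun t' => f t' = f t) = {t, α t, β t, α (β t)} := by
    ext t'
    simp only [Finset.mem_filter, Finset.mem_univ, true_and, Finset.mem_insert,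
      Finset.mem_singleton]
    rw [eq_comm, h]
  rw [hfib]
  have hαβ : ∀ s, α (β (α s)) = β s := fun s => by rw [hc, hα]
  have hβα : ∀ s, β (α (β s)) = α s := fun s => by rw [← hc, hβ]
  have hw : ∀ t' ∈ ({t, α t, β t, α (β t)} : Finset T), w t' = w t := by
    have e1 : w (α t) = w t := by
      have i1 : α (α t) = α t ↔ α t = t := hα.injective.eq_iff
      have i2 : β (α t) = α t ↔ β t = t := by rw [← hc, hα.injective.eq_iff]
      have i3 : α (β (α t)) = α t ↔ α (β t) = t := by rw [hαβ, ← hα.injective.eq_iff, hα t]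
      simp only [w, i1, i2, i3]
    have e2 : ∀ t, w (β t) = w t := by
      intro t
      have i1 : β (β t) = β t ↔ β t = t := hβ.injective.eq_iff
      have i2 : α (β t) = β t ↔ α t = t := by rw [hc, hβ.injective.eq_iff]
      have i3 : α (β (β t)) = β t ↔ α (β t) = t := by rw [hβ t, hc, ← hβ.injective.eq_iff, hβ t]
      simp only [w, i1, i2, i3]
    have e3 : w (α (β t)) = w t := by rw [hc, e2, e1]
    intro t' ht'
    simp only [Finset.mem_insert, Finset.mem_singleton] at ht'
    rcases ht' with rfl | rfl | rfl | rfl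
    exacts [rfl, e1, e2 t, e3]
  rw [Finset.sum_congr rfl hw, Finset.sum_const, smul_eq_mul]
  by_cases h1 : α t = t
  · by_cases h2 : β t = t
    · simp [w, h1, h2]
    · have h3 : α (β t) = β t := by rw [hc, h1]
      have h2' : t ≠ β t := fun h => h2 h.symm
      simp [w, h1, h2, h2', h3]
  · have h1' : t ≠ α t := fun h => h1 h.symm
    by_cases h2 : β t = t
    · simp [w, h1, h1', h2]
    · have h2' : t ≠ β t := fun h => h2 h.symm
      by_cases h3 : α (β t) = t
      · have h4 : β t = α t := by rw [← hα (β t), h3]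
        simp [w, h1, h1', h4, hα t]
      · have h3' : t ≠ α (β t) := fun h => h3 h.symm
        have h5 : α t ≠ β t := fun h => h3 (by rw [← h, hα])
        have h6 : α t ≠ α (β t) := fun h => h2' (hα.injective h)
        have h7 : β t ≠ α (β t) := fun h => h1' (by
          have := congrArg β h
          rwa [hβ, hβα] at this)
        rw [Finset.card_insert_of_notMem, Finset.card_insert_of_notMem,
          Finset.card_insert_of_notMem]
        · simp [w, h1, h2, h3]
        · simpa using h7
        · simpa using ⟨h5, h6⟩
        · simpa using ⟨h1', h2', h3'⟩

/-- Isomorphic groups have the same number of conjugacy classes of subgroups of a given index and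
isomorphism type. -/
theorem hasCount_subgroupClasses_congr {A A' G G' : Type} [Group A] [Group A'] [Group G] [Group G']
    (a : A ≃* A') (g : G ≃* G') (n : ℕ) (q : ℚ) :
    HasCount (subgroupClasses A G n) q ↔ HasCount (subgroupClasses A' G' n) q := by
  have key : ∀ {A A' G G' : Type} [Group A] [Group A'] [Group G] [Group G']
      (_ : A ≃* A') (g : G ≃* G') (H : Subgroup G), (H.index = n ∧ Nonempty (H ≃* A)) →
      ((H.map g.toMonoidHom).index = n ∧ Nonempty (H.map g.toMonoidHom ≃* A')) := by
    rintro A A' G G' _ _ _ _ a g H ⟨h1, ⟨h2⟩⟩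
    exact ⟨by rw [← h1]; exact Subgroup.index_map_equiv H g,
      ⟨((g.subgroupMap H).symm.trans h2).trans a⟩⟩
  refine hasCount_iff_of_rel _ _ (fun H K => K = H.map g.toMonoidHom) ?_ ?_ ?_ q
  · intro H hH
    exact ⟨_, key a g H hH, rfl⟩
  · intro K hK
    refine ⟨_, key a.symm g.symm K hK, ?_⟩
    ext x
    simp [Subgroup.mem_map]
  · rintro H _ H' _ rfl rfl
    constructor
    · rintro ⟨x, rfl⟩
      refine ⟨g x, ?_⟩
      ext y
      simp [Subgroup.mem_map]
    · rintro ⟨x, hx⟩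
      refine ⟨g.symm x, ?_⟩
      apply Subgroup.map_injective (f := g.toMonoidHom) g.injective
      rw [hx]
      ext y
      simp [Subgroup.mem_map]

/-! ### Coverings of a quotient by a free and properly discontinuous action -/

section Coverings

variable {E M : Type} [TopologicalSpace E] [TopologicalSpace M] {G : Type} [Group G]
  [MulAction G E] {q : E → M}

/-- The projection `E / H → M` induced by a quotient map `q` by the action of `G ≥ H`. -/
def quotientProj (hq : IsQuotientCoveringMap q G) (H : Subgroup G) :
    MulAction.orbitRel.Quotient H E → M :=
  Quotient.lift q fun a b hab => by
    obtain ⟨h, rfl⟩ := hab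
    exact hq.map_smul (h : G)

omit [TopologicalSpace E] in
/-- Points of `E / H` agree iff they differ by an element of `H`. -/
theorem orbit_mk_eq_iff (H : Subgroup G) (e e' : E) :
    (Quotient.mk (MulAction.orbitRel H E) e = Quotient.mk (MulAction.orbitRel H E) e') ↔
      ∃ h ∈ H, h • e = e' := by
  rw [eq_comm, Quotient.eq]
  constructor
  · rintro ⟨h, hh⟩
    exact ⟨h, h.2, hh⟩
  · rintro ⟨h, hh, rfl⟩
    exact ⟨⟨h, hh⟩, rfl⟩

theorem IsQuotientCoveringMap.smul_left_injective (hq : IsQuotientCoveringMap q G) {g g' : G}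
    {e : E} (h : g • e = g' • e) : g = g' :=
  have := hq.isCancelSMul
  IsCancelSMul.right_cancel _ _ e h

/-- `f` exhibits the covering `p : N → M` as the quotient of `E` by the subgroup `H`. -/
structure IsUniformizedBy (q : E → M) {N : Type} [TopologicalSpace N] (p : N → M)
    (H : Subgroup G) (f : E → N) : Prop where
  isOpenQuotientMap : IsOpenQuotientMap f
  comp_eq : p ∘ f = q
  eq_iff : ∀ e e', f e = f e' ↔ ∃ h ∈ H, h • e = e'

theorem isUniformizedBy_quotientProj (hq : IsQuotientCoveringMap q G) (H : Subgroup G) :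
    IsUniformizedBy q (quotientProj hq H) H (Quotient.mk (MulAction.orbitRel H E)) where
  isOpenQuotientMap := by
    have := hq.toContinuousConstSMul
    have : ContinuousConstSMul H E := ⟨fun h => continuous_const_smul (h : G)⟩
    exact MulAction.isOpenQuotientMap_quotientMk
  comp_eq := rfl
  eq_iff := orbit_mk_eq_iff H

/-- If no nontrivial element of `G` moves a point of the open set `U` into `U`, then over `q '' U`
the space E/H splits into disjoint open sheets, the images of g⁻¹U, one for each coset gH. -/
theorem isCoveringMap_quotientProj (hq : IsQuotientCoveringMap q G) (H : Subgroup G) :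
    IsCoveringMap (quotientProj hq H) := by
  have hcs := hq.toContinuousConstSMul
  have hoq := (isUniformizedBy_quotientProj hq H).isOpenQuotientMap
  have hqo := hq.isOpenQuotientMap
  set π : E → MulAction.orbitRel.Quotient H E := Quotient.mk (MulAction.orbitRel H E) with hπ
  have hpπ : ∀ e, quotientProj hq H (π e) = q e := fun e => rfl
  have hcont : Continuous (quotientProj hq H) :=
    hoq.isQuotientMap.continuous_iff.2 hqo.continuous
  have hopen : IsOpenMap (quotientProj hq H) := fun W hW => by
    have : quotientProj hq H '' W = q '' (π ⁻¹' W) := by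
      ext m
      constructor
      · rintro ⟨x, hx, rfl⟩
        obtain ⟨e, rfl⟩ := hoq.surjective x
        exact ⟨e, hx, rfl⟩
      · rintro ⟨e, he, rfl⟩
        exact ⟨π e, he, rfl⟩
    rw [this]
    exact hqo.isOpenMap _ (hW.preimage hoq.continuous)
  intro m
  obtain ⟨e₀, rfl⟩ := hq.surjective m
  obtain ⟨U', hU', hd⟩ := hq.disjoint e₀
  obtain ⟨U, hUU', hU, he₀⟩ := mem_nhds_iff.1 hU'
  have hUd : ∀ e ∈ U, ∀ e' ∈ U, ∀ g : G, g • e = e' → g = 1 := fun e he e' he' g hg =>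
    hd g ⟨e', ⟨e, hUU' he, hg⟩, hUU' he'⟩
  have hqU : ∀ e ∈ U, ∀ e' ∈ U, q e = q e' → e = e' := by
    intro e he e' he' h
    obtain ⟨g, hg⟩ := hq.apply_eq_iff_mem_orbit.1 h
    have := hUd e' he' e he g hg
    subst this
    simpa using hg.symm
  -- The inverse turns the left coset gH into Hg⁻¹, so that the image of g⁻¹U in E/H depends on the
  -- coset alone.
  let S : G ⧸ H → Set (MulAction.orbitRel.Quotient H E) := fun i =>
    {x | ∃ g : G, (g : G ⧸ H) = i ∧ ∃ e ∈ U, x = π (g⁻¹ • e)}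
  have hS : ∀ g : G, S g = (fun e => π (g⁻¹ • e)) '' U := by
    intro g
    ext x
    constructor
    · rintro ⟨g', hg', e, he, rfl⟩
      refine ⟨e, he, ?_⟩
      rw [QuotientGroup.eq] at hg'
      refine (orbit_mk_eq_iff H _ _).2 ⟨g'⁻¹ * g, hg', ?_⟩
      rw [smul_smul]
      simp
    · rintro ⟨e, he, rfl⟩
      exact ⟨g, rfl, e, he, rfl⟩
  have hSo : ∀ i, IsOpen (S i) := by
    intro i
    obtain ⟨g, rfl⟩ := QuotientGroup.mk_surjective i
    rw [hS]
    exact (hoq.isOpenMap.comp (isOpenMap_smul g⁻¹)) U hU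
  have hSs : ∀ i, (S i).SurjOn (quotientProj hq H) (q '' U) := by
    rintro i _ ⟨e, he, rfl⟩
    obtain ⟨g, rfl⟩ := QuotientGroup.mk_surjective i
    exact ⟨π (g⁻¹ • e), ⟨g, rfl, e, he, rfl⟩, (hpπ _).trans (hq.map_smul _)⟩
  have hne : Nonempty (M → MulAction.orbitRel.Quotient H E) := ⟨fun _ => π e₀⟩
  let _ : TopologicalSpace (G ⧸ H) := ⊥
  have _ : DiscreteTopology (G ⧸ H) := ⟨rfl⟩
  refine IsEvenlyCovered.to_isEvenlyCovered_preimage (I := G ⧸ H)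
    (IsEvenlyCovered.of_trivialization (t := IsOpen.trivializationDiscrete S (q '' U)
      (hqo.isOpenMap U hU) ?_ ?_ hSs ?_ ?_) ⟨e₀, he₀, rfl⟩)
  · intro i W hW
    refine ⟨fun h => (h.preimage hcont).inter (hSo i), fun h => ?_⟩
    have : W = quotientProj hq H '' (quotientProj hq H ⁻¹' W ∩ S i) := by
      ext m
      constructor
      · intro hm
        obtain ⟨x, hx, rfl⟩ := hSs i (hW hm)
        exact ⟨x, ⟨hm, hx⟩, rfl⟩
      · rintro ⟨x, hx, rfl⟩
        exact hx.1
    rw [this]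
    exact hopen _ h
  · intro i x hx y hy hxy
    obtain ⟨g, rfl⟩ := QuotientGroup.mk_surjective i
    rw [hS] at hx hy
    obtain ⟨e, he, rfl⟩ := hx
    obtain ⟨e', he', rfl⟩ := hy
    have : q (g⁻¹ • e) = q (g⁻¹ • e') := hxy
    rw [hq.map_smul, hq.map_smul] at this
    rw [hqU e he e' he' this]
  · intro i j hij
    rw [Function.onFun, Set.disjoint_left]
    rintro x ⟨g, rfl, e, he, rfl⟩ ⟨g', rfl, e', he', h⟩
    apply hij
    have hqe : q (g⁻¹ • e) = q (g'⁻¹ • e') := congrArg (quotientProj hq H) h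
    rw [hq.map_smul, hq.map_smul] at hqe
    obtain rfl := hqU e he e' he' hqe
    obtain ⟨k, hk, hk'⟩ := (orbit_mk_eq_iff H _ _).1 h
    rw [smul_smul] at hk'
    have := hq.smul_left_injective hk'
    rw [QuotientGroup.eq]
    have e2 : g⁻¹ * g' = k⁻¹ := by
      rw [eq_inv_iff_mul_eq_one, ← inv_inv g', ← this]
      group
    rw [e2]
    exact H.inv_mem hk
  · rintro x ⟨e, he, hx⟩
    obtain ⟨e', rfl⟩ := hoq.surjective x
    obtain ⟨k, hk⟩ := hq.apply_eq_iff_mem_orbit.1 (show q e' = q e from hx.symm)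
    refine Set.mem_iUnion.2 ⟨((k⁻¹ : G) : G ⧸ H), k⁻¹, rfl, e, he, ?_⟩
    rw [inv_inv]
    exact congrArg π hk.symm

/-- The space uniformized by `H` is the orbit space of `H`. -/
def IsUniformizedBy.homeomorph {N : Type} [TopologicalSpace N] {p : N → M} {H : Subgroup G}
    {f : E → N} (hf : IsUniformizedBy q p H f) : MulAction.orbitRel.Quotient H E ≃ₜ N :=
  (Homeomorph.Quotient.congr (rY := Setoid.ker f) (Homeomorph.refl E) fun e e' => by
    rw [← Quotient.eq, orbit_mk_eq_iff, Setoid.ker_def, ← hf.eq_iff]; rfl).trans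
    (Topology.IsQuotientMap.homeomorph (f := ⟨f, hf.isOpenQuotientMap.continuous⟩)
      hf.isOpenQuotientMap.isQuotientMap)

omit [TopologicalSpace M] in
theorem IsUniformizedBy.homeomorph_mk {N : Type} [TopologicalSpace N] {p : N → M}
    {H : Subgroup G} {f : E → N} (hf : IsUniformizedBy q p H f) (e : E) :
    hf.homeomorph (Quotient.mk _ e) = f e := rfl

/-- The sheets of a uniformized covering correspond to the cosets of the subgroup. -/
theorem IsUniformizedBy.card_fiber (hq : IsQuotientCoveringMap q G) {N : Type}
    [TopologicalSpace N] {p : N → M} {H : Subgroup G} {f : E → N}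
    (hf : IsUniformizedBy q p H f) (m : M) : Nat.card (p ⁻¹' {m}) = H.index := by
  obtain ⟨e, rfl⟩ := hq.surjective m
  have hp : ∀ e, p (f e) = q e := congrFun hf.comp_eq
  have key : ∀ g g' : G, f (g⁻¹ • e) = f (g'⁻¹ • e) ↔ (g : G ⧸ H) = g' := by
    intro g g'
    rw [hf.eq_iff, QuotientGroup.eq]
    constructor
    · rintro ⟨h, hh, hhe⟩
      rw [smul_smul] at hhe
      have := hq.smul_left_injective hhe
      have e2 : g⁻¹ * g' = h⁻¹ := by
        rw [eq_inv_iff_mul_eq_one, ← inv_inv g', ← this]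
        group
      rw [e2]
      exact H.inv_mem hh
    · intro h
      refine ⟨(g⁻¹ * g')⁻¹, H.inv_mem h, ?_⟩
      rw [smul_smul]
      simp
  let F : G ⧸ H → p ⁻¹' {q e} := Quotient.lift
    (fun g : G => ⟨f (g⁻¹ • e), by
      rw [Set.mem_preimage, hp, hq.map_smul]; rfl⟩)
    (fun g g' h => Subtype.ext ((key g g').2 (Quotient.sound h)))
  have hF : Function.Bijective F := by
    constructor
    · intro x y hxy
      obtain ⟨g, rfl⟩ := QuotientGroup.mk_surjective x
      obtain ⟨g', rfl⟩ := QuotientGroup.mk_surjective y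
      exact (key g g').1 (congrArg Subtype.val hxy)
    · rintro ⟨x, hx⟩
      obtain ⟨e', rfl⟩ := hf.isOpenQuotientMap.surjective x
      rw [Set.mem_preimage, hp] at hx
      obtain ⟨g, rfl⟩ := hq.apply_eq_iff_mem_orbit.1 hx
      exact ⟨((g⁻¹ : G) : G ⧸ H), Subtype.ext (by change f (g⁻¹⁻¹ • e) = _; rw [inv_inv])⟩
  rw [Subgroup.index]
  exact (Nat.card_congr (Equiv.ofBijective F hF)).symm

/-- Translating the uniformization conjugates the subgroup. -/
theorem IsUniformizedBy.smul (hq : IsQuotientCoveringMap q G) {N : Type} [TopologicalSpace N]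
    {p : N → M} {H : Subgroup G} {f : E → N} (g : G)
    (hf : IsUniformizedBy q p (H.map (MulAut.conj g).toMonoidHom) f) :
    IsUniformizedBy q p H (fun e => f (g • e)) where
  isOpenQuotientMap := by
    have := hq.toContinuousConstSMul
    exact hf.isOpenQuotientMap.comp (Homeomorph.smul g).isOpenQuotientMap
  comp_eq := by
    ext e
    exact (congrFun hf.comp_eq (g • e)).trans (hq.map_smul g)
  eq_iff e e' := by
    rw [hf.eq_iff]
    constructor
    · rintro ⟨_, ⟨h, hh, rfl⟩, hhe⟩
      refine ⟨h, hh, ?_⟩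
      simpa [mul_smul] using hhe
    · rintro ⟨h, hh, rfl⟩
      refine ⟨_, ⟨h, hh, rfl⟩, ?_⟩
      simp [mul_smul]

variable [SimplyConnectedSpace E] [LocallyPathConnectedSpace E]

/-- Every connected covering is uniformized by the universal cover. -/
theorem exists_isUniformizedBy (hq : IsQuotientCoveringMap q G) {N : Type} [TopologicalSpace N]
    [ConnectedSpace N] {p : N → M} (hp : IsCoveringMap p) :
    ∃ (H : Subgroup G) (f : E → N), IsUniformizedBy q p H f := by
  have hcs := hq.toContinuousConstSMul
  have hlift : ∀ (e : E) (x : N), p x = q e → ∃ F : C(E, N), F e = x ∧ p ∘ F = q := by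
    intro e x h
    obtain ⟨F, hF, -⟩ := hp.existsUnique_continuousMap_lifts
      (⟨q, hq.isCoveringMap.continuous⟩ : C(E, M)) e x h
    exact ⟨F, hF⟩
  have hopen : ∀ F : C(E, N), p ∘ F = q → IsOpenMap F := fun F hF =>
    (IsLocalHomeomorph.of_comp (by rw [hF]; exact hq.isCoveringMap.isLocalHomeomorph)
      hp.isLocalHomeomorph F.continuous).isOpenMap
  have huniq : ∀ (F F' : E → N), Continuous F → Continuous F' → p ∘ F = q → p ∘ F' = q →
      ∀ e, F e = F' e → F = F' := fun F F' hF hF' h h' e he =>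
    hp.eq_of_comp_eq hF hF' (h.trans h'.symm) e he
  have hsmul : ∀ (F : C(E, N)) (g : G), p ∘ F = q → p ∘ (fun e => F (g • e)) = q := by
    intro F g hF
    ext e
    exact (congrFun hF (g • e)).trans (hq.map_smul g)
  obtain ⟨x₀⟩ := (inferInstance : Nonempty N)
  obtain ⟨e₀, he₀⟩ := hq.surjective (p x₀)
  obtain ⟨F, hFe, hF⟩ := hlift e₀ x₀ he₀.symm
  -- Two lifts of `q` with a common value differ by an element of `G`, by uniqueness of lifts.
  have htrans : ∀ (F' : C(E, N)), p ∘ F' = q → ∀ e e', F e = F' e' →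
      ∃ g : G, (F : E → N) = fun e => F' (g • e) := by
    intro F' hF' e e' h
    have : q e' = q e := by
      rw [← congrFun hF e, ← congrFun hF' e', Function.comp_apply, Function.comp_apply, h]
    obtain ⟨g, hg⟩ := hq.apply_eq_iff_mem_orbit.1 this
    refine ⟨g, huniq _ _ F.continuous (F'.continuous.comp (continuous_const_smul g)) hF
      (hsmul F' g hF') e ?_⟩
    have hg' : g • e = e' := hg
    rw [hg', h]
  -- A point missed by `F` lies in the open image of another lift. If the two images met, `htrans`
  -- would make the lifts translates of each other and the point would be hit by `F`.
  have hclopen : IsClopen (Set.range F) := by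
    refine ⟨⟨?_⟩, (hopen F hF).isOpen_range⟩
    rw [isOpen_iff_forall_mem_open]
    intro x hx
    obtain ⟨e, he⟩ := hq.surjective (p x)
    obtain ⟨F', hF'e, hF'⟩ := hlift e x he.symm
    refine ⟨Set.range F', ?_, (hopen F' hF').isOpen_range, e, hF'e⟩
    rintro _ ⟨e', rfl⟩ ⟨e'', he''⟩
    obtain ⟨g, hg⟩ := htrans F' hF' e'' e' he''
    apply hx
    refine ⟨g⁻¹ • e, ?_⟩
    rw [hg]
    simpa using hF'e
  have hsurj : Function.Surjective F := by
    rw [← Set.range_eq_univ]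
    exact hclopen.eq_univ ⟨F e₀, e₀, rfl⟩
  -- The elements of `G` that leave the lift `F` unchanged.
  let H : Subgroup G :=
    { carrier := {g | ∀ e, F (g • e) = F e}
      mul_mem' := fun {a b} ha hb e => by rw [mul_smul, ha, hb]
      one_mem' := fun e => by rw [one_smul]
      inv_mem' := fun {a} ha e => by rw [← ha (a⁻¹ • e), smul_inv_smul] }
  refine ⟨H, F, ⟨⟨hsurj, F.continuous, hopen F hF⟩, hF, fun e e' => ⟨fun h => ?_, ?_⟩⟩⟩
  · have : q e' = q e := by
      rw [← congrFun hF e, ← congrFun hF e', Function.comp_apply, Function.comp_apply, h]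
    obtain ⟨g, hg⟩ := hq.apply_eq_iff_mem_orbit.1 this
    have hg' : g • e = e' := hg
    refine ⟨g, fun x => ?_, hg'⟩
    have := huniq (fun x => F (g • x)) F (F.continuous.comp (continuous_const_smul g))
      F.continuous (hsmul F g hF) hF e (by rw [hg', h])
    exact congrFun this x
  · rintro ⟨h, hh, rfl⟩
    exact (hh e).symm

omit [LocallyPathConnectedSpace E] in
/-- Uniformized coverings are equivalent iff the subgroups are conjugate. -/
theorem exists_homeomorph_iff_conj (hq : IsQuotientCoveringMap q G) {N N' : Type}
    [TopologicalSpace N] [TopologicalSpace N'] {p : N → M} {p' : N' → M}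
    (hp' : IsCoveringMap p') {H H' : Subgroup G} {f : E → N} {f' : E → N'}
    (hf : IsUniformizedBy q p H f) (hf' : IsUniformizedBy q p' H' f') :
    (∃ h : N ≃ₜ N', p = p' ∘ h) ↔ subgroupConj G H H' := by
  have hcs := hq.toContinuousConstSMul
  constructor
  · rintro ⟨h, hh⟩
    obtain ⟨e₀⟩ := (inferInstance : Nonempty E)
    obtain ⟨e₁, he₁⟩ := hf'.isOpenQuotientMap.surjective (h (f e₀))
    have hqe : q e₁ = q e₀ := by
      rw [← congrFun hf'.comp_eq e₁, ← congrFun hf.comp_eq e₀, Function.comp_apply, he₁, hh]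
      rfl
    obtain ⟨g, hg⟩ := hq.apply_eq_iff_mem_orbit.1 hqe
    have hg' : g • e₀ = e₁ := hg
    -- Both sides are lifts of `q` through `p'`, and they agree at `e₀`.
    have hfun : (fun e => h (f e)) = fun e => f' (g • e) := by
      refine hp'.eq_of_comp_eq (h.continuous.comp hf.isOpenQuotientMap.continuous)
        (hf'.isOpenQuotientMap.continuous.comp (continuous_const_smul g)) ?_ e₀ ?_
      · ext e
        have h1 : p' (h (f e)) = p (f e) := by rw [hh]; rfl
        have h2 : p (f e) = q e := congrFun hf.comp_eq e
        have h3 : p' (f' (g • e)) = q (g • e) := congrFun hf'.comp_eq _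
        change p' (h (f e)) = p' (f' (g • e))
        rw [h1, h2, h3, hq.map_smul]
      · simp only [hg', he₁]
    refine ⟨g, ?_⟩
    -- Since the action is free, membership in `H` or `H'` can be tested on a single orbit point.
    ext k
    rw [Subgroup.mem_map_equiv]
    have hk1 : k ∈ H' ↔ f' (g • e₀) = f' (k • g • e₀) := by
      rw [hf'.eq_iff]
      exact ⟨fun hk => ⟨k, hk, rfl⟩, fun ⟨k', hk', h⟩ => hq.smul_left_injective h ▸ hk'⟩
    have hk2 : (MulAut.conj g).symm k ∈ H ↔ f e₀ = f ((MulAut.conj g).symm k • e₀) := by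
      rw [hf.eq_iff]
      exact ⟨fun hk => ⟨_, hk, rfl⟩, fun ⟨k', hk', h⟩ => hq.smul_left_injective h ▸ hk'⟩
    rw [hk1, hk2, ← h.injective.eq_iff, congrFun hfun e₀,
      congrFun hfun ((MulAut.conj g).symm k • e₀)]
    simp [mul_smul]
  · rintro ⟨g, rfl⟩
    have h2 := hf'.smul hq g
    refine ⟨hf.homeomorph.symm.trans h2.homeomorph, ?_⟩
    ext x
    obtain ⟨e, rfl⟩ := hf.isOpenQuotientMap.surjective x
    rw [← hf.homeomorph_mk e]
    have h3 : (hf.homeomorph.symm.trans h2.homeomorph) (hf.homeomorph (Quotient.mk _ e)) =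
        f' (g • e) := by
      rw [Homeomorph.trans_apply, Homeomorph.symm_apply_apply, h2.homeomorph_mk]
    rw [Function.comp_apply, h3, hf.homeomorph_mk]
    exact (congrFun hf.comp_eq e).trans (congrFun h2.comp_eq e).symm

/-- The classification of finite coverings by a space `X` in terms of subgroups. -/
theorem hasCount_coveringClasses_iff (hq : IsQuotientCoveringMap q G) (X : Type)
    [TopologicalSpace X] (n : ℕ) (c : ℚ) :
    HasCount (coveringClasses X M n) c ↔
      HasCount (Quotient.mk (subgroupConj G) '' {H : Subgroup G |
        H.index = n ∧ Nonempty (MulAction.orbitRel.Quotient H E ≃ₜ X)}) c := by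
  refine hasCount_iff_of_rel _ _
    (fun (N : FoldCovering M n) H => ∃ f : E → N.total, IsUniformizedBy q N.proj H f) ?_ ?_ ?_ c
  · rintro N ⟨φ⟩
    have := N.connected
    obtain ⟨H, f, hf⟩ := exists_isUniformizedBy hq N.isCoveringMap
    refine ⟨H, ⟨?_, ⟨hf.homeomorph.trans φ⟩⟩, f, hf⟩
    obtain ⟨e⟩ := (inferInstance : Nonempty E)
    rw [← hf.card_fiber hq (q e), N.card_fiber]
  · rintro H ⟨hH, ⟨φ⟩⟩
    have hf := isUniformizedBy_quotientProj hq H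
    refine ⟨⟨MulAction.orbitRel.Quotient H E, hf.isOpenQuotientMap.surjective.connectedSpace
      hf.isOpenQuotientMap.continuous, quotientProj hq H, isCoveringMap_quotientProj hq H,
      fun m => by rw [hf.card_fiber hq, hH]⟩, ⟨φ⟩, _, hf⟩
  · rintro N H N' H' ⟨f, hf⟩ ⟨f', hf'⟩
    exact exists_homeomorph_iff_conj hq N'.isCoveringMap hf hf'

omit [LocallyPathConnectedSpace E] in
/-- The fundamental group of a space homeomorphic to `E / H` is `H`. -/
theorem nonempty_fundamentalGroup_mulEquiv (hq : IsQuotientCoveringMap q G) {X : Type}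
    [TopologicalSpace X] (φ : M ≃ₜ X) (x : X) : Nonempty (FundamentalGroup X x ≃* G) := by
  have h := hq.homeomorph_comp φ
  obtain ⟨e, he⟩ := h.surjective x
  -- The loops give the opposite group of `G`; inversion identifies it with `G`.
  exact ⟨(h.fundamentalGroupEquiv ⟨e, he⟩).trans (MulEquiv.inv' G).symm⟩

end Coverings

/-! ### The group `ℤ³` with the twisted multiplication of `π₁(ℬ₃)` -/

/-- The sign `(-1) ^ k`. -/
def altSign (k : ℤ) : ℤ := if Even k then 1 else -1

theorem altSign_even {k : ℤ} (h : Even k) : altSign k = 1 := if_pos h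

theorem altSign_odd {k : ℤ} (h : ¬ Even k) : altSign k = -1 := if_neg h

@[simp] theorem altSign_zero : altSign 0 = 1 := by simp [altSign]

@[simp] theorem altSign_one : altSign 1 = -1 := by simp [altSign]

theorem altSign_eq (k : ℤ) : altSign k = 1 ∨ altSign k = -1 := by
  unfold altSign; split_ifs <;> simp

@[simp] theorem altSign_neg (k : ℤ) : altSign (-k) = altSign k := by simp [altSign]

theorem altSign_add (k l : ℤ) : altSign (k + l) = altSign k * altSign l := by
  unfold altSign
  by_cases hk : Even k <;> by_cases hl : Even l <;> simp [Int.even_add, hk, hl]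

theorem altSign_sub (k l : ℤ) : altSign (k - l) = altSign k * altSign l := by
  rw [sub_eq_add_neg, altSign_add, altSign_neg]

@[simp] theorem altSign_mul_self (k : ℤ) : altSign k * altSign k = 1 := by
  rcases altSign_eq k with h | h <;> simp [h]

@[simp] theorem altSign_altSign_mul (k l : ℤ) : altSign (altSign k * l) = altSign l := by
  rcases altSign_eq k with h | h <;> simp [h]

@[simp] theorem altSign_two_mul (k : ℤ) : altSign (2 * k) = 1 := by simp [altSign]

/-- The element `(a, b, c)` stands for `S₁ ^ a * S₂ ^ b * S₃ ^ c` in the fundamental group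
of `ℬ₃`. -/
@[ext] structure B3Group where
  a : ℤ
  b : ℤ
  c : ℤ

namespace B3Group

/-- S₂ inverts S₁, and S₃ inverts both S₁ and S₂. Moving a power of S₁ past S₂^b S₃^c therefore
costs the sign (-1)^(b+c), and moving a power of S₂ past S₃^c costs (-1)^c. -/
instance : Mul B3Group :=
  ⟨fun g h => ⟨g.a + altSign (g.b + g.c) * h.a, g.b + altSign g.c * h.b, g.c + h.c⟩⟩

instance : One B3Group := ⟨⟨0, 0, 0⟩⟩

instance : Inv B3Group :=
  ⟨fun g => ⟨-(altSign (g.b + g.c) * g.a), -(altSign g.c * g.b), -g.c⟩⟩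

@[simp] theorem mul_a (g h : B3Group) : (g * h).a = g.a + altSign (g.b + g.c) * h.a := rfl

@[simp] theorem mul_b (g h : B3Group) : (g * h).b = g.b + altSign g.c * h.b := rfl

@[simp] theorem mul_c (g h : B3Group) : (g * h).c = g.c + h.c := rfl

@[simp] theorem one_a : (1 : B3Group).a = 0 := rfl

@[simp] theorem one_b : (1 : B3Group).b = 0 := rfl

@[simp] theorem one_c : (1 : B3Group).c = 0 := rfl

@[simp] theorem inv_a (g : B3Group) : (g⁻¹).a = -(altSign (g.b + g.c) * g.a) := rfl

@[simp] theorem inv_b (g : B3Group) : (g⁻¹).b = -(altSign g.c * g.b) := rfl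

@[simp] theorem inv_c (g : B3Group) : (g⁻¹).c = -g.c := rfl

instance : Group B3Group :=
  Group.ofLeftAxioms
    (fun g h k => by
      ext
      · simp only [mul_a, mul_b, mul_c, altSign_add, altSign_altSign_mul]
        ring
      · simp only [mul_b, mul_c, altSign_add]
        ring
      · simp only [mul_c]
        ring)
    (fun g => by ext <;> simp)
    (fun g => by
      ext
      · simp only [mul_a, inv_a, inv_b, inv_c, one_a, altSign_add, altSign_neg,
          altSign_altSign_mul]
        ring
      · simp only [mul_b, inv_b, inv_c, one_b, altSign_neg]
        ring
      · simp)

instance : MulAction B3Group (ℝ × ℝ × ℝ) where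
  smul g v := ((altSign (g.b + g.c) : ℝ) * v.1 + g.a, (altSign g.c : ℝ) * v.2.1 + g.b, v.2.2 + g.c)
  one_smul v := by
    change ((altSign (0 + 0) : ℝ) * v.1 + ((0 : ℤ) : ℝ), (altSign 0 : ℝ) * v.2.1 + ((0 : ℤ) : ℝ),
      v.2.2 + ((0 : ℤ) : ℝ)) = v
    simp
  mul_smul g h v := by
    change ((altSign ((g * h).b + (g * h).c) : ℝ) * v.1 + (g * h).a,
      (altSign (g * h).c : ℝ) * v.2.1 + (g * h).b, v.2.2 + (g * h).c) =
      ((altSign (g.b + g.c) : ℝ) * ((altSign (h.b + h.c) : ℝ) * v.1 + h.a) + g.a,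
       (altSign g.c : ℝ) * ((altSign h.c : ℝ) * v.2.1 + h.b) + g.b, v.2.2 + h.c + g.c)
    simp only [mul_a, mul_b, mul_c, altSign_add, altSign_altSign_mul, Prod.mk.injEq]
    push_cast
    exact ⟨by ring, by ring, by ring⟩

theorem smul_def (g : B3Group) (v : ℝ × ℝ × ℝ) :
    g • v = ((altSign (g.b + g.c) : ℝ) * v.1 + g.a, (altSign g.c : ℝ) * v.2.1 + g.b,
      v.2.2 + g.c) := rfl

instance : ContinuousConstSMul B3Group (ℝ × ℝ × ℝ) where
  continuous_const_smul g := by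
    simp only [smul_def]
    fun_prop

/-- Every point has a neighbourhood which is moved off itself by all nontrivial elements. -/
theorem exists_nhds_disjoint (v : ℝ × ℝ × ℝ) :
    ∃ U ∈ nhds v, ∀ g : B3Group, ((g • ·) '' U ∩ U).Nonempty → g = 1 := by
  have hlt : ∀ (r s t : ℝ) (k : ℤ), |s - r| < 1 / 2 → |t - r| < 1 / 2 → t = s + k → k = 0 := by
    intro r s t k h1 h2 h3
    have : |(k : ℝ)| < 1 := by
      rw [abs_lt] at *
      constructor <;> linarith
    exact Int.abs_lt_one_iff.1 (by exact_mod_cast this)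
  refine ⟨{w | |w.1 - v.1| < 1 / 2 ∧ |w.2.1 - v.2.1| < 1 / 2 ∧ |w.2.2 - v.2.2| < 1 / 2}, ?_, ?_⟩
  · refine IsOpen.mem_nhds ?_ (by norm_num)
    have hopen : ∀ (f : ℝ × ℝ × ℝ → ℝ) (r : ℝ), Continuous f → IsOpen {w | |f w - r| < 1 / 2} :=
      fun f r hf => isOpen_lt (hf.sub continuous_const).abs continuous_const
    exact (hopen _ v.1 continuous_fst).inter
      ((hopen _ v.2.1 continuous_snd.fst).inter (hopen _ v.2.2 continuous_snd.snd))
  · rintro g ⟨_, ⟨w, ⟨h1, h2, h3⟩, rfl⟩, h1', h2', h3'⟩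
    simp only [smul_def] at h1' h2' h3'
    -- Points of the box whose coordinates differ by an integer agree there. The order c, b, a
    -- matters: each vanishing entry removes the sign from the next coordinate.
    have hc : g.c = 0 := hlt _ _ _ _ h3 h3' rfl
    simp only [hc, altSign_zero, Int.cast_one, one_mul] at h2'
    have hb : g.b = 0 := hlt _ _ _ _ h2 h2' rfl
    simp only [hc, hb, add_zero, altSign_zero, Int.cast_one, one_mul] at h1'
    have ha : g.a = 0 := hlt _ _ _ _ h1 h1' rfl
    ext <;> assumption

instance (H : Subgroup B3Group) : ContinuousConstSMul H (ℝ × ℝ × ℝ) :=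
  ⟨fun h => continuous_const_smul (h : B3Group)⟩

theorem isQuotientCoveringMap (H : Subgroup B3Group) :
    IsQuotientCoveringMap (Quotient.mk (MulAction.orbitRel H (ℝ × ℝ × ℝ))) H where
  toIsQuotientMap := isQuotientMap_quotient_mk'
  continuous_const_smul := continuous_const_smul
  apply_eq_iff_mem_orbit := Quotient.eq''
  disjoint v := by
    obtain ⟨U, hU, h⟩ := exists_nhds_disjoint v
    exact ⟨U, hU, fun g hg => Subtype.ext (h g hg)⟩

/-- The orbit space of a subgroup of `π₁(ℬ₃)`. -/
abbrev Orb (H : Subgroup B3Group) : Type := MulAction.orbitRel.Quotient H (ℝ × ℝ × ℝ)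

/-- Both groups are the fundamental group of `Orb K`. -/
theorem nonempty_mulEquiv_of_homeomorph {H K : Subgroup B3Group} (φ : Orb H ≃ₜ Orb K) :
    Nonempty (H ≃* K) := by
  let x : Orb K := Quotient.mk _ 0
  obtain ⟨e⟩ := nonempty_fundamentalGroup_mulEquiv (isQuotientCoveringMap H) φ x
  obtain ⟨e'⟩ := nonempty_fundamentalGroup_mulEquiv (isQuotientCoveringMap K) (Homeomorph.refl _) x
  exact ⟨e.symm.trans e'⟩

end B3Group

/-! ### Homeomorphisms between orbit spaces -/

theorem exists_smul_of_mem_closure {G G' E E' : Type*} [Group G] [Group G'] [MulAction G E]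
    [MulAction G' E'] (φ : E → E') {S : Set G} {K : Subgroup G'}
    (h : ∀ s ∈ S, ∃ k ∈ K, ∀ e, φ (s • e) = k • φ e) {g : G} (hg : g ∈ Subgroup.closure S) :
    ∃ k ∈ K, ∀ e, φ (g • e) = k • φ e := by
  induction hg using Subgroup.closure_induction with
  | mem s hs => exact h s hs
  | one => exact ⟨1, K.one_mem, fun e => by simp⟩
  | mul x y _ _ hx hy =>
    obtain ⟨k, hk, h1⟩ := hx
    obtain ⟨l, hl, h2⟩ := hy
    exact ⟨k * l, K.mul_mem hk hl, fun e => by rw [mul_smul, h1, h2, mul_smul]⟩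
  | inv x _ hx =>
    obtain ⟨k, hk, h1⟩ := hx
    refine ⟨k⁻¹, K.inv_mem hk, fun e => ?_⟩
    rw [eq_inv_smul_iff, ← h1, smul_inv_smul]

/-- A homeomorphism which conjugates generators of two groups to elements of the other group
induces a homeomorphism of the orbit spaces. -/
theorem nonempty_orbit_homeomorph {G G' E E' : Type} [Group G] [Group G'] [TopologicalSpace E]
    [TopologicalSpace E'] [MulAction G E] [MulAction G' E'] (φ : E ≃ₜ E') {S : Set G} {T : Set G'}
    {H : Subgroup G} {K : Subgroup G'} (hH : H = Subgroup.closure S) (hK : K = Subgroup.closure T)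
    (h : ∀ s ∈ S, ∃ k ∈ K, ∀ e, φ (s • e) = k • φ e)
    (h' : ∀ t ∈ T, ∃ g ∈ H, ∀ e, φ (g • e) = t • φ e) :
    Nonempty (MulAction.orbitRel.Quotient H E ≃ₜ MulAction.orbitRel.Quotient K E') := by
  refine ⟨Homeomorph.Quotient.congr φ fun x y => ?_⟩
  constructor
  · rintro ⟨⟨g, hg⟩, hgx⟩
    have hgx' : g • y = x := hgx
    obtain ⟨k, hk, hk'⟩ := exists_smul_of_mem_closure φ h (hH ▸ hg)
    exact ⟨⟨k, hk⟩, by rw [← hgx', hk']; rfl⟩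
  · rintro ⟨⟨k, hk⟩, hkx⟩
    have hkx' : k • φ y = φ x := hkx
    obtain ⟨g, hg, hg'⟩ := exists_smul_of_mem_closure (K := H) φ.symm (fun t ht => by
      obtain ⟨g, hg, hg'⟩ := h' t ht
      exact ⟨g, hg, fun e => by rw [φ.symm_apply_eq, hg', φ.apply_symm_apply]⟩) (hK ▸ hk)
    refine ⟨⟨g, hg⟩, ?_⟩
    change g • y = x
    have := hg' (φ y)
    rw [φ.symm_apply_apply, hkx', φ.symm_apply_apply] at this
    exact this.symm

/-- The triangular affine map `(αx + βy + γz + δ, εy + ζz + η, θz)`. -/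
def triangularHomeomorph (α β γ δ ε ζ η θ : ℝ) (hα : α ≠ 0) (hε : ε ≠ 0) (hθ : θ ≠ 0) :
    (ℝ × ℝ × ℝ) ≃ₜ (ℝ × ℝ × ℝ) where
  toFun v := (α * v.1 + β * v.2.1 + γ * v.2.2 + δ, ε * v.2.1 + ζ * v.2.2 + η, θ * v.2.2)
  invFun v := ((v.1 - β * ((v.2.1 - ζ * (v.2.2 / θ) - η) / ε) - γ * (v.2.2 / θ) - δ) / α,
    (v.2.1 - ζ * (v.2.2 / θ) - η) / ε, v.2.2 / θ)
  left_inv v := by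
    ext
    · simp only
      field_simp
      ring
    · simp only
      field_simp
      ring
    · simp only
      field_simp
  right_inv v := by
    ext
    · simp only
      field_simp
      ring
    · simp only
      field_simp
      ring
    · simp only
      field_simp
  continuous_toFun := by fun_prop
  continuous_invFun := by fun_prop

theorem triangularHomeomorph_apply (α β γ δ ε ζ η θ : ℝ) (hα : α ≠ 0) (hε : ε ≠ 0) (hθ : θ ≠ 0)
    (v : ℝ × ℝ × ℝ) : triangularHomeomorph α β γ δ ε ζ η θ hα hε hθ v =
      (α * v.1 + β * v.2.1 + γ * v.2.2 + δ, ε * v.2.1 + ζ * v.2.2 + η, θ * v.2.2) := rfl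

/-- The permutation `(x, y, z) ↦ (x, z, y)` of the coordinates. -/
def swapHomeomorph : (ℝ × ℝ × ℝ) ≃ₜ (ℝ × ℝ × ℝ) where
  toFun v := (v.1, v.2.2, v.2.1)
  invFun v := (v.1, v.2.2, v.2.1)
  left_inv v := rfl
  right_inv v := rfl
  continuous_toFun := by fun_prop
  continuous_invFun := by fun_prop

theorem swapHomeomorph_apply (v : ℝ × ℝ × ℝ) : swapHomeomorph v = (v.1, v.2.2, v.2.1) := rfl

/-- The permutation `(x, y, z) ↦ (z, x, y)` of the coordinates. -/
def cycleHomeomorph : (ℝ × ℝ × ℝ) ≃ₜ (ℝ × ℝ × ℝ) where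
  toFun v := (v.2.2, v.1, v.2.1)
  invFun v := (v.2.1, v.2.2, v.1)
  left_inv v := rfl
  right_inv v := rfl
  continuous_toFun := by fun_prop
  continuous_invFun := by fun_prop

theorem cycleHomeomorph_apply (v : ℝ × ℝ × ℝ) : cycleHomeomorph v = (v.2.2, v.1, v.2.1) := rfl

/-- Euclidean space in coordinates. -/
def coordHomeomorph : E3 ≃ₜ (ℝ × ℝ × ℝ) where
  toFun v := (v 0, v 1, v 2)
  invFun w := !₂[w.1, w.2.1, w.2.2]
  left_inv v := by
    ext i
    fin_cases i <;> rfl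
  right_inv w := rfl
  continuous_toFun := by fun_prop
  continuous_invFun := by
    refine (PiLp.continuous_toLp 2 _).comp (continuous_pi fun i => ?_)
    fin_cases i
    · exact continuous_fst
    · exact continuous_snd.fst
    · exact continuous_snd.snd

theorem coordHomeomorph_signedShift (s : Fin 3 → ℤˣ) (t : Fin 3 → ℝ) (v : E3) :
    coordHomeomorph (signedShift s t • v) =
      (((s 0 : ℤ) : ℝ) * (coordHomeomorph v).1 + t 0,
       ((s 1 : ℤ) : ℝ) * (coordHomeomorph v).2.1 + t 1,
       ((s 2 : ℤ) : ℝ) * (coordHomeomorph v).2.2 + t 2) := rfl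

namespace B3Group

/-! ### Bases of subgroups of finite index -/

theorem zpow_c (g : B3Group) (m : ℤ) : (g ^ m).c = m * g.c := by
  induction m using Int.induction_on with
  | zero => simp
  | succ n ih => rw [zpow_add_one, mul_c, ih]; ring
  | pred n ih => rw [zpow_sub_one, mul_c, inv_c, ih]; ring

theorem zpow_b {g : B3Group} (hg : g.c = 0) (m : ℤ) : (g ^ m).b = m * g.b := by
  induction m using Int.induction_on with
  | zero => simp
  | succ n ih => rw [zpow_add_one, mul_b, ih, zpow_c, hg]; simp; ring
  | pred n ih => rw [zpow_sub_one, mul_b, inv_b, ih, zpow_c, hg]; simp; ring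

theorem zpow_a_of_even {g : B3Group} (hc : g.c = 0) (hb : Even g.b) (m : ℤ) :
    (g ^ m).a = m * g.a := by
  induction m using Int.induction_on with
  | zero => simp
  | succ n ih =>
    rw [zpow_add_one, mul_a, ih, zpow_c, zpow_b hc, hc, mul_zero, add_zero,
      altSign_even (hb.mul_left _)]
    ring
  | pred n ih =>
    rw [zpow_sub_one, mul_a, inv_a, ih, zpow_c, zpow_b hc, hc, mul_zero, add_zero,
      altSign_even (hb.mul_left _), add_zero, altSign_even hb]
    ring

/-- Such an element reverses the first axis, so in its square the shifts along this axis cancel. -/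
theorem zpow_two_mul_a_of_odd {g : B3Group} (hc : g.c = 0) (hb : ¬ Even g.b) (m : ℤ) :
    (g ^ (2 * m)).a = 0 := by
  have h2 : (g ^ (2 : ℤ)).c = 0 := by rw [zpow_c, hc, mul_zero]
  have h2b : (g ^ (2 : ℤ)).b = 2 * g.b := zpow_b hc 2
  rw [zpow_mul, zpow_a_of_even h2 (by rw [h2b]; exact even_two_mul _)]
  have : (g ^ (2 : ℤ)).a = 0 := by
    rw [zpow_ofNat, pow_two, mul_a, hc, add_zero, altSign_odd hb]
    ring
  rw [this, mul_zero]

theorem zpow_shift (A k : ℤ) : (⟨A, 0, 0⟩ : B3Group) ^ k = ⟨k * A, 0, 0⟩ := by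
  ext
  · exact zpow_a_of_even rfl (by simp) k
  · rw [zpow_b rfl]; simp
  · rw [zpow_c]; simp

/-- The subgroup `H` has the basis `(A, 0, 0)`, `(u, B, 0)`, `(v, w, C)` in Hermite form. -/
structure HasBasis (H : Subgroup B3Group) (A B C u w v : ℤ) : Prop where
  A_pos : 0 < A
  B_pos : 0 < B
  C_pos : 0 < C
  mem_fst : (⟨A, 0, 0⟩ : B3Group) ∈ H
  mem_snd : (⟨u, B, 0⟩ : B3Group) ∈ H
  mem_trd : (⟨v, w, C⟩ : B3Group) ∈ H
  dvd_c : ∀ g ∈ H, C ∣ g.c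
  dvd_b : ∀ g ∈ H, g.c = 0 → B ∣ g.b
  dvd_a : ∀ g ∈ H, g.c = 0 → g.b = 0 → A ∣ g.a

namespace HasBasis

variable {H K : Subgroup B3Group} {A B C u w v u' w' v' : ℤ}

/-- Right multiplication by powers of the basis elements kills the entry c, then b, then a; at each
stage the corresponding divisibility supplies the exponent. -/
theorem exists_eq (h : HasBasis H A B C u w v) {g : B3Group} (hg : g ∈ H) :
    ∃ k l m : ℤ, g = ⟨A, 0, 0⟩ ^ k * ⟨u, B, 0⟩ ^ l * ⟨v, w, C⟩ ^ m := by
  obtain ⟨m, hm⟩ := h.dvd_c g hg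
  set g₁ := g * (⟨v, w, C⟩ : B3Group) ^ (-m) with hg₁
  have h₁ : g₁ ∈ H := H.mul_mem hg (H.zpow_mem h.mem_trd _)
  have h₁c : g₁.c = 0 := by rw [hg₁, mul_c, zpow_c, hm]; simp only; ring
  obtain ⟨l, hl⟩ := h.dvd_b g₁ h₁ h₁c
  set g₂ := g₁ * (⟨u, B, 0⟩ : B3Group) ^ (-l) with hg₂
  have h₂ : g₂ ∈ H := H.mul_mem h₁ (H.zpow_mem h.mem_snd _)
  have h₂c : g₂.c = 0 := by rw [hg₂, mul_c, zpow_c, h₁c]; simp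
  have h₂b : g₂.b = 0 := by rw [hg₂, mul_b, zpow_b rfl, h₁c, hl, altSign_zero]; ring
  obtain ⟨k, hk⟩ := h.dvd_a g₂ h₂ h₂c h₂b
  refine ⟨k, l, m, ?_⟩
  have e : (⟨A, 0, 0⟩ : B3Group) ^ k = g₂ := by
    rw [zpow_shift]
    ext
    · rw [hk, mul_comm]
    · exact h₂b.symm
    · exact h₂c.symm
  rw [e, hg₂, hg₁]
  simp [mul_assoc]

theorem eq_closure (h : HasBasis H A B C u w v) :
    H = Subgroup.closure {⟨A, 0, 0⟩, ⟨u, B, 0⟩, ⟨v, w, C⟩} := by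
  apply le_antisymm
  · intro g hg
    obtain ⟨k, l, m, rfl⟩ := h.exists_eq hg
    refine Subgroup.mul_mem _ (Subgroup.mul_mem _ ?_ ?_) ?_ <;>
    exact Subgroup.zpow_mem _ (Subgroup.subset_closure (by simp)) _
  · rw [Subgroup.closure_le]
    rintro g (rfl | rfl | rfl)
    exacts [h.mem_fst, h.mem_snd, h.mem_trd]

theorem le (h : HasBasis H A B C u w v) (h₁ : (⟨A, 0, 0⟩ : B3Group) ∈ K)
    (h₂ : (⟨u, B, 0⟩ : B3Group) ∈ K) (h₃ : (⟨v, w, C⟩ : B3Group) ∈ K) : H ≤ K := by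
  rw [h.eq_closure, Subgroup.closure_le]
  rintro g (rfl | rfl | rfl)
  exacts [h₁, h₂, h₃]

theorem congr (h : HasBasis H A B C u w v) (h₂ : (⟨u', B, 0⟩ : B3Group) ∈ H)
    (h₃ : (⟨v', w', C⟩ : B3Group) ∈ H) : HasBasis H A B C u' w' v' :=
  { h with mem_snd := h₂, mem_trd := h₃ }

/-- With equal diagonals one inclusion suffices: the second and third basis elements of `H`, once in
`K`, also complete a basis of `K`. -/
theorem eq_of_mem (h : HasBasis H A B C u w v) (h' : HasBasis K A B C u' w' v')
    (h₂ : (⟨u, B, 0⟩ : B3Group) ∈ K) (h₃ : (⟨v, w, C⟩ : B3Group) ∈ K) : H = K :=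
  le_antisymm (h.le h'.mem_fst h₂ h₃) ((h'.congr h₂ h₃).le h.mem_fst h.mem_snd h.mem_trd)

theorem unique {A' B' C' : ℤ} (h : HasBasis H A B C u w v) (h' : HasBasis H A' B' C' u' w' v') :
    A = A' ∧ B = B' ∧ C = C' := by
  have key : ∀ {x y : ℤ}, 0 < x → 0 < y → x ∣ y → y ∣ x → x = y := fun hx hy h1 h2 =>
    Int.dvd_antisymm hx.le hy.le h1 h2
  exact ⟨key h.A_pos h'.A_pos (h.dvd_a _ h'.mem_fst rfl rfl) (h'.dvd_a _ h.mem_fst rfl rfl),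
    key h.B_pos h'.B_pos (h.dvd_b _ h'.mem_snd rfl) (h'.dvd_b _ h.mem_snd rfl),
    key h.C_pos h'.C_pos (h.dvd_c _ h'.mem_trd) (h'.dvd_c _ h.mem_trd)⟩

theorem shift_mem (h : HasBasis H A B C u w v) {x : ℤ} (hx : A ∣ x) :
    (⟨x, 0, 0⟩ : B3Group) ∈ H := by
  obtain ⟨k, rfl⟩ := hx
  have := H.zpow_mem h.mem_fst k
  rwa [zpow_shift, mul_comm] at this

theorem mem_iff_of_b_eq_zero (h : HasBasis H A B C u w v) (x : ℤ) :
    (⟨x, 0, 0⟩ : B3Group) ∈ H ↔ A ∣ x :=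
  ⟨fun hx => h.dvd_a _ hx rfl rfl, h.shift_mem⟩

theorem mem_snd_iff (h : HasBasis H A B C u w v) (x : ℤ) :
    (⟨x, B, 0⟩ : B3Group) ∈ H ↔ A ∣ x - u := by
  have : (⟨x - u, 0, 0⟩ * ⟨u, B, 0⟩ : B3Group) = ⟨x, B, 0⟩ := by ext <;> simp
  rw [← h.mem_iff_of_b_eq_zero, ← this, H.mul_mem_cancel_right h.mem_snd]

/-- Two elements of `H` with last entry C differ on the left by an element with c = 0, which is a
multiple of (A,0,0) times a power s^l. The sign of l * B is the effect of s^l on the entry v. -/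
theorem mem_trd_iff (h : HasBasis H A B C u w v) (x y : ℤ) :
    (⟨x, y, C⟩ : B3Group) ∈ H ↔ ∃ l, y = w + l * B ∧
      A ∣ x - ((⟨u, B, 0⟩ : B3Group) ^ l).a - altSign (l * B) * v := by
  have key : ∀ l, y = w + l * B → ((⟨x, y, C⟩ : B3Group) ∈ H ↔
      A ∣ x - ((⟨u, B, 0⟩ : B3Group) ^ l).a - altSign (l * B) * v) := by
    rintro l rfl
    have : (⟨x - ((⟨u, B, 0⟩ : B3Group) ^ l).a - altSign (l * B) * v, 0, 0⟩ *
        ((⟨u, B, 0⟩ : B3Group) ^ l * ⟨v, w, C⟩) : B3Group) = ⟨x, w + l * B, C⟩ := by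
      ext
      · simp [zpow_b, zpow_c]
      · simp [zpow_b, zpow_c]; ring
      · simp [zpow_c]
    rw [← h.mem_iff_of_b_eq_zero, ← this, H.mul_mem_cancel_right
      (H.mul_mem (H.zpow_mem h.mem_snd l) h.mem_trd)]
  constructor
  · intro hx
    have h1 := H.mul_mem hx (H.inv_mem h.mem_trd)
    obtain ⟨l, hl⟩ := h.dvd_b _ h1 (by simp)
    have hy : y = w + l * B := by
      simp only [mul_b, inv_b, mul_neg, ← mul_assoc, altSign_mul_self] at hl
      linarith
    exact ⟨l, hy, (key l hy).1 hx⟩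
  · rintro ⟨l, hl, hx⟩
    exact (key l hl).2 hx

/-- The index of a subgroup is the product of the diagonal entries of its basis. -/
theorem index_eq (h : HasBasis H A B C u w v) : (H.index : ℤ) = A * B * C := by
  let T : Finset (ℤ × ℤ × ℤ) := Finset.Ico 0 A ×ˢ Finset.Ico 0 B ×ˢ Finset.Ico 0 C
  -- The box represents the cosets Hg, whereas the quotient consists of the cosets gH; hence the
  -- inverse.
  let F : T → B3Group ⧸ H := fun x => ((⟨x.1.1, x.1.2.1, x.1.2.2⟩ : B3Group)⁻¹ : B3Group)
  have hsmall : ∀ {n x y : ℤ}, 0 ≤ x → x < n → 0 ≤ y → y < n → n ∣ x - y → x = y := by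
    intro n x y h1 h2 h3 h4 h5
    have := Int.eq_zero_of_abs_lt_dvd h5 (by rw [abs_lt]; constructor <;> linarith)
    linarith
  have hF : Function.Bijective F := by
    constructor
    · rintro ⟨⟨a, b, c⟩, hx⟩ ⟨⟨a', b', c'⟩, hy⟩ hxy
      simp only [T, Finset.mem_product, Finset.mem_Ico] at hx hy
      have hm := QuotientGroup.eq.1 hxy
      rw [inv_inv] at hm
      simp only at hm
      have hc : c = c' := by
        have := h.dvd_c _ hm
        exact hsmall hx.2.2.1 hx.2.2.2 hy.2.2.1 hy.2.2.2 (by simpa [sub_eq_add_neg] using this)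
      subst hc
      have hb : b = b' := by
        have := h.dvd_b _ hm (by simp)
        simp only [mul_b, inv_b, mul_neg, ← mul_assoc, altSign_mul_self, one_mul] at this
        exact hsmall hx.2.1.1 hx.2.1.2 hy.2.1.1 hy.2.1.2 (by simpa [sub_eq_add_neg] using this)
      subst hb
      have ha : a = a' := by
        have := h.dvd_a _ hm (by simp) (by simp [← mul_assoc])
        simp only [mul_a, inv_a, mul_neg, ← mul_assoc, altSign_mul_self, one_mul] at this
        exact hsmall hx.1.1 hx.1.2 hy.1.1 hy.1.2 (by simpa [sub_eq_add_neg] using this)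
      subst ha
      rfl
    · intro x
      obtain ⟨g, rfl⟩ := QuotientGroup.mk_surjective x
      set g₀ := g⁻¹
      -- Left multiplication by elements of `H` reduces c modulo C, then b modulo B, then a modulo
      -- A, and no stage disturbs the entries reduced before.
      set g₁ := (⟨v, w, C⟩ : B3Group) ^ (-(g₀.c / C)) * g₀ with hg₁
      have hc : g₁.c = g₀.c % C := by
        rw [hg₁, mul_c, zpow_c, Int.emod_def]; simp only; ring
      set g₂ := (⟨u, B, 0⟩ : B3Group) ^ (-(g₁.b / B)) * g₁ with hg₂
      have hb : g₂.b = g₁.b % B := by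
        rw [hg₂, mul_b, zpow_b rfl, zpow_c, Int.emod_def, mul_zero, altSign_zero]; simp only; ring
      have hc₂ : g₂.c = g₁.c := by rw [hg₂, mul_c, zpow_c]; simp
      set g₃ := (⟨A, 0, 0⟩ : B3Group) ^ (-(g₂.a / A)) * g₂ with hg₃
      have ha : g₃.a = g₂.a % A := by
        rw [hg₃, zpow_shift, mul_a, Int.emod_def]; simp; ring
      have hb₃ : g₃.b = g₂.b := by rw [hg₃, zpow_shift, mul_b]; simp
      have hc₃ : g₃.c = g₂.c := by rw [hg₃, zpow_shift, mul_c]; simp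
      refine ⟨⟨(g₃.a, g₃.b, g₃.c), ?_⟩, ?_⟩
      · simp only [T, Finset.mem_product, Finset.mem_Ico]
        rw [ha, hb₃, hb, hc₃, hc₂, hc]
        exact ⟨⟨Int.emod_nonneg _ h.A_pos.ne', Int.emod_lt_of_pos _ h.A_pos⟩,
          ⟨Int.emod_nonneg _ h.B_pos.ne', Int.emod_lt_of_pos _ h.B_pos⟩,
          ⟨Int.emod_nonneg _ h.C_pos.ne', Int.emod_lt_of_pos _ h.C_pos⟩⟩
      · refine QuotientGroup.eq.2 ?_
        change (g₃⁻¹)⁻¹ * g ∈ H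
        have : (g₃⁻¹)⁻¹ * g = (⟨A, 0, 0⟩ : B3Group) ^ (-(g₂.a / A)) *
            ((⟨u, B, 0⟩ : B3Group) ^ (-(g₁.b / B)) *
            (⟨v, w, C⟩ : B3Group) ^ (-(g₀.c / C))) := by
          rw [inv_inv, hg₃, hg₂, hg₁]
          simp only [g₀]
          group
        rw [this]
        exact H.mul_mem (H.zpow_mem h.mem_fst _)
          (H.mul_mem (H.zpow_mem h.mem_snd _) (H.zpow_mem h.mem_trd _))
  have hcard : H.index = T.card := by
    rw [Subgroup.index, ← Nat.card_congr (Equiv.ofBijective F hF), Nat.card_eq_fintype_card,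
      Fintype.card_coe]
  rw [hcard]
  simp only [T, Finset.card_product, Int.card_Ico, sub_zero]
  push_cast
  rw [Int.toNat_of_nonneg h.A_pos.le, Int.toNat_of_nonneg h.B_pos.le,
    Int.toNat_of_nonneg h.C_pos.le]
  ring

end HasBasis

/-- A subgroup of `ℤ` with a positive element consists of the multiples of a positive element. -/
theorem exists_pos_dvd_iff (S : AddSubgroup ℤ) {k : ℤ} (hk : 0 < k) (hkS : k ∈ S) :
    ∃ d : ℤ, 0 < d ∧ ∀ x, x ∈ S ↔ d ∣ x := by
  obtain ⟨a, ha⟩ := Int.subgroup_cyclic S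
  have h : ∀ x, x ∈ S ↔ |a| ∣ x := by
    intro x
    rw [ha, ← AddSubgroup.zmultiples_eq_closure, Int.mem_zmultiples_iff, abs_dvd]
  refine ⟨|a|, ?_, h⟩
  rw [abs_pos]
  rintro rfl
  have := (h k).1 hkS
  simp at this
  exact hk.ne' this

/-- The entries c of elements of `H`, the entries b of those with c = 0, and the entries a of those
with b = c = 0 form subgroups of ℤ. Finite index puts a positive power of each Sᵢ into `H`, so these
subgroups are nonzero, and their generators are the diagonal. -/
theorem exists_hasBasis_of_index_ne_zero (H : Subgroup B3Group) (hH : H.index ≠ 0) :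
    ∃ A B C u w v, HasBasis H A B C u w v := by
  have hpow : ∀ g : B3Group, ∃ k : ℤ, 0 < k ∧ g ^ k ∈ H := by
    intro g
    obtain ⟨k, hk, -, h⟩ := Subgroup.exists_pow_mem_of_index_ne_zero hH g
    exact ⟨k, by exact_mod_cast hk, by simpa using h⟩
  let Sc : AddSubgroup ℤ :=
    { carrier := {c | ∃ g ∈ H, g.c = c}
      add_mem' := by
        rintro _ _ ⟨g, hg, rfl⟩ ⟨g', hg', rfl⟩
        exact ⟨g * g', H.mul_mem hg hg', rfl⟩
      zero_mem' := ⟨1, H.one_mem, rfl⟩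
      neg_mem' := by
        rintro _ ⟨g, hg, rfl⟩
        exact ⟨g⁻¹, H.inv_mem hg, rfl⟩ }
  let Sb : AddSubgroup ℤ :=
    { carrier := {b | ∃ g ∈ H, g.c = 0 ∧ g.b = b}
      add_mem' := by
        rintro _ _ ⟨g, hg, hc, rfl⟩ ⟨g', hg', hc', rfl⟩
        exact ⟨g * g', H.mul_mem hg hg', by simp [hc, hc'], by simp [hc]⟩
      zero_mem' := ⟨1, H.one_mem, rfl, rfl⟩
      neg_mem' := by
        rintro _ ⟨g, hg, hc, rfl⟩
        exact ⟨g⁻¹, H.inv_mem hg, by simp [hc], by simp [hc]⟩ }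
  let Sa : AddSubgroup ℤ :=
    { carrier := {a | (⟨a, 0, 0⟩ : B3Group) ∈ H}
      add_mem' := by
        intro a b ha hb
        have := H.mul_mem ha hb
        have e : (⟨a, 0, 0⟩ * ⟨b, 0, 0⟩ : B3Group) = ⟨a + b, 0, 0⟩ := by ext <;> simp
        rwa [e] at this
      zero_mem' := H.one_mem
      neg_mem' := by
        intro a ha
        have := H.inv_mem ha
        have e : (⟨a, 0, 0⟩⁻¹ : B3Group) = ⟨-a, 0, 0⟩ := by ext <;> simp
        rwa [e] at this }
  obtain ⟨k, hk, hkH⟩ := hpow ⟨0, 0, 1⟩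
  obtain ⟨C, hC, hCS⟩ := exists_pos_dvd_iff Sc hk ⟨_, hkH, by rw [zpow_c]; simp⟩
  obtain ⟨k, hk, hkH⟩ := hpow ⟨0, 1, 0⟩
  obtain ⟨B, hB, hBS⟩ := exists_pos_dvd_iff Sb hk
    ⟨_, hkH, by rw [zpow_c]; simp, by rw [zpow_b rfl]; simp⟩
  obtain ⟨k, hk, hkH⟩ := hpow ⟨1, 0, 0⟩
  obtain ⟨A, hA, hAS⟩ := exists_pos_dvd_iff Sa hk (by
    rw [zpow_shift, mul_one] at hkH
    exact hkH)
  obtain ⟨⟨v, w, c⟩, ht, rfl⟩ := (hCS C).2 dvd_rfl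
  obtain ⟨⟨u, b, c'⟩, hs, hc', rfl⟩ := (hBS B).2 dvd_rfl
  simp only at hc'
  subst hc'
  refine ⟨A, b, c, u, w, v, hA, hB, hC, (hAS A).2 dvd_rfl, hs, ht, fun g hg => (hCS _).1 ⟨g, hg, rfl⟩,
    fun g hg hc => (hBS _).1 ⟨g, hg, hc, rfl⟩, fun g hg hc hb => (hAS _).1 ?_⟩
  have e : g = ⟨g.a, 0, 0⟩ := by ext <;> simp [hc, hb]
  exact e ▸ hg

/-- If `(v, w, C)` normalizes the group of rank two generated by `(A, 0, 0)` and `(u, B, 0)`,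
then the three elements are the basis of a subgroup. -/
theorem exists_hasBasis_of_conj {A B C : ℤ} (hA : 0 < A) (hB : 0 < B) (hC : 0 < C) {u w v : ℤ}
    {x ε : ℤ} (hε : ε = 1 ∨ ε = -1) (hx : A ∣ x)
    (h : (⟨v, w, C⟩ * ⟨u, B, 0⟩ * ⟨v, w, C⟩⁻¹ : B3Group) = ⟨x, 0, 0⟩ * ⟨u, B, 0⟩ ^ ε) :
    ∃ H, HasBasis H A B C u w v := by
  set s : B3Group := ⟨u, B, 0⟩ with hs
  set t : B3Group := ⟨v, w, C⟩ with ht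
  have hsc : ∀ l : ℤ, (s ^ l).c = 0 := fun l => by rw [zpow_c]; simp [hs]
  have hsb : ∀ l : ℤ, (s ^ l).b = l * B := fun l => zpow_b rfl l
  -- The group generated by (A,0,0) and s, described by congruences so that membership can be read
  -- off from the entries.
  let N : Subgroup B3Group :=
    { carrier := {g | g.c = 0 ∧ ∃ l, g.b = l * B ∧ A ∣ g.a - (s ^ l).a}
      mul_mem' := by
        rintro g g' ⟨hc, l, hb, ha⟩ ⟨hc', l', hb', ha'⟩
        refine ⟨by simp [hc, hc'], l + l', by simp [hc, hb, hb']; ring, ?_⟩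
        rw [zpow_add, mul_a, mul_a, hsb, hsc, hc, hb]
        have := dvd_add ha (ha'.mul_left (altSign (l * B + 0)))
        refine this.trans (dvd_of_eq ?_)
        ring
      one_mem' := ⟨rfl, 0, by simp, by simp⟩
      inv_mem' := by
        rintro g ⟨hc, l, hb, ha⟩
        refine ⟨by simp [hc], -l, by simp [hc, hb], ?_⟩
        rw [zpow_neg, inv_a, inv_a, hsb, hsc, hc, hb]
        refine (ha.mul_left (-altSign (l * B + 0))).trans (dvd_of_eq ?_)
        ring }
  have hsh : ∀ y, A ∣ y → (⟨y, 0, 0⟩ : B3Group) ∈ N := fun y hy => ⟨rfl, 0, by simp, by simpa using hy⟩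
  have hsN : ∀ l : ℤ, s ^ l ∈ N := fun l => ⟨hsc l, l, hsb l, by simp⟩
  have hconj : ∀ r : B3Group, ∀ k : ℤ, r * ⟨k * A, 0, 0⟩ * r⁻¹ =
      ⟨altSign (r.b + r.c) * (k * A), 0, 0⟩ := by
    intro r k
    rw [mul_inv_eq_iff_eq_mul]
    ext
    · simp; ring
    · simp
    · simp
  have hnorm : t ∈ Subgroup.normalizer (N : Set B3Group) := by
    have hN : N = Subgroup.closure {⟨A, 0, 0⟩, s} := by
      apply le_antisymm
      · rintro g ⟨hc, l, hb, k, hk⟩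
        have e : g = (⟨A, 0, 0⟩ : B3Group) ^ k * s ^ l := by
          rw [zpow_shift]
          ext
          · simp; linarith
          · simp [hsb, hb]
          · simp [hsc, hc]
        rw [e]
        exact Subgroup.mul_mem _ (Subgroup.zpow_mem _ (Subgroup.subset_closure (by simp)) _)
          (Subgroup.zpow_mem _ (Subgroup.subset_closure (by simp)) _)
      · rw [Subgroup.closure_le]
        rintro g (rfl | rfl)
        · exact hsh _ dvd_rfl
        · simpa using hsN 1
    have hle : N.map (MulAut.conj t).toMonoidHom ≤ N := by
      conv_lhs => rw [hN]
      rw [MonoidHom.map_closure, Subgroup.closure_le]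
      rintro _ ⟨g, (rfl | rfl), rfl⟩
      · have := hconj t 1
        rw [one_mul] at this
        change t * _ * t⁻¹ ∈ N
        rw [this]
        exact hsh _ (Dvd.intro_left _ rfl)
      · change t * s * t⁻¹ ∈ N
        rw [h]
        exact N.mul_mem (hsh _ hx) (hsN ε)
    -- The conjugate of s is s^ε up to a multiple of (A,0,0); since ε = ±1, s itself is recovered
    -- from it.
    have hge : N ≤ N.map (MulAut.conj t).toMonoidHom := by
      have hAm : ∀ y, A ∣ y → (⟨y, 0, 0⟩ : B3Group) ∈ N.map (MulAut.conj t).toMonoidHom := by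
        rintro _ ⟨k, rfl⟩
        have := hconj t⁻¹ k
        refine ⟨_, ?_, (show (MulAut.conj t) (t⁻¹ * ⟨k * A, 0, 0⟩ * t⁻¹⁻¹) = _ by
          rw [MulAut.conj_apply, mul_comm A]; group)⟩
        rw [this]
        exact hsh _ ((Dvd.intro_left k rfl).mul_left _)
      conv_lhs => rw [hN]
      rw [Subgroup.closure_le]
      rintro g (rfl | rfl)
      · exact hAm _ dvd_rfl
      · have h1 : s ^ ε ∈ N.map (MulAut.conj t).toMonoidHom := by
          have h2 : (⟨x, 0, 0⟩ * s ^ ε : B3Group) ∈ N.map (MulAut.conj t).toMonoidHom :=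
            ⟨s, by simpa using hsN 1, h⟩
          exact (Subgroup.mul_mem_cancel_left _ (hAm x hx)).1 h2
        rcases hε with rfl | rfl
        · simpa using h1
        · simpa using h1
    rw [Subgroup.mem_normalizer_iff]
    intro g
    constructor
    · intro hg
      exact hle ⟨g, hg, rfl⟩
    · intro hg
      obtain ⟨g', hg', h'⟩ := hge hg
      have : g' = g := (MulAut.conj t).injective h'
      exact this ▸ hg'
  have hz : ∀ (m : ℤ) (g : B3Group), g ∈ N → t ^ m * g * (t ^ m)⁻¹ ∈ N := fun m g hg =>
    (Subgroup.mem_normalizer_iff.1 (Subgroup.zpow_mem _ hnorm m) g).1 hg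
  -- The product of `N` with the powers of t, which is a group because t normalizes `N`.
  let H : Subgroup B3Group :=
    { carrier := {g | ∃ m : ℤ, g * t ^ m ∈ N}
      mul_mem' := by
        rintro g g' ⟨m, hm⟩ ⟨m', hm'⟩
        refine ⟨m' + m, ?_⟩
        have := N.mul_mem hm (hz (-m) _ hm')
        have e : g * t ^ m * (t ^ (-m) * (g' * t ^ m') * (t ^ (-m))⁻¹) = g * g' * t ^ (m' + m) := by
          group
        rwa [e] at this
      one_mem' := ⟨0, by simp⟩
      inv_mem' := by
        rintro g ⟨m, hm⟩
        refine ⟨-m, ?_⟩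
        have := hz m _ (N.inv_mem hm)
        have e : t ^ m * (g * t ^ m)⁻¹ * (t ^ m)⁻¹ = g⁻¹ * t ^ (-m) := by group
        rwa [e] at this }
  -- As C is nonzero, only the power t^0 has last entry 0. So adjoining t adds nothing to the part
  -- with c = 0.
  have hHN : ∀ g ∈ H, g.c = 0 → g ∈ N := by
    rintro g ⟨m, hm⟩ hg
    have h1 : (g * t ^ m).c = 0 := hm.1
    rw [mul_c, hg, zpow_c, zero_add] at h1
    have h2 : m = 0 := by
      rcases mul_eq_zero.1 h1 with h | h
      · exact h
      · exact absurd h hC.ne'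
    simpa [h2] using hm
  refine ⟨H, hA, hB, hC, ⟨0, by simpa using hsh _ dvd_rfl⟩, ⟨0, by simpa using hsN 1⟩,
    ⟨-1, by rw [zpow_neg_one, mul_inv_cancel]; exact N.one_mem⟩, ?_, ?_, ?_⟩
  · rintro g ⟨m, hm⟩
    have h1 : (g * t ^ m).c = 0 := hm.1
    rw [mul_c, zpow_c] at h1
    exact ⟨-m, by simp only [ht] at h1; linarith⟩
  · intro g hg hc
    obtain ⟨-, l, hl, -⟩ := hHN g hg hc
    exact ⟨l, by rw [hl, mul_comm]⟩
  · intro g hg hc hb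
    obtain ⟨-, l, hl, ha⟩ := hHN g hg hc
    rw [hb] at hl
    have h2 : l = 0 := by
      rcases mul_eq_zero.1 hl.symm with h | h
      · exact h
      · exact absurd h hB.ne'
    simpa [h2] using ha

end B3Group

namespace B3Group

/-! ### Conjugation in terms of bases -/

theorem conj_eq (g h : B3Group) : g * h * g⁻¹ =
    ⟨g.a + altSign (g.b + g.c) * h.a - altSign (h.b + h.c) * g.a,
      g.b + altSign g.c * h.b - altSign h.c * g.b, h.c⟩ := by
  rw [mul_inv_eq_iff_eq_mul]
  ext
  · simp only [mul_a, altSign_add, altSign_sub, altSign_altSign_mul]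
    rcases altSign_eq g.b with h1 | h1 <;> rw [h1] <;> ring
  · simp
  · simp [add_comm]

namespace HasBasis

variable {H K : Subgroup B3Group} {A B C u w v u' w' v' : ℤ}

/-- As w is odd, t s t⁻¹ for C even, or its inverse for C odd, is (-u, B, 0). Its first entry must
agree with u modulo A. -/
theorem two_dvd_of_odd (h : HasBasis H A B C u w v) (hB : Even B) (hw : ¬ Even w) :
    A ∣ 2 * u := by
  have h1 := H.mul_mem (H.mul_mem h.mem_trd h.mem_snd) (H.inv_mem h.mem_trd)
  rw [conj_eq] at h1
  have h2 : (⟨-u, B, 0⟩ : B3Group) ∈ H := by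
    by_cases hC : Even C
    · convert h1 using 2 <;> simp [altSign_add, altSign_even hB, altSign_odd hw, altSign_even hC]
    · convert H.inv_mem h1 using 1
      ext <;> simp [altSign_add, altSign_even hB, altSign_odd hw, altSign_odd hC]
  have h3 := (h.mem_snd_iff _).1 h2
  rw [← dvd_neg]
  exact h3.trans (dvd_of_eq (by ring))

/-- Again t s t⁻¹ is compared with s. For odd B the element s reverses the first axis, so that v
enters twice. In `dvd_of_odd` the inverse of t s t⁻¹ is compared instead, because t then reverses
the second axis. -/
theorem dvd_of_even (h : HasBasis H A B C u w v) (hB : ¬ Even B) (hw : Even w) (hC : Even C) :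
    A ∣ 2 * v := by
  have h1 := H.mul_mem (H.mul_mem h.mem_trd h.mem_snd) (H.inv_mem h.mem_trd)
  rw [conj_eq] at h1
  have h2 : (⟨2 * v + u, B, 0⟩ : B3Group) ∈ H := by
    convert h1 using 2 <;> simp [altSign_add, altSign_odd hB, altSign_even hw, altSign_even hC]
    ring
  exact ((h.mem_snd_iff _).1 h2).trans (dvd_of_eq (by ring))

theorem dvd_of_odd (h : HasBasis H A B C u w v) (hB : ¬ Even B) (hw : Even w) (hC : ¬ Even C) :
    A ∣ 2 * (v - u) := by
  have h1 := H.mul_mem (H.mul_mem h.mem_trd h.mem_snd) (H.inv_mem h.mem_trd)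
  rw [conj_eq] at h1
  have h2 : (⟨2 * v - u, B, 0⟩ : B3Group) ∈ H := by
    convert H.inv_mem h1 using 1
    ext
    · simp [altSign_add, altSign_odd hB, altSign_even hw, altSign_odd hC]
      ring
    · simp [altSign_odd hC]
    · simp
  exact ((h.mem_snd_iff _).1 h2).trans (dvd_of_eq (by ring))

/-- If `B` is odd then the entry `w` can be chosen even. -/
theorem exists_even (h : HasBasis H A B C u w v) (hB : ¬ Even B) :
    ∃ w' v', HasBasis H A B C u w' v' ∧ Even w' := by
  by_cases hw : Even w
  · exact ⟨w, v, h, hw⟩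
  · refine ⟨B + w, u + altSign B * v, h.congr h.mem_snd ?_, ?_⟩
    · convert H.mul_mem h.mem_snd h.mem_trd using 1
      ext <;> simp
    · exact Int.even_add.2 (iff_of_false hB hw)

/-- Conjugation fixes c, changes b at most by a sign when c = 0, and a at most by a sign when b = c
= 0. The diagonal is therefore an invariant of the conjugacy class. -/
theorem map_conj (h : HasBasis H A B C u w v) (g : B3Group) :
    ∃ u' w' v', HasBasis (H.map (MulAut.conj g).toMonoidHom) A B C u' w' v' := by
  have hm : ∀ x ∈ H, g * x * g⁻¹ ∈ H.map (MulAut.conj g).toMonoidHom := fun x hx => ⟨x, hx, rfl⟩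
  have h1 := hm _ h.mem_fst
  have h2 := hm _ h.mem_snd
  have h3 := hm _ h.mem_trd
  rw [conj_eq] at h1 h2 h3
  have h1' : (⟨A, 0, 0⟩ : B3Group) ∈ H.map (MulAut.conj g).toMonoidHom := by
    rcases altSign_eq (g.b + g.c) with e | e
    · convert h1 using 2 <;> simp [e]
    · convert Subgroup.inv_mem _ h1 using 1
      ext <;> simp [e]
  have h2' : ∃ u', (⟨u', B, 0⟩ : B3Group) ∈ H.map (MulAut.conj g).toMonoidHom := by
    rcases altSign_eq g.c with e | e
    · have hb : g.b + 1 * B - 1 * g.b = B := by ring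
      simp only [e, altSign_zero, hb] at h2
      exact ⟨_, h2⟩
    · have hx : ∀ x ∈ H.map (MulAut.conj g).toMonoidHom, x.b = -B → x.c = 0 →
          ∃ u', (⟨u', B, 0⟩ : B3Group) ∈ H.map (MulAut.conj g).toMonoidHom := fun x hx hb hc =>
        ⟨(x⁻¹).a, by convert Subgroup.inv_mem _ hx using 1; ext <;> simp [hb, hc]⟩
      exact hx _ h2 (by simp [e]) rfl
  obtain ⟨u', h2'⟩ := h2'
  refine ⟨u', _, _, h.A_pos, h.B_pos, h.C_pos, h1', h2', h3, ?_, ?_, ?_⟩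
  · rintro _ ⟨x, hx, rfl⟩
    have := h.dvd_c x hx
    change C ∣ (g * x * g⁻¹).c
    rwa [conj_eq]
  · rintro _ ⟨x, hx, rfl⟩ hc
    change (g * x * g⁻¹).c = 0 at hc
    change B ∣ (g * x * g⁻¹).b
    rw [conj_eq] at hc ⊢
    simp only at hc ⊢
    have := h.dvd_b x hx hc
    rw [hc, altSign_zero]
    exact (this.mul_left (altSign g.c)).trans (dvd_of_eq (by ring))
  · rintro _ ⟨x, hx, rfl⟩ hc hb
    change (g * x * g⁻¹).c = 0 at hc
    change (g * x * g⁻¹).b = 0 at hb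
    change A ∣ (g * x * g⁻¹).a
    rw [conj_eq] at hc hb ⊢
    simp only at hc hb ⊢
    have hb' : x.b = 0 := by
      rw [hc, altSign_zero] at hb
      rcases altSign_eq g.c with e | e <;> rw [e] at hb <;> linarith
    have := h.dvd_a x hx hc hb'
    rw [hc, hb', add_zero, altSign_zero]
    exact (this.mul_left (altSign (g.b + g.c))).trans (dvd_of_eq (by ring))

/-- The first basis element needs no condition, as its conjugates are (±A,0,0); and an inclusion of
groups with equal diagonals is an equality. -/
theorem conj_iff (h : HasBasis H A B C u w v) (h' : HasBasis K A B C u' w' v') :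
    subgroupConj B3Group H K ↔ ∃ g : B3Group, g * ⟨u, B, 0⟩ * g⁻¹ ∈ K ∧ g * ⟨v, w, C⟩ * g⁻¹ ∈ K := by
  constructor
  · rintro ⟨g, rfl⟩
    exact ⟨g, ⟨_, h.mem_snd, rfl⟩, ⟨_, h.mem_trd, rfl⟩⟩
  · rintro ⟨g, h2, h3⟩
    refine ⟨g, ?_⟩
    have hle : H.map (MulAut.conj g).toMonoidHom ≤ K := by
      rw [Subgroup.map_le_iff_le_comap]
      refine h.le ?_ h2 h3
      change g * ⟨A, 0, 0⟩ * g⁻¹ ∈ K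
      have : (g * ⟨A, 0, 0⟩ * g⁻¹ : B3Group) = ⟨altSign (g.b + g.c) * A, 0, 0⟩ := by
        rw [conj_eq]; ext <;> simp
      rw [this]
      exact h'.shift_mem (Dvd.intro_left _ rfl)
    obtain ⟨x, y, z, hb⟩ := h.map_conj g
    exact (hb.eq_of_mem h' (hle hb.mem_snd) (hle hb.mem_trd)).symm

/-- The conjugator is (p,q,r), and l counts the factors s of `K` split off from the conjugate of t;
these have the form (l u', l B, 0) as B is even. In the condition on u the sign of r is absent: for
odd r the inverse of the conjugate of s is used. -/
theorem conj_iff_of_even (h : HasBasis H A B C u w v) (h' : HasBasis K A B C u' w' v')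
    (hB : Even B) : subgroupConj B3Group H K ↔ ∃ p q r l : ℤ, A ∣ altSign q * u - u' ∧
      q + altSign r * w - altSign C * q = w' + l * B ∧
      A ∣ p + altSign (q + r) * v - altSign (w + C) * p - l * u' - v' := by
  have key : ∀ g : B3Group, (g * ⟨u, B, 0⟩ * g⁻¹ ∈ K ∧ g * ⟨v, w, C⟩ * g⁻¹ ∈ K) ↔
      ∃ l : ℤ, A ∣ altSign g.b * u - u' ∧
      g.b + altSign g.c * w - altSign C * g.b = w' + l * B ∧
      A ∣ g.a + altSign (g.b + g.c) * v - altSign (w + C) * g.a - l * u' - v' := by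
    intro g
    have h1 : g * ⟨u, B, 0⟩ * g⁻¹ ∈ K ↔ A ∣ altSign g.b * u - u' := by
      rw [← h'.mem_snd_iff]
      rcases altSign_eq g.c with e | e
      · rw [conj_eq]
        simp only [altSign_add, altSign_even hB, e, altSign_zero]
        simp
      · rw [← K.inv_mem_iff]
        have : (g * ⟨u, B, 0⟩ * g⁻¹ : B3Group)⁻¹ = ⟨altSign g.b * u, B, 0⟩ := by
          rw [conj_eq]
          ext <;> simp [altSign_add, altSign_even hB, e]
        rw [this]
    rw [h1, conj_eq, h'.mem_trd_iff]
    constructor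
    · rintro ⟨ha, l, hl, hd⟩
      refine ⟨l, ha, hl, hd.trans (dvd_of_eq ?_)⟩
      rw [zpow_a_of_even rfl hB, altSign_even (hB.mul_left l)]
      ring
    · rintro ⟨l, ha, hl, hd⟩
      refine ⟨ha, l, hl, hd.trans (dvd_of_eq ?_)⟩
      rw [zpow_a_of_even rfl hB, altSign_even (hB.mul_left l)]
      ring
  rw [h.conj_iff h']
  constructor
  · rintro ⟨g, hg⟩
    obtain ⟨l, hl⟩ := (key g).1 hg
    exact ⟨g.a, g.b, g.c, l, hl⟩
  · rintro ⟨p, q, r, l, hl⟩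
    exact ⟨⟨p, q, r⟩, (key ⟨p, q, r⟩).2 ⟨l, hl⟩⟩

/-- Since s reverses the first axis, conjugation by p moves u by 2p. As w and w' are even and B is
odd, the number of split-off factors s is an even number 2k, and an even power of s has first entry
0. -/
theorem conj_iff_of_odd (h : HasBasis H A B C u w v) (h' : HasBasis K A B C u' w' v')
    (hB : ¬ Even B) (hw : Even w) (hw' : Even w') :
    subgroupConj B3Group H K ↔ ∃ p q r k : ℤ, A ∣ 2 * p + altSign (q + r) * u - u' ∧
      q + altSign r * w - altSign C * q = w' + 2 * k * B ∧
      A ∣ p + altSign (q + r) * v - altSign C * p - v' := by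
  have key : ∀ g : B3Group, (g * ⟨u, B, 0⟩ * g⁻¹ ∈ K ∧ g * ⟨v, w, C⟩ * g⁻¹ ∈ K) ↔
      ∃ k : ℤ, A ∣ 2 * g.a + altSign (g.b + g.c) * u - u' ∧
      g.b + altSign g.c * w - altSign C * g.b = w' + 2 * k * B ∧
      A ∣ g.a + altSign (g.b + g.c) * v - altSign C * g.a - v' := by
    intro g
    have h1 : g * ⟨u, B, 0⟩ * g⁻¹ ∈ K ↔ A ∣ 2 * g.a + altSign (g.b + g.c) * u - u' := by
      rw [← h'.mem_snd_iff]
      have hx : g.a + altSign (g.b + g.c) * u + g.a = 2 * g.a + altSign (g.b + g.c) * u := by ring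
      rcases altSign_eq g.c with e | e
      · rw [conj_eq]
        simp only [altSign_odd hB, e, altSign_zero, add_zero]
        simp [hx]
      · rw [← K.inv_mem_iff]
        have : (g * ⟨u, B, 0⟩ * g⁻¹ : B3Group)⁻¹ = ⟨2 * g.a + altSign (g.b + g.c) * u, B, 0⟩ := by
          rw [conj_eq, ← hx]
          ext <;> simp [altSign_odd hB, e]
        rw [this]
    rw [h1, conj_eq, h'.mem_trd_iff]
    constructor
    · rintro ⟨ha, l, hl, hd⟩
      have hle : Even l := by
        have h3 : Even (w' + l * B) := by
          rw [← hl]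
          change Even (g.b + altSign g.c * w - altSign C * g.b)
          rcases altSign_eq C with e | e
          · rw [show g.b + altSign g.c * w - altSign C * g.b = altSign g.c * w by rw [e]; ring]
            exact hw.mul_left _
          · rw [show g.b + altSign g.c * w - altSign C * g.b = 2 * g.b + altSign g.c * w by
              rw [e]; ring]
            exact (even_two_mul _).add (hw.mul_left _)
        have h4 : Even (l * B) := (Int.even_add.1 h3).1 hw'
        exact (Int.even_mul.1 h4).resolve_right hB
      obtain ⟨k, rfl⟩ := hle.two_dvd
      refine ⟨k, ha, hl, hd.trans (dvd_of_eq ?_)⟩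
      simp only [zpow_two_mul_a_of_odd (g := ⟨u', B, 0⟩) rfl hB, mul_assoc, altSign_two_mul,
        altSign_add, altSign_even hw]
      ring
    · rintro ⟨k, ha, hl, hd⟩
      refine ⟨ha, 2 * k, hl, hd.trans (dvd_of_eq ?_)⟩
      simp only [zpow_two_mul_a_of_odd (g := ⟨u', B, 0⟩) rfl hB, mul_assoc, altSign_two_mul,
        altSign_add, altSign_even hw]
      ring
  rw [h.conj_iff h']
  constructor
  · rintro ⟨g, hg⟩
    obtain ⟨l, hl⟩ := (key g).1 hg
    exact ⟨g.a, g.b, g.c, l, hl⟩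
  · rintro ⟨p, q, r, l, hl⟩
    exact ⟨⟨p, q, r⟩, (key ⟨p, q, r⟩).2 ⟨l, hl⟩⟩

end HasBasis

/-- The necessary congruence of `HasBasis.two_dvd_of_odd` is sufficient: under it t s t⁻¹ is s or
s⁻¹, by the parity of C, up to a multiple of (A,0,0). -/
theorem exists_hasBasis_of_even {A B C : ℤ} (hA : 0 < A) (hB : 0 < B) (hC : 0 < C) {u w v : ℤ}
    (hB2 : Even B) (h : Even w ∨ A ∣ 2 * u) : ∃ H, HasBasis H A B C u w v := by
  have hpow : ∀ l : ℤ, (⟨u, B, 0⟩ : B3Group) ^ l = ⟨l * u, l * B, 0⟩ := fun l => by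
    ext
    · exact zpow_a_of_even rfl hB2 l
    · exact zpow_b rfl l
    · rw [zpow_c, mul_zero]
  by_cases hw : Even w
  · refine exists_hasBasis_of_conj hA hB hC (altSign_eq C) (dvd_zero A) ?_
    rw [conj_eq, hpow]
    ext <;> simp [altSign_add, altSign_even hB2, altSign_even hw]
  · refine exists_hasBasis_of_conj hA hB hC (altSign_eq C)
      ((h.resolve_left hw).mul_left (-altSign C)) ?_
    rw [conj_eq, hpow]
    ext
    · simp [altSign_add, altSign_even hB2, altSign_odd hw]
      ring
    · simp
    · simp

/-- Converse to `HasBasis.dvd_of_even` and `HasBasis.dvd_of_odd`. -/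
theorem exists_hasBasis_of_odd {A B C : ℤ} (hA : 0 < A) (hB : 0 < B) (hC : 0 < C) {u w v : ℤ}
    (hB2 : ¬ Even B) (hw : Even w) (h : if Even C then A ∣ 2 * v else A ∣ 2 * (v - u)) :
    ∃ H, HasBasis H A B C u w v := by
  by_cases hC2 : Even C
  · rw [if_pos hC2] at h
    refine exists_hasBasis_of_conj hA hB hC (Or.inl rfl) h ?_
    rw [conj_eq, zpow_one]
    ext
    · simp [altSign_add, altSign_odd hB2, altSign_even hw, altSign_even hC2]
      ring
    · simp [altSign_even hC2]
    · simp
  · rw [if_neg hC2] at h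
    refine exists_hasBasis_of_conj hA hB hC (Or.inr rfl) h ?_
    rw [conj_eq, zpow_neg_one]
    ext
    · simp [altSign_add, altSign_odd hB2, altSign_even hw, altSign_odd hC2]
      ring
    · simp [altSign_odd hC2]
    · simp

end B3Group

theorem nonempty_homeomorph_of_generators {G G' E E' : Type} [Group G] [Group G']
    [TopologicalSpace E] [TopologicalSpace E'] [MulAction G E] [MulAction G' E'] (φ : E ≃ₜ E')
    {H : Subgroup G} {K : Subgroup G'} {g₁ g₂ g₃ : G} {k₁ k₂ k₃ : G'}
    (hH : H = Subgroup.closure {g₁, g₂, g₃}) (hK : K = Subgroup.closure {k₁, k₂, k₃})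
    (h₁ : ∀ e, φ (g₁ • e) = k₁ • φ e) (h₂ : ∀ e, φ (g₂ • e) = k₂ • φ e)
    (h₃ : ∀ e, φ (g₃ • e) = k₃ • φ e) :
    Nonempty (MulAction.orbitRel.Quotient H E ≃ₜ MulAction.orbitRel.Quotient K E') := by
  have mH : ∀ g ∈ ({g₁, g₂, g₃} : Set G), g ∈ H := fun g hg => hH ▸ Subgroup.subset_closure hg
  have mK : ∀ k ∈ ({k₁, k₂, k₃} : Set G'), k ∈ K := fun k hk => hK ▸ Subgroup.subset_closure hk
  refine nonempty_orbit_homeomorph φ hH hK ?_ ?_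
  · rintro g (rfl | rfl | rfl)
    exacts [⟨k₁, mK _ (by simp), h₁⟩, ⟨k₂, mK _ (by simp), h₂⟩, ⟨k₃, mK _ (by simp), h₃⟩]
  · rintro k (rfl | rfl | rfl)
    exacts [⟨g₁, mH _ (by simp), h₁⟩, ⟨g₂, mH _ (by simp), h₂⟩, ⟨g₃, mH _ (by simp), h₃⟩]

/-- The six flat manifolds which cover `ℬ₃`. -/
inductive FlatType
  | G1 | G2 | B1 | B2 | B3 | B4

namespace B3Group

/-! ### Models of the six groups inside `π₁(ℬ₃)` -/

/-- A subgroup of `π₁(ℬ₃)` isomorphic to the fundamental group of the given flat manifold. -/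
def model : FlatType → Subgroup B3Group
  | .G1 =>
    { carrier := {g | 2 ∣ g.b ∧ 2 ∣ g.c}
      mul_mem' := by
        rintro g h ⟨h1, h2⟩ ⟨h3, h4⟩
        exact ⟨h1.add (h3.mul_left _), h2.add h4⟩
      one_mem' := by simp
      inv_mem' := by
        rintro g ⟨h1, h2⟩
        exact ⟨(h1.mul_left _).neg_right, h2.neg_right⟩ }
  | .G2 =>
    { carrier := {g | 2 ∣ g.b}
      mul_mem' := fun {g h} h1 h2 => h1.add (h2.mul_left _)
      one_mem' := by simp
      inv_mem' := fun {g} h1 => (h1.mul_left _).neg_right }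
  | .B1 =>
    { carrier := {g | 2 ∣ g.c}
      mul_mem' := fun {g h} h1 h2 => h1.add h2
      one_mem' := by simp
      inv_mem' := fun {g} h1 => h1.neg_right }
  -- Equivalently, c is even and a ≡ c/2 modulo 2.
  | .B2 =>
    { carrier := {g | 4 ∣ 2 * g.a - g.c}
      mul_mem' := by
        intro g h h1 h2
        simp only [Set.mem_ofPred_eq, mul_a, mul_c] at *
        rcases altSign_eq (g.b + g.c) with e | e <;> rw [e] <;> omega
      one_mem' := by simp
      inv_mem' := by
        intro g h1
        simp only [Set.mem_ofPred_eq, inv_a, inv_c] at *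
        rcases altSign_eq (g.b + g.c) with e | e <;> rw [e] <;> omega }
  | .B3 => ⊤
  | .B4 =>
    { carrier := {g | 2 ∣ g.a - g.c}
      mul_mem' := by
        intro g h h1 h2
        simp only [Set.mem_ofPred_eq, mul_a, mul_c] at *
        rcases altSign_eq (g.b + g.c) with e | e <;> rw [e] <;> omega
      one_mem' := by simp
      inv_mem' := by
        intro g h1
        simp only [Set.mem_ofPred_eq, inv_a, inv_c] at *
        rcases altSign_eq (g.b + g.c) with e | e <;> rw [e] <;> omega }

theorem mem_model_G1 {g : B3Group} : g ∈ model .G1 ↔ 2 ∣ g.b ∧ 2 ∣ g.c := Iff.rfl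
theorem mem_model_G2 {g : B3Group} : g ∈ model .G2 ↔ 2 ∣ g.b := Iff.rfl
theorem mem_model_B1 {g : B3Group} : g ∈ model .B1 ↔ 2 ∣ g.c := Iff.rfl
theorem mem_model_B2 {g : B3Group} : g ∈ model .B2 ↔ 4 ∣ 2 * g.a - g.c := Iff.rfl
theorem mem_model_B3 {g : B3Group} : g ∈ model .B3 := Subgroup.mem_top g
theorem mem_model_B4 {g : B3Group} : g ∈ model .B4 ↔ 2 ∣ g.a - g.c := Iff.rfl

theorem hasBasis_G1 : HasBasis (model .G1) 1 2 2 0 0 0 := by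
  constructor <;> simp [mem_model_G1]
  all_goals try intros
  all_goals omega

theorem hasBasis_G2 : HasBasis (model .G2) 1 2 1 0 0 0 := by
  constructor <;> simp [mem_model_G2]
  all_goals try intros
  all_goals omega

theorem hasBasis_B1 : HasBasis (model .B1) 1 1 2 0 0 0 := by
  constructor <;> simp [mem_model_B1]

theorem hasBasis_B2 : HasBasis (model .B2) 2 1 2 0 0 1 := by
  constructor <;> simp [mem_model_B2]
  all_goals intros
  all_goals omega

theorem hasBasis_B3 : HasBasis (model .B3) 1 1 1 0 0 0 := by
  constructor <;> simp [mem_model_B3]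

theorem hasBasis_B4 : HasBasis (model .B4) 2 1 1 0 0 1 := by
  constructor <;> simp [mem_model_B4]
  all_goals intros
  all_goals omega

/-! ### The models are pairwise non-isomorphic -/

theorem mul_comm_of_even {g h : B3Group} (h1 : Even g.b) (h2 : Even g.c) (h3 : Even h.b)
    (h4 : Even h.c) : g * h = h * g := by
  ext <;> simp [altSign_add, altSign_even, h1, h2, h3, h4, add_comm]

/-- A square always has even b and c, so both factors act as translations. -/
theorem mul_sq_comm_of_even {g : B3Group} (h1 : Even g.b) (h2 : Even g.c) (k : B3Group) :
    g * (k * k) = k * k * g := by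
  refine mul_comm_of_even h1 h2 ?_ ⟨k.c, rfl⟩
  rw [mul_b]
  rcases altSign_eq k.c with e | e <;> simp [e]

/-- One of `g`, `h`, `gh` commutes with all squares. -/
def SquareCondition (G : Type) [Group G] : Prop :=
  ∀ g h : G, (∀ k, g * (k * k) = k * k * g) ∨ (∀ k, h * (k * k) = k * k * h) ∨
    (∀ k, g * h * (k * k) = k * k * (g * h))

/-- Central elements are squares. -/
def CenterCondition (G : Type) [Group G] : Prop :=
  ∀ z : G, (∀ g, z * g = g * z) → ∃ y, z = y * y

/-- Commutators are squares. -/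
def CommutatorCondition (G : Type) [Group G] : Prop :=
  ∀ g h : G, ∃ y, g * h * g⁻¹ = y * y * h

/-- Elements conjugate to their inverse commute with all squares. -/
def InversionCondition (G : Type) [Group G] : Prop :=
  ∀ g h k : G, g * h * g⁻¹ = h⁻¹ → h * (k * k) = k * k * h

section transfer

variable {G G' : Type} [Group G] [Group G'] (e : G ≃* G')

include e

theorem commute_transfer (h : ∀ x y : G, x * y = y * x) (x y : G') : x * y = y * x := by
  obtain ⟨x, rfl⟩ := e.surjective x
  obtain ⟨y, rfl⟩ := e.surjective y
  rw [← map_mul, h, map_mul]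

theorem SquareCondition.transfer (h : SquareCondition G) : SquareCondition G' := by
  intro x y
  obtain ⟨x, rfl⟩ := e.surjective x
  obtain ⟨y, rfl⟩ := e.surjective y
  have key : ∀ x : G, (∀ k, x * (k * k) = k * k * x) → ∀ k, e x * (k * k) = k * k * e x := by
    intro x hx k
    obtain ⟨k, rfl⟩ := e.surjective k
    simp only [← map_mul, hx]
  rcases h x y with h | h | h
  · exact Or.inl (key _ h)
  · exact Or.inr (Or.inl (key _ h))
  · rw [← map_mul]
    exact Or.inr (Or.inr (key _ h))

theorem CenterCondition.transfer (h : CenterCondition G) : CenterCondition G' := by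
  intro z hz
  obtain ⟨z, rfl⟩ := e.surjective z
  obtain ⟨y, rfl⟩ := h z fun g => e.injective (by rw [map_mul, hz, map_mul])
  exact ⟨e y, map_mul e y y⟩

theorem CommutatorCondition.transfer (h : CommutatorCondition G) : CommutatorCondition G' := by
  intro x y
  obtain ⟨x, rfl⟩ := e.surjective x
  obtain ⟨y, rfl⟩ := e.surjective y
  obtain ⟨z, hz⟩ := h x y
  exact ⟨e z, by rw [← map_inv, ← map_mul, ← map_mul, hz, map_mul, map_mul]⟩

theorem InversionCondition.transfer (h : InversionCondition G) : InversionCondition G' := by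
  intro x y k
  obtain ⟨x, rfl⟩ := e.surjective x
  obtain ⟨y, rfl⟩ := e.surjective y
  obtain ⟨k, rfl⟩ := e.surjective k
  intro hxy
  have := h x y k (e.injective (by simpa using hxy))
  simp only [← map_mul, this]

end transfer

theorem commute_model_G1 (g h : model .G1) : g * h = h * g :=
  Subtype.ext (mul_comm_of_even (even_iff_two_dvd.2 g.2.1) (even_iff_two_dvd.2 g.2.2)
    (even_iff_two_dvd.2 h.2.1) (even_iff_two_dvd.2 h.2.2))

theorem not_commute_of_mem {X : FlatType} {g h : B3Group} (hg : g ∈ model X) (hh : h ∈ model X)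
    (hne : g * h ≠ h * g) : ¬ ∀ x y : model X, x * y = y * x := fun hc =>
  hne (congrArg Subtype.val (hc ⟨g, hg⟩ ⟨h, hh⟩))

theorem not_commute_model : ∀ X : FlatType, X ≠ .G1 → ¬ ∀ x y : model X, x * y = y * x
  | .G1, h => absurd rfl h
  | .G2, _ => not_commute_of_mem (g := ⟨1, 0, 0⟩) (h := ⟨0, 0, 1⟩) (by simp [mem_model_G2])
      (by simp [mem_model_G2]) (by simp [B3Group.ext_iff])
  | .B1, _ => not_commute_of_mem (g := ⟨1, 0, 0⟩) (h := ⟨0, 1, 0⟩) (by simp [mem_model_B1])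
      (by simp [mem_model_B1]) (by simp [B3Group.ext_iff])
  | .B2, _ => not_commute_of_mem (g := ⟨2, 0, 0⟩) (h := ⟨0, 1, 0⟩) (by simp [mem_model_B2])
      (by simp [mem_model_B2]) (by simp [B3Group.ext_iff])
  | .B3, _ => not_commute_of_mem (g := ⟨1, 0, 0⟩) (h := ⟨0, 1, 0⟩) mem_model_B3
      mem_model_B3 (by simp [B3Group.ext_iff])
  | .B4, _ => not_commute_of_mem (g := ⟨2, 0, 0⟩) (h := ⟨0, 1, 0⟩) (by simp [mem_model_B4])
      (by simp [mem_model_B4]) (by simp [B3Group.ext_iff])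

theorem squareCondition_model {X : FlatType}
    (hX : ∀ g ∈ model X, ∀ h ∈ model X, (Even g.b ∧ Even g.c) ∨ (Even h.b ∧ Even h.c) ∨
      (Even (g * h).b ∧ Even (g * h).c)) : SquareCondition (model X) := by
  intro g h
  rcases hX g g.2 h h.2 with h1 | h1 | h1
  · exact Or.inl fun k => Subtype.ext (mul_sq_comm_of_even h1.1 h1.2 k)
  · exact Or.inr (Or.inl fun k => Subtype.ext (mul_sq_comm_of_even h1.1 h1.2 k))
  · exact Or.inr (Or.inr fun k => Subtype.ext (mul_sq_comm_of_even h1.1 h1.2 k))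

theorem squareCondition_G2 : SquareCondition (model .G2) :=
  squareCondition_model fun g hg h hh => by
    rw [mem_model_G2] at hg hh
    have hgh := (mem_model_G2.1 ((model .G2).mul_mem hg hh))
    simp only [even_iff_two_dvd, mul_c, hg, hh, hgh, true_and]
    omega

theorem even_b_trichotomy {g h : B3Group} (hg : 2 ∣ g.c) (hh : 2 ∣ h.c) :
    (Even g.b ∧ Even g.c) ∨ (Even h.b ∧ Even h.c) ∨ (Even (g * h).b ∧ Even (g * h).c) := by
  have hs : altSign g.c = 1 := altSign_even (even_iff_two_dvd.2 hg)
  simp only [even_iff_two_dvd, mul_c, mul_b, hs]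
  omega

theorem squareCondition_B1 : SquareCondition (model .B1) :=
  squareCondition_model fun _ hg _ hh => even_b_trichotomy hg hh

theorem squareCondition_B2 : SquareCondition (model .B2) :=
  squareCondition_model fun g hg h hh => by
    rw [mem_model_B2] at hg hh
    exact even_b_trichotomy (by omega) (by omega)

/-- The holonomy is (ℤ/2)². Both S₂ and h reverse the first axis and fail to commute with (2,0,0)²;
their product reverses the second axis and fails to commute with S₂². -/
theorem not_squareCondition_of_mem {X : FlatType} {h : B3Group}
    (hg : (⟨0, 1, 0⟩ : B3Group) ∈ model X) (hh : h ∈ model X) (hk : (⟨2, 0, 0⟩ : B3Group) ∈ model X)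
    (hhb : h.b = 0) (hhc : h.c = 1) : ¬ SquareCondition (model X) := by
  intro hs
  rcases hs ⟨_, hg⟩ ⟨_, hh⟩ with h1 | h1 | h1
  · have := congrArg (fun x : model _ => (x : B3Group).a) (h1 ⟨_, hk⟩)
    simp at this
  · have := congrArg (fun x : model _ => (x : B3Group).a) (h1 ⟨_, hk⟩)
    simp [hhb, hhc] at this
    omega
  · have := congrArg (fun x : model _ => (x : B3Group).b) (h1 ⟨_, hg⟩)
    simp [hhb, hhc] at this

theorem not_squareCondition_B3 : ¬ SquareCondition (model .B3) :=
  not_squareCondition_of_mem (h := ⟨0, 0, 1⟩) mem_model_B3 mem_model_B3 mem_model_B3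
    rfl rfl

theorem not_squareCondition_B4 : ¬ SquareCondition (model .B4) :=
  not_squareCondition_of_mem (h := ⟨1, 0, 1⟩) (by simp [mem_model_B4])
    (by simp [mem_model_B4]) (by simp [mem_model_B4]) rfl rfl

/-- Commuting with S₁ and S₃ forces z = (0,0,2d), the square of (0,0,d). -/
theorem centerCondition_G2 : CenterCondition (model .G2) := by
  rintro ⟨⟨a, b, c⟩, hz⟩ hc
  rw [mem_model_G2] at hz
  have h1 := congrArg (fun x : model _ => (x : B3Group).a) (hc ⟨⟨1, 0, 0⟩, by simp [mem_model_G2]⟩)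
  have h2 := congrArg (fun x : model _ => (x : B3Group).a) (hc ⟨⟨0, 0, 1⟩, by simp [mem_model_G2]⟩)
  have h3 := congrArg (fun x : model _ => (x : B3Group).b) (hc ⟨⟨0, 0, 1⟩, by simp [mem_model_G2]⟩)
  simp [altSign_add, altSign_even (even_iff_two_dvd.2 hz)] at h1 h2 h3
  have ha : a = 0 := by linarith
  have hb : b = 0 := by linarith
  subst ha hb
  have hce : Even c := by
    by_contra h
    rw [altSign_odd h] at h1
    linarith
  obtain ⟨d, rfl⟩ := hce
  refine ⟨⟨⟨0, 0, d⟩, by simp [mem_model_G2]⟩, Subtype.ext ?_⟩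
  ext <;> simp

/-- A square root of the central element (0,0,2) would have the odd last entry 1. -/
theorem not_centerCondition_B1 : ¬ CenterCondition (model .B1) := by
  intro h
  obtain ⟨⟨⟨a, b, c⟩, hy⟩, hyy⟩ := h ⟨⟨0, 0, 2⟩, by simp [mem_model_B1]⟩ (by
    rintro ⟨g, hg⟩
    rw [mem_model_B1] at hg
    apply Subtype.ext
    ext <;> simp [altSign_even (show Even (2 : ℤ) by decide), add_comm])
  rw [mem_model_B1] at hy
  have h1 := congrArg (fun x : model _ => (x : B3Group).c) hyy
  simp at h1 hy
  omega

/-- The only candidate for a square root of the central element (0,0,4) is (0,0,2), which violates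
the congruence. -/
theorem not_centerCondition_B2 : ¬ CenterCondition (model .B2) := by
  intro h
  obtain ⟨⟨⟨a, b, c⟩, hy⟩, hyy⟩ := h ⟨⟨0, 0, 4⟩, by simp [mem_model_B2]⟩ (by
    rintro ⟨g, hg⟩
    apply Subtype.ext
    ext <;> simp [altSign_even (show Even (4 : ℤ) by decide), add_comm])
  rw [mem_model_B2] at hy
  have h1 := congrArg (fun x : model _ => (x : B3Group).c) hyy
  have h2 := congrArg (fun x : model _ => (x : B3Group).b) hyy
  have h3 := congrArg (fun x : model _ => (x : B3Group).a) hyy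
  simp at h1 h2 h3 hy
  obtain rfl : c = 2 := by omega
  simp [altSign_even (show Even (2 : ℤ) by decide)] at h2
  obtain rfl : b = 0 := by omega
  simp [altSign_even (show Even (2 : ℤ) by decide)] at h3
  omega

/-- For even c only the first axis is ever reversed, so every commutator is of the form (2n,0,0),
and (n,0,0) lies in the model. -/
theorem commutatorCondition_B1 : CommutatorCondition (model .B1) := by
  rintro ⟨g, hg⟩ ⟨h, hh⟩
  have hn : ∃ n : ℤ, g.a + altSign g.b * h.a - altSign h.b * g.a = n + n + h.a := by
    rcases altSign_eq g.b with e | e <;> rcases altSign_eq h.b with e' | e' <;> rw [e, e']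
    exacts [⟨0, by ring⟩, ⟨g.a, by ring⟩, ⟨-h.a, by ring⟩, ⟨g.a - h.a, by ring⟩]
  obtain ⟨n, hn⟩ := hn
  refine ⟨⟨⟨n, 0, 0⟩, by simp [mem_model_B1]⟩, Subtype.ext ?_⟩
  change g * h * g⁻¹ = ⟨n, 0, 0⟩ * ⟨n, 0, 0⟩ * h
  rw [conj_eq]
  rw [mem_model_B1, ← even_iff_two_dvd] at hg hh
  ext
  · simp [altSign_add, altSign_even hg, altSign_even hh, hn]
  · simp [altSign_even hg, altSign_even hh]
  · simp

/-- The chosen commutator is (-2,0,0), whose only possible root (-1,0,0) is not in the model. -/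
theorem not_commutatorCondition_B2 : ¬ CommutatorCondition (model .B2) := by
  intro h
  obtain ⟨⟨⟨a, b, c⟩, hy⟩, hyy⟩ := h ⟨⟨0, 1, 0⟩, by simp [mem_model_B2]⟩
    ⟨⟨1, 0, 2⟩, by simp [mem_model_B2]⟩
  rw [mem_model_B2] at hy
  have h1 := congrArg (fun x : model _ => (x : B3Group).c) hyy
  have h2 := congrArg (fun x : model _ => (x : B3Group).b) hyy
  have h3 := congrArg (fun x : model _ => (x : B3Group).a) hyy
  simp at h1 h2 h3 hy
  obtain rfl : c = 0 := by omega
  simp [altSign_even (show Even (2 : ℤ) by decide)] at h2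
  obtain rfl : b = 0 := by omega
  simp at h3
  omega

/-- S₃ inverts S₂, yet S₂ does not commute with S₁². -/
theorem not_inversionCondition_B3 : ¬ InversionCondition (model .B3) := by
  intro h
  have h1 := h ⟨⟨0, 0, 1⟩, mem_model_B3⟩ ⟨⟨0, 1, 0⟩, mem_model_B3⟩ ⟨⟨1, 0, 0⟩, mem_model_B3⟩
    (Subtype.ext (by ext <;> simp))
  have h2 := congrArg (fun x : model _ => (x : B3Group).a) h1
  simp at h2

/-- Inversion forces c = 0 for h. If b is odd, then c is odd for g, so the congruence makes the
first entry of g odd and that of h even. Comparing first entries makes that of g equal to 0 or to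
that of h, which is impossible. -/
theorem inversionCondition_B4 : InversionCondition (model .B4) := by
  rintro ⟨g, hg⟩ ⟨h, hh⟩ ⟨k, hk⟩ hgh
  rw [mem_model_B4] at hg hh
  have h0 : g * h * g⁻¹ = h⁻¹ := congrArg Subtype.val hgh
  rw [conj_eq] at h0
  have h1 := congrArg B3Group.c h0
  have h2 := congrArg B3Group.b h0
  have h3 := congrArg B3Group.a h0
  simp only [inv_a, inv_b, inv_c] at h1 h2 h3
  have hc : h.c = 0 := by omega
  apply Subtype.ext
  change h * (k * k) = k * k * h
  by_cases hb : Even h.b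
  · exact mul_sq_comm_of_even hb (by simp [hc]) k
  · exfalso
    have hne : h.b ≠ 0 := by rintro h; simp [h] at hb
    simp only [hc, altSign_zero, add_zero, altSign_odd hb] at h2 h3
    have hgc : ¬ Even g.c := by
      intro hgc
      rw [altSign_even hgc] at h2
      omega
    rw [even_iff_two_dvd] at hgc
    rcases altSign_eq (g.b + g.c) with e | e <;> rw [e] at h3 <;> omega

/-- Commutativity singles out 𝒢₁. `SquareCondition` separates holonomy of order two (𝒢₂, ℬ₁, ℬ₂)
from (ℤ/2)² (ℬ₃, ℬ₄). Then `CenterCondition` splits off 𝒢₂, `CommutatorCondition` separates ℬ₁ from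
ℬ₂, and `InversionCondition` separates ℬ₃ from ℬ₄. -/
theorem model_injective {X Y : FlatType} (e : model X ≃* model Y) : X = Y := by
  have c1 := commute_transfer e
  have c1' := commute_transfer e.symm
  have c2 := SquareCondition.transfer e
  have c2' := SquareCondition.transfer e.symm
  have c3 := CenterCondition.transfer e
  have c3' := CenterCondition.transfer e.symm
  have c4 := CommutatorCondition.transfer e
  have c4' := CommutatorCondition.transfer e.symm
  have c5 := InversionCondition.transfer e
  have c5' := InversionCondition.transfer e.symm
  have d1 := not_commute_model Y
  have d1' := not_commute_model X
  cases X <;> cases Y <;> first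
    | rfl
    | exact absurd (c1 commute_model_G1) (d1 nofun)
    | exact absurd (c1' commute_model_G1) (d1' nofun)
    | exact absurd (c2 squareCondition_G2) not_squareCondition_B3
    | exact absurd (c2 squareCondition_G2) not_squareCondition_B4
    | exact absurd (c2 squareCondition_B1) not_squareCondition_B3
    | exact absurd (c2 squareCondition_B1) not_squareCondition_B4
    | exact absurd (c2 squareCondition_B2) not_squareCondition_B3
    | exact absurd (c2 squareCondition_B2) not_squareCondition_B4
    | exact absurd (c2' squareCondition_G2) not_squareCondition_B3
    | exact absurd (c2' squareCondition_G2) not_squareCondition_B4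
    | exact absurd (c2' squareCondition_B1) not_squareCondition_B3
    | exact absurd (c2' squareCondition_B1) not_squareCondition_B4
    | exact absurd (c2' squareCondition_B2) not_squareCondition_B3
    | exact absurd (c2' squareCondition_B2) not_squareCondition_B4
    | exact absurd (c3 centerCondition_G2) not_centerCondition_B1
    | exact absurd (c3 centerCondition_G2) not_centerCondition_B2
    | exact absurd (c3' centerCondition_G2) not_centerCondition_B1
    | exact absurd (c3' centerCondition_G2) not_centerCondition_B2
    | exact absurd (c4 commutatorCondition_B1) not_commutatorCondition_B2
    | exact absurd (c4' commutatorCondition_B1) not_commutatorCondition_B2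
    | exact absurd (c5 inversionCondition_B4) not_inversionCondition_B3
    | exact absurd (c5' inversionCondition_B4) not_inversionCondition_B3

end B3Group

@[simp] theorem altSign_two : altSign 2 = 1 := altSign_even even_two

namespace B3Group

/-! ### The type of a subgroup in terms of a basis -/

/-- The condition on a basis for the orbit space to be of the given type. If `B` is odd then `w`
is supposed to be even. -/
def IsType (A B C u w v : ℤ) : FlatType → Prop
  | .G1 => Even B ∧ Even C ∧ Even w
  | .G2 => Even B ∧ ¬ Even C ∧ Even w
  | .B1 => (Even B ∧ ¬ Even w ∧ A ∣ u) ∨ (¬ Even B ∧ Even C ∧ Even w ∧ A ∣ v)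
  | .B2 => (Even B ∧ ¬ Even w ∧ ¬ A ∣ u) ∨ (¬ Even B ∧ Even C ∧ Even w ∧ ¬ A ∣ v)
  | .B3 => ¬ Even B ∧ ¬ Even C ∧ Even w ∧ A ∣ v - u
  | .B4 => ¬ Even B ∧ ¬ Even C ∧ Even w ∧ ¬ A ∣ v - u

/-- The orbit space of the subgroup `H` is homeomorphic to that of the model of type `X`. -/
def HasType (X : FlatType) (H : Subgroup B3Group) : Prop := Nonempty (Orb (model X) ≃ₜ Orb H)

namespace HasBasis

variable {H : Subgroup B3Group} {A B C u w v : ℤ}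

/-- All generators are translations, so the affine map is just the linear change of basis. -/
theorem hasType_G1 (h : HasBasis H A B C u w v) (hB : Even B) (hC : Even C) (hw : Even w) :
    HasType .G1 H := by
  obtain ⟨B, rfl⟩ := hB.two_dvd
  obtain ⟨C, rfl⟩ := hC.two_dvd
  obtain ⟨w, rfl⟩ := hw.two_dvd
  have hA : (A : ℝ) ≠ 0 := by exact_mod_cast h.A_pos.ne'
  have hB : (B : ℝ) ≠ 0 := by exact_mod_cast (by linarith [h.B_pos] : 0 < B).ne'
  have hC : (C : ℝ) ≠ 0 := by exact_mod_cast (by linarith [h.C_pos] : 0 < C).ne'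
  refine nonempty_homeomorph_of_generators
    (triangularHomeomorph A (u / 2) (v / 2) 0 B w 0 C hA hB hC) hasBasis_G1.eq_closure
    h.eq_closure ?_ ?_ ?_ <;> intro e <;>
  · simp [triangularHomeomorph_apply, smul_def, altSign_add]
    try refine ⟨?_, ?_⟩
    all_goals try refine ⟨?_, ?_⟩
    all_goals ring

/-- Here t reverses the first two axes; its entries v and 2w become a shift of the origin to the
axis of the screw motion instead of a shear. -/
theorem hasType_G2 (h : HasBasis H A B C u w v) (hB : Even B) (hC : ¬ Even C) (hw : Even w) :
    HasType .G2 H := by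
  obtain ⟨B, rfl⟩ := hB.two_dvd
  obtain ⟨w, rfl⟩ := hw.two_dvd
  have hA : (A : ℝ) ≠ 0 := by exact_mod_cast h.A_pos.ne'
  have hB : (B : ℝ) ≠ 0 := by exact_mod_cast (by linarith [h.B_pos] : 0 < B).ne'
  have hC0 : (C : ℝ) ≠ 0 := by exact_mod_cast h.C_pos.ne'
  refine nonempty_homeomorph_of_generators
    (triangularHomeomorph A (u / 2) 0 (v / 2) B 0 w C hA hB hC0) hasBasis_G2.eq_closure
    h.eq_closure ?_ ?_ ?_ <;> intro e <;>
  · simp [triangularHomeomorph_apply, smul_def, altSign_add, altSign_odd hC]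
    try refine ⟨?_, ?_⟩
    all_goals try refine ⟨?_, ?_⟩
    all_goals ring

theorem hasType_B1_of_even (h : HasBasis H A B C 0 w v) (hB : Even B) (hw : ¬ Even w) :
    HasType .B1 H := by
  obtain ⟨B, rfl⟩ := hB.two_dvd
  have hA : (A : ℝ) ≠ 0 := by exact_mod_cast h.A_pos.ne'
  have hB : (B : ℝ) ≠ 0 := by exact_mod_cast (by linarith [h.B_pos] : 0 < B).ne'
  have hC0 : (C : ℝ) ≠ 0 := by exact_mod_cast h.C_pos.ne'
  by_cases hC : Even C
  -- Here t reverses the first axis and s is a translation: s and t take the roles of the third and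
  -- second generators of the model.
  · have hH := h.eq_closure
    rw [Set.pair_comm] at hH
    refine nonempty_homeomorph_of_generators
      (swapHomeomorph.trans (triangularHomeomorph A 0 0 (v / 2) B w 0 C hA hB hC0))
      hasBasis_B1.eq_closure hH ?_ ?_ ?_ <;> intro e <;>
    · simp [triangularHomeomorph_apply, swapHomeomorph_apply, smul_def, altSign_add,
        altSign_even hC, altSign_odd hw]
      try refine ⟨?_, ?_⟩
      all_goals try refine ⟨?_, ?_⟩
      all_goals ring
  -- For odd C the axis reversed by t is the second one, so s plays the role of the first generator
  -- of the model, t that of the second and (A,0,0) that of the third.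
  · have hH := h.eq_closure
    rw [Set.insert_comm, Set.pair_comm (⟨A, 0, 0⟩ : B3Group)] at hH
    refine nonempty_homeomorph_of_generators
      (cycleHomeomorph.trans (triangularHomeomorph (A / 2) 0 v 0 (2 * B) 0 (w / 2) C
        (by simpa using hA) (by simpa using hB) hC0))
      hasBasis_B1.eq_closure hH ?_ ?_ ?_ <;> intro e <;>
    · simp [triangularHomeomorph_apply, cycleHomeomorph_apply, smul_def, altSign_add,
        altSign_odd hC, altSign_odd hw]
      try refine ⟨?_, ?_⟩
      all_goals try refine ⟨?_, ?_⟩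
      all_goals ring

theorem hasType_B1_of_odd (h : HasBasis H A B C u w 0) (hB : ¬ Even B) (hC : Even C)
    (hw : Even w) : HasType .B1 H := by
  obtain ⟨C, rfl⟩ := hC.two_dvd
  obtain ⟨w, rfl⟩ := hw.two_dvd
  have hA : (A : ℝ) ≠ 0 := by exact_mod_cast h.A_pos.ne'
  have hB0 : (B : ℝ) ≠ 0 := by exact_mod_cast h.B_pos.ne'
  have hC0 : (C : ℝ) ≠ 0 := by exact_mod_cast (by linarith [h.C_pos] : 0 < C).ne'
  refine nonempty_homeomorph_of_generators
    (triangularHomeomorph A 0 0 (u / 2) B w 0 C hA hB0 hC0)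
    hasBasis_B1.eq_closure h.eq_closure ?_ ?_ ?_ <;> intro e <;>
  · simp [triangularHomeomorph_apply, smul_def, altSign_add, altSign_odd hB]
    try refine ⟨?_, ?_⟩
    all_goals ring

theorem hasType_B2_of_even (h : HasBasis H (2 * A) B C A w v) (hB : Even B) (hw : ¬ Even w) :
    HasType .B2 H := by
  have hA : (A : ℝ) ≠ 0 := by exact_mod_cast (by linarith [h.A_pos] : 0 < A).ne'
  have hB0 : (B : ℝ) ≠ 0 := by exact_mod_cast h.B_pos.ne'
  have hC0 : (C : ℝ) ≠ 0 := by exact_mod_cast h.C_pos.ne'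
  have hH := h.eq_closure
  by_cases hC : Even C
  · rw [Set.pair_comm] at hH
    refine nonempty_homeomorph_of_generators
      (swapHomeomorph.trans (triangularHomeomorph A 0 0 (v / 2) (B / 2) w 0 C hA
        (by simpa using hB0) hC0))
      hasBasis_B2.eq_closure hH ?_ ?_ ?_ <;> intro e <;>
    · simp [triangularHomeomorph_apply, swapHomeomorph_apply, smul_def, altSign_add,
        altSign_even hB, altSign_even hC, altSign_odd hw]
      try refine ⟨?_, ?_⟩
      all_goals try refine ⟨?_, ?_⟩
      all_goals ring
  -- The reversed translation must lie along the second axis, so (2A,0,0) is exchanged for (0,2B,0),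
  -- which is s² up to this element.
  · have hs : (⟨A, B, 0⟩ * ⟨A, B, 0⟩ : B3Group) = ⟨2 * A, 0, 0⟩ * ⟨0, 2 * B, 0⟩ := by
      ext <;> simp [altSign_even hB] <;> ring
    have hH' : H = Subgroup.closure {⟨0, 2 * B, 0⟩, ⟨v, w, C⟩, ⟨A, B, 0⟩} := by
      apply le_antisymm
      · have h2 : (⟨A, B, 0⟩ : B3Group) ∈
            Subgroup.closure {⟨0, 2 * B, 0⟩, ⟨v, w, C⟩, ⟨A, B, 0⟩} :=
          Subgroup.subset_closure (by simp)
        refine h.le ?_ h2 (Subgroup.subset_closure (by simp))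
        have := Subgroup.mul_mem _ h2 h2
        rwa [hs, Subgroup.mul_mem_cancel_right _ (Subgroup.subset_closure (by simp))] at this
      · rw [Subgroup.closure_le]
        have := H.mul_mem h.mem_snd h.mem_snd
        rw [hs, H.mul_mem_cancel_left h.mem_fst] at this
        rintro g (rfl | rfl | rfl)
        exacts [this, h.mem_trd, h.mem_snd]
    refine nonempty_homeomorph_of_generators
      (cycleHomeomorph.trans (triangularHomeomorph (A / 2) 0 v 0 B 0 (w / 2) C
        (by simpa using hA) hB0 hC0))
      hasBasis_B2.eq_closure hH' ?_ ?_ ?_ <;> intro e <;>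
    · simp [triangularHomeomorph_apply, cycleHomeomorph_apply, smul_def, altSign_add,
        altSign_odd hC, altSign_odd hw, altSign_even hB]
      try refine ⟨?_, ?_⟩
      all_goals try refine ⟨?_, ?_⟩
      all_goals ring

theorem hasType_B2_of_odd (h : HasBasis H (2 * A) B C u w A) (hB : ¬ Even B) (hC : Even C)
    (hw : Even w) : HasType .B2 H := by
  obtain ⟨C, rfl⟩ := hC.two_dvd
  obtain ⟨w, rfl⟩ := hw.two_dvd
  have hA : (A : ℝ) ≠ 0 := by exact_mod_cast (by linarith [h.A_pos] : 0 < A).ne'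
  have hB0 : (B : ℝ) ≠ 0 := by exact_mod_cast h.B_pos.ne'
  have hC0 : (C : ℝ) ≠ 0 := by exact_mod_cast (by linarith [h.C_pos] : 0 < C).ne'
  refine nonempty_homeomorph_of_generators
    (triangularHomeomorph A 0 0 (u / 2) B w 0 C hA hB0 hC0)
    hasBasis_B2.eq_closure h.eq_closure ?_ ?_ ?_ <;> intro e <;>
  · simp [triangularHomeomorph_apply, smul_def, altSign_add, altSign_odd hB]
    try refine ⟨?_, ?_⟩
    all_goals try refine ⟨?_, ?_⟩
    all_goals ring

/-- Both s and t reverse the first axis, about u/2 and v/2. For ℬ₃ the centres can be made equal and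
moved to the origin; for ℬ₄, where v = u + A, they differ by A/2, half of the primitive translation
A. -/
theorem hasType_B3 (h : HasBasis H A B C u w u) (hB : ¬ Even B) (hC : ¬ Even C)
    (hw : Even w) : HasType .B3 H := by
  have hA : (A : ℝ) ≠ 0 := by exact_mod_cast h.A_pos.ne'
  have hB0 : (B : ℝ) ≠ 0 := by exact_mod_cast h.B_pos.ne'
  have hC0 : (C : ℝ) ≠ 0 := by exact_mod_cast h.C_pos.ne'
  refine nonempty_homeomorph_of_generators
    (triangularHomeomorph A 0 0 (u / 2) B 0 (w / 2) C hA hB0 hC0)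
    hasBasis_B3.eq_closure h.eq_closure ?_ ?_ ?_ <;> intro e <;>
  · simp [triangularHomeomorph_apply, smul_def, altSign_add, altSign_odd hB, altSign_odd hC,
      altSign_even hw]
    try refine ⟨?_, ?_⟩
    all_goals try refine ⟨?_, ?_⟩
    all_goals ring

theorem hasType_B4 (h : HasBasis H (2 * A) B C u w (u + A)) (hB : ¬ Even B) (hC : ¬ Even C)
    (hw : Even w) : HasType .B4 H := by
  have hA : (A : ℝ) ≠ 0 := by exact_mod_cast (by linarith [h.A_pos] : 0 < A).ne'
  have hB0 : (B : ℝ) ≠ 0 := by exact_mod_cast h.B_pos.ne'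
  have hC0 : (C : ℝ) ≠ 0 := by exact_mod_cast h.C_pos.ne'
  refine nonempty_homeomorph_of_generators
    (triangularHomeomorph A 0 0 (u / 2) B 0 (w / 2) C hA hB0 hC0)
    hasBasis_B4.eq_closure h.eq_closure ?_ ?_ ?_ <;> intro e <;>
  · simp [triangularHomeomorph_apply, smul_def, altSign_add, altSign_odd hB, altSign_odd hC,
      altSign_even hw]
    try refine ⟨?_, ?_⟩
    all_goals try refine ⟨?_, ?_⟩
    all_goals ring

theorem congr_fst (h : HasBasis H A B C u w v) {u' : ℤ} (hu : A ∣ u' - u) :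
    HasBasis H A B C u' w v :=
  h.congr ((h.mem_snd_iff _).2 hu) h.mem_trd

theorem congr_trd (h : HasBasis H A B C u w v) {v' : ℤ} (hv : A ∣ v' - v) :
    HasBasis H A B C u w v' := by
  refine h.congr h.mem_snd ((h.mem_trd_iff _ _).2 ⟨0, by simp, ?_⟩)
  simpa using hv

end HasBasis

/-- An integer with `A ∣ 2 * u` is either divisible by `A` or congruent to `A / 2`. -/
theorem exists_half {A u : ℤ} (h2 : A ∣ 2 * u) (h : ¬ A ∣ u) :
    ∃ A', A = 2 * A' ∧ A ∣ A' - u := by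
  obtain ⟨k, hk⟩ := h2
  have hko : ¬ Even k := by
    rintro ⟨j, rfl⟩
    exact h ⟨j, by linarith⟩
  have hA : Even A := by
    have : Even (A * k) := by rw [← hk]; exact even_two_mul u
    exact (Int.even_mul.1 this).resolve_right hko
  obtain ⟨A', rfl⟩ := hA.two_dvd
  obtain ⟨j, rfl⟩ := Int.not_even_iff_odd.1 hko
  exact ⟨A', rfl, -j, by linarith⟩

/-- The congruence for t leaves two residues for the deciding entry; it may be altered modulo A,
which brings it to the normal form of the preceding lemmas. -/
theorem HasBasis.hasType {H : Subgroup B3Group} {A B C u w v : ℤ} (h : HasBasis H A B C u w v) :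
    ∀ {X : FlatType}, IsType A B C u w v X → HasType X H
  | .G1, hX => h.hasType_G1 hX.1 hX.2.1 hX.2.2
  | .G2, hX => h.hasType_G2 hX.1 hX.2.1 hX.2.2
  | .B1, .inl hX => (h.congr_fst (by simpa using hX.2.2)).hasType_B1_of_even hX.1 hX.2.1
  | .B1, .inr hX => (h.congr_trd (by simpa using hX.2.2.2)).hasType_B1_of_odd hX.1 hX.2.1 hX.2.2.1
  | .B2, .inl hX => by
    obtain ⟨A, rfl, hA⟩ := exists_half (h.two_dvd_of_odd hX.1 hX.2.1) hX.2.2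
    exact (h.congr_fst hA).hasType_B2_of_even hX.1 hX.2.1
  | .B2, .inr hX => by
    obtain ⟨A, rfl, hA⟩ := exists_half (h.dvd_of_even hX.1 hX.2.2.1 hX.2.1) hX.2.2.2
    exact (h.congr_trd hA).hasType_B2_of_odd hX.1 hX.2.1 hX.2.2.1
  | .B3, hX => (h.congr_trd (by rw [← dvd_neg, neg_sub]; exact hX.2.2.2)).hasType_B3
      hX.1 hX.2.1 hX.2.2.1
  | .B4, hX => by
    obtain ⟨A, rfl, hA⟩ := exists_half (h.dvd_of_odd hX.1 hX.2.2.1 hX.2.1) hX.2.2.2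
    exact (h.congr_trd (v' := u + A) (hA.trans (dvd_of_eq (by ring)))).hasType_B4
      hX.1 hX.2.1 hX.2.2.1

theorem HasBasis.exists_isType {H : Subgroup B3Group} {A B C u w v : ℤ}
    (h : HasBasis H A B C u w v) :
    ∃ X w' v', HasBasis H A B C u w' v' ∧ IsType A B C u w' v' X := by
  by_cases hB : Even B
  · by_cases hw : Even w
    · by_cases hC : Even C
      · exact ⟨.G1, w, v, h, hB, hC, hw⟩
      · exact ⟨.G2, w, v, h, hB, hC, hw⟩
    · by_cases hu : A ∣ u
      · exact ⟨.B1, w, v, h, .inl ⟨hB, hw, hu⟩⟩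
      · exact ⟨.B2, w, v, h, .inl ⟨hB, hw, hu⟩⟩
  · obtain ⟨w, v, h, hw⟩ := h.exists_even hB
    by_cases hC : Even C
    · by_cases hv : A ∣ v
      · exact ⟨.B1, w, v, h, .inr ⟨hB, hC, hw, hv⟩⟩
      · exact ⟨.B2, w, v, h, .inr ⟨hB, hC, hw, hv⟩⟩
    · by_cases hv : A ∣ v - u
      · exact ⟨.B3, w, v, h, hB, hC, hw, hv⟩
      · exact ⟨.B4, w, v, h, hB, hC, hw, hv⟩

theorem HasType.eq {X : FlatType} {H : Subgroup B3Group} (h : HasType X H) {Y : FlatType}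
    (h' : Nonempty (H ≃* model Y)) : X = Y := by
  obtain ⟨φ⟩ := h
  obtain ⟨e⟩ := nonempty_mulEquiv_of_homeomorph φ
  obtain ⟨e'⟩ := h'
  exact model_injective (e.trans e')

/-- The subgroups with a basis of the given type. -/
def typeSet (X : FlatType) (A B C : ℤ) : Set (Subgroup B3Group) :=
  {H | ∃ u w v, HasBasis H A B C u w v ∧ IsType A B C u w v X}

theorem exists_typeSet {H : Subgroup B3Group} (hH : H.index ≠ 0) :
    ∃ X A B C, H ∈ typeSet X A B C := by
  obtain ⟨A, B, C, u, w, v, h⟩ := exists_hasBasis_of_index_ne_zero H hH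
  obtain ⟨X, w', v', h, hX⟩ := h.exists_isType
  exact ⟨X, A, B, C, u, w', v', h, hX⟩

/-- Some type always holds, and its model is isomorphic to `H`; since the models are pairwise
non-isomorphic, it must be `X`. -/
theorem nonempty_mulEquiv_model_iff {H : Subgroup B3Group} (hH : H.index ≠ 0) (X : FlatType) :
    Nonempty (H ≃* model X) ↔ ∃ A B C, H ∈ typeSet X A B C := by
  constructor
  · intro e
    obtain ⟨Y, A, B, C, u, w, v, h, hY⟩ := exists_typeSet hH
    obtain rfl := (h.hasType hY).eq e
    exact ⟨A, B, C, u, w, v, h, hY⟩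
  · rintro ⟨A, B, C, u, w, v, h, hX⟩
    obtain ⟨φ⟩ := h.hasType hX
    exact nonempty_mulEquiv_of_homeomorph φ.symm

theorem hasType_iff {H : Subgroup B3Group} (hH : H.index ≠ 0) (X : FlatType) :
    HasType X H ↔ ∃ A B C, H ∈ typeSet X A B C := by
  constructor
  · rintro ⟨φ⟩
    exact (nonempty_mulEquiv_model_iff hH X).1 (nonempty_mulEquiv_of_homeomorph φ.symm)
  · rintro ⟨A, B, C, u, w, v, h, hX⟩
    exact h.hasType hX

end B3Group

/-! ### The six flat manifolds -/

open B3Group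

/-- Rescaling by the diagonal of the model turns the given isometries into its basis. The five
further cases are similar, some with a permutation of coordinates. -/
theorem nonempty_homeomorph_G1 : Nonempty (G1 ≃ₜ Orb (model .G1)) := by
  refine nonempty_homeomorph_of_generators (coordHomeomorph.trans
    (triangularHomeomorph 1 0 0 0 2 0 0 2 (by simp) (by simp) (by simp))) rfl
    hasBasis_G1.eq_closure ?_ ?_ ?_ <;> intro e <;>
  · simp [coordHomeomorph_signedShift, triangularHomeomorph_apply, smul_def]
    try ring

theorem nonempty_homeomorph_G2 : Nonempty (G2 ≃ₜ Orb (model .G2)) := by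
  refine nonempty_homeomorph_of_generators (coordHomeomorph.trans
    (triangularHomeomorph 1 0 0 0 2 0 0 1 (by simp) (by simp) (by simp))) rfl
    hasBasis_G2.eq_closure ?_ ?_ ?_ <;> intro e <;>
  · simp [coordHomeomorph_signedShift, triangularHomeomorph_apply, smul_def]
    try ring

theorem nonempty_homeomorph_B1 : Nonempty (B1 ≃ₜ Orb (model .B1)) := by
  have h := hasBasis_B1.eq_closure
  rw [Set.pair_comm] at h
  refine nonempty_homeomorph_of_generators (coordHomeomorph.trans (swapHomeomorph.trans
    (triangularHomeomorph 1 0 0 0 1 0 0 2 (by simp) (by simp) (by simp)))) rfl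
    h ?_ ?_ ?_ <;> intro e <;>
  · simp [coordHomeomorph_signedShift, triangularHomeomorph_apply, swapHomeomorph_apply, smul_def]
    try ring

theorem nonempty_homeomorph_B2 : Nonempty (B2 ≃ₜ Orb (model .B2)) := by
  -- The generator with shift -1/2 has first entry -1 after scaling by 2, and -1 ≡ 1 modulo 2.
  have h := (hasBasis_B2.congr_trd (v' := -1) (by norm_num)).eq_closure
  rw [Set.pair_comm] at h
  refine nonempty_homeomorph_of_generators (coordHomeomorph.trans (swapHomeomorph.trans
    (triangularHomeomorph 2 0 0 0 1 0 0 2 (by simp) (by simp) (by simp)))) rfl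
    h ?_ ?_ ?_ <;> intro e <;>
  · simp [coordHomeomorph_signedShift, triangularHomeomorph_apply, swapHomeomorph_apply, smul_def]
    try refine ⟨?_, ?_⟩
    all_goals try ring

theorem nonempty_homeomorph_B3 : Nonempty (B3 ≃ₜ Orb (model .B3)) := by
  refine nonempty_homeomorph_of_generators coordHomeomorph rfl
    hasBasis_B3.eq_closure ?_ ?_ ?_ <;> intro e <;>
  simp [coordHomeomorph_signedShift, smul_def]

theorem nonempty_homeomorph_B4 : Nonempty (B4 ≃ₜ Orb (model .B4)) := by
  refine nonempty_homeomorph_of_generators (coordHomeomorph.trans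
    (triangularHomeomorph 2 0 0 0 1 0 0 1 (by simp) (by simp) (by simp))) rfl
    hasBasis_B4.eq_closure ?_ ?_ ?_ <;> intro e <;>
  · simp [coordHomeomorph_signedShift, triangularHomeomorph_apply, smul_def]
    try ring

theorem exists_isQuotientCoveringMap :
    ∃ q : ℝ × ℝ × ℝ → B3, IsQuotientCoveringMap q B3Group := by
  obtain ⟨φ⟩ := nonempty_homeomorph_B3
  have h := isQuotientCoveringMap (model .B3)
  refine ⟨φ.symm ∘ Quotient.mk _, IsQuotientCoveringMap.homeomorph_comp
    { toIsQuotientMap := h.toIsQuotientMap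
      continuous_const_smul := continuous_const_smul
      apply_eq_iff_mem_orbit := ?_
      disjoint := ?_ } φ.symm⟩
  · intro x y
    rw [h.apply_eq_iff_mem_orbit]
    constructor
    · rintro ⟨g, hg⟩
      exact ⟨g, hg⟩
    · rintro ⟨g, hg⟩
      exact ⟨⟨g, mem_model_B3⟩, hg⟩
  · intro v
    obtain ⟨U, hU, h⟩ := exists_nhds_disjoint v
    exact ⟨U, hU, h⟩

/-! ### Representatives of residue classes -/

/-- The least nonnegative representative of a residue class. -/
def residue {n : ℕ} (x : ZMod n) : ℤ := x.val

section residue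

set_option linter.unusedSectionVars false

variable {n : ℕ} [NeZero n]

@[simp] theorem residue_cast (x : ZMod n) : ((residue x : ℤ) : ZMod n) = x := by
  simp [residue]

theorem residue_nonneg (x : ZMod n) : 0 ≤ residue x := Int.natCast_nonneg _

theorem residue_lt (x : ZMod n) : residue x < n := Int.ofNat_lt.2 x.val_lt

theorem exists_residue_eq (n : ℕ) [NeZero n] (x : ℤ) :
    ∃ m : ℤ, x = residue (x : ZMod n) + m * n := by
  have h : ((residue (x : ZMod n) : ℤ) : ZMod n) = (x : ZMod n) := residue_cast _
  rw [ZMod.intCast_eq_intCast_iff_dvd_sub] at h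
  obtain ⟨m, hm⟩ := h
  exact ⟨m, by linarith⟩

theorem eq_zero_of_lt_of_lt {l N : ℤ} (h1 : -N < l * N) (h2 : l * N < N) : l = 0 := by
  have hN : 0 < N := by linarith
  by_contra hl
  rcases lt_or_gt_of_ne hl with h | h
  · nlinarith
  · nlinarith

theorem residue_eq_iff {x y : ZMod n} {l : ℤ} : residue x = residue y + l * n ↔ y = x ∧ l = 0 := by
  constructor
  · intro h
    have hl : l = 0 := eq_zero_of_lt_of_lt (N := (n : ℤ))
      (by linarith [residue_nonneg x, residue_lt y]) (by linarith [residue_lt x, residue_nonneg y])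
    subst hl
    refine ⟨?_, rfl⟩
    rw [← residue_cast y, ← residue_cast x, h]
    simp
  · rintro ⟨rfl, rfl⟩
    simp

theorem residue_neg (x : ZMod n) : residue (-x) = -residue x + (if x = 0 then 0 else 1) * n := by
  unfold residue
  rw [ZMod.neg_val]
  split_ifs with h
  · simp [h]
  · rw [Nat.cast_sub x.val_lt.le]
    ring

/-- Negation wraps around once unless the residue is 0; this exception is visible in the counts for
type 𝒢₁. -/
theorem neg_residue_eq_iff {x y : ZMod n} {l : ℤ} :
    -residue x = residue y + l * n ↔ y = -x ∧ l = -(if x = 0 then 0 else 1) := by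
  rw [show -residue x = residue (-x) + -(if x = 0 then 0 else 1) * n by rw [residue_neg]; ring]
  rw [show residue (-x) + -(if x = 0 then 0 else 1) * n = residue y + l * n ↔
    residue (-x) = residue y + (l + if x = 0 then 0 else 1) * n by
      constructor <;> intro h <;> linarith]
  rw [residue_eq_iff]
  constructor <;> rintro ⟨h1, h2⟩ <;> exact ⟨h1, by linarith⟩

theorem residue_compl (x : ZMod n) : residue (-1 - x) = n - 1 - residue x := by
  obtain ⟨m, hm⟩ := exists_residue_eq n (n - 1 - residue x)
  have h1 : ((n - 1 - residue x : ℤ) : ZMod n) = -1 - x := by simp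
  rw [h1] at hm
  have hm0 : m = 0 := eq_zero_of_lt_of_lt (N := (n : ℤ))
    (by linarith [residue_nonneg (-1 - x), residue_lt (-1 - x), residue_nonneg x, residue_lt x])
    (by linarith [residue_nonneg (-1 - x), residue_lt (-1 - x), residue_nonneg x, residue_lt x])
  rw [hm, hm0]
  ring

/-- Negating the odd number 2j + 1 modulo 2n acts on j as j ↦ -1 - j, and always wraps around
exactly once. -/
theorem compl_residue_eq_iff {x y : ZMod n} {l : ℤ} :
    -(2 * residue x + 1) = 2 * residue y + 1 + l * (2 * n) ↔ y = -1 - x ∧ l = -1 := by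
  rw [show -(2 * residue x + 1) = 2 * residue y + 1 + l * (2 * n) ↔
    residue (-1 - x) = residue y + (l + 1) * n by
      rw [residue_compl]
      constructor <;> intro h <;> linarith]
  rw [residue_eq_iff]
  constructor <;> rintro ⟨h1, h2⟩ <;> exact ⟨h1, by linarith⟩

end residue

/-- The indicator function of the even numbers. -/
def evenInd (n : ℕ) : ℕ := if Even n then 1 else 0

theorem evenInd_even {n : ℕ} (h : Even n) : evenInd n = 1 := if_pos h

theorem evenInd_odd {n : ℕ} (h : ¬ Even n) : evenInd n = 0 := if_neg h

theorem evenInd_le_one (n : ℕ) : evenInd n ≤ 1 := by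
  unfold evenInd; split_ifs <;> simp

section card

set_option linter.unusedSectionVars false

variable {n : ℕ} [NeZero n]

theorem neg_eq_self_iff_of_even {m : ℕ} [NeZero m] (x : ZMod (2 * m)) :
    -x = x ↔ x = 0 ∨ x = (m : ZMod (2 * m)) := by
  have hm : 0 < m := Nat.pos_of_neZero m
  rw [ZMod.neg_eq_self_iff]
  refine or_congr Iff.rfl ⟨fun h => ?_, fun h => ?_⟩
  · rw [← ZMod.natCast_zmod_val x]
    congr 1
    omega
  · rw [h, ZMod.val_natCast, Nat.mod_eq_of_lt (by omega)]

theorem neg_eq_self_iff_of_odd (hn : ¬ Even n) (x : ZMod n) : -x = x ↔ x = 0 := by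
  rw [ZMod.neg_eq_self_iff, or_iff_left]
  intro h
  exact hn (h ▸ even_two_mul _)

theorem half_ne_zero {m : ℕ} [NeZero m] : (m : ZMod (2 * m)) ≠ 0 := by
  have hm : 0 < m := Nat.pos_of_neZero m
  intro h
  rw [ZMod.natCast_eq_zero_iff] at h
  have := Nat.le_of_dvd hm h
  omega

theorem card_neg_eq_self : (Finset.univ.filter fun x : ZMod n => -x = x).card = evenInd n + 1 := by
  by_cases hn : Even n
  · obtain ⟨m, rfl⟩ := hn.two_dvd
    have : NeZero m := ⟨by rintro rfl; exact NeZero.ne (2 * 0) rfl⟩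
    rw [evenInd_even hn]
    simp only [neg_eq_self_iff_of_even]
    rw [show (Finset.univ.filter fun x : ZMod (2 * m) => x = 0 ∨ x = (m : ZMod (2 * m)))
      = {0, (m : ZMod (2 * m))} by ext; simp]
    exact Finset.card_pair half_ne_zero.symm
  · rw [evenInd_odd hn]
    simp only [neg_eq_self_iff_of_odd hn]
    rw [Finset.filter_eq' Finset.univ (0 : ZMod n)]
    simp

/-- A fixed point solves 2x + 1 = 0, which has one solution for odd n and none for even n. -/
theorem card_compl_eq_self :
    (Finset.univ.filter fun x : ZMod n => -1 - x = x).card = 1 - evenInd n := by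
  have h : ∀ x : ZMod n, -1 - x = x ↔ ((2 * residue x + 1 : ℤ) : ZMod n) = 0 := by
    intro x
    push_cast
    rw [residue_cast]
    constructor <;> intro h
    · linear_combination -h
    · linear_combination -h
  by_cases hn : Even n
  · rw [evenInd_even hn, Finset.card_eq_zero, Finset.filter_eq_empty_iff]
    intro x _ hx
    rw [h, ZMod.intCast_zmod_eq_zero_iff_dvd] at hx
    have h2 : (2 : ℤ) ∣ n := by exact_mod_cast hn.two_dvd
    have := h2.trans hx
    omega
  · rw [evenInd_odd hn, Finset.card_eq_one]
    obtain ⟨m, rfl⟩ := Nat.not_even_iff_odd.1 hn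
    have hm : (2 : ZMod (2 * m + 1)) * m + 1 = 0 := by
      have := ZMod.natCast_self (2 * m + 1)
      push_cast at this
      exact this
    refine ⟨(m : ZMod (2 * m + 1)), ?_⟩
    ext x
    simp only [Finset.mem_filter, Finset.mem_univ, true_and, Finset.mem_singleton]
    constructor
    · intro h
      linear_combination x * hm + (m : ZMod (2 * m + 1)) * h
    · rintro rfl
      linear_combination -hm

end card

/-- `gcd(2, n)`, written as a function of `n`. -/
def parityModulus (n : ℕ) : ℕ := evenInd n + 1

instance (n : ℕ) : NeZero (parityModulus n) := ⟨Nat.succ_ne_zero _⟩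

theorem parityModulus_even {n : ℕ} (h : Even n) : parityModulus n = 2 := by
  simp [parityModulus, evenInd_even h]

theorem parityModulus_odd {n : ℕ} (h : ¬ Even n) : parityModulus n = 1 := by
  simp [parityModulus, evenInd_odd h]

theorem parityModulus_dvd (n : ℕ) : parityModulus n ∣ n := by
  by_cases h : Even n
  · rw [parityModulus_even h]; exact h.two_dvd
  · rw [parityModulus_odd h]; exact one_dvd _

theorem two_eq_zero_parity {n : ℕ} : (2 : ZMod (parityModulus n)) = 0 := by
  have : parityModulus n ∣ 2 := by
    by_cases h : Even n
    · rw [parityModulus_even h]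
    · rw [parityModulus_odd h]; exact one_dvd _
  exact_mod_cast (ZMod.natCast_eq_zero_iff 2 _).2 this

theorem neg_eq_parity {n : ℕ} (x : ZMod (parityModulus n)) : -x = x := by
  linear_combination (-x) * two_eq_zero_parity (n := n)

theorem altSign_cast_parity {n : ℕ} (k : ℤ) : ((altSign k : ℤ) : ZMod (parityModulus n)) = 1 := by
  rcases altSign_eq k with h | h <;> simp [h, neg_eq_parity]

/-- Modulo n the numbers 2p are the multiples of gcd(2, n). This eliminates the first entry p of a
conjugator. -/
theorem exists_two_mul_add_iff {n : ℕ} (x : ℤ) :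
    (∃ p : ℤ, (n : ℤ) ∣ 2 * p + x) ↔ ((x : ℤ) : ZMod (parityModulus n)) = 0 := by
  rw [ZMod.intCast_zmod_eq_zero_iff_dvd]
  by_cases h : Even n
  · rw [parityModulus_even h]
    have h2 : (2 : ℤ) ∣ n := by exact_mod_cast h.two_dvd
    constructor
    · rintro ⟨p, hp⟩
      have := h2.trans hp
      push_cast
      omega
    · rintro ⟨k, rfl⟩
      exact ⟨-k, by simp⟩
  · rw [parityModulus_odd h]
    obtain ⟨m, rfl⟩ := Nat.not_even_iff_odd.1 h
    refine iff_of_true ⟨x * m, x, by push_cast; ring⟩ (one_dvd _)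

theorem two_eq_zero_mod_two : (2 : ZMod 2) = 0 := rfl

theorem altSign_cast_mod_two (k : ℤ) : ((altSign k : ℤ) : ZMod 2) = 1 := by
  rcases altSign_eq k with h | h <;> rw [h] <;> rfl

theorem exists_two_mul_add_iff_mod_two {n : ℕ} (x : ℤ) :
    (∃ p : ℤ, (2 * n : ℤ) ∣ 2 * p + x) ↔ ((x : ℤ) : ZMod 2) = 0 := by
  have := exists_two_mul_add_iff (n := 2 * n) x
  rw [parityModulus_even (even_two_mul n)] at this
  exact_mod_cast this

namespace B3Group

/-! ### Conjugacy classes and orbits -/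

section

variable {X : FlatType} {A B C : ℤ} {T : Type} [Fintype T] [DecidableEq T]

/-- `T` parametrizes bases in normal form. The hypotheses say that each parameter occurs, that
conjugacy is the orbit relation of α and β, and that every subgroup of the type is conjugate to a
normal form; Burnside's lemma then applies. -/
theorem four_mul_ncard_typeSet (u w v : T → ℤ) (α β : T → T)
    (hα : Function.Involutive α) (hβ : Function.Involutive β) (hc : ∀ t, α (β t) = β (α t))
    (hbasis : ∀ t, ∃ H, HasBasis H A B C (u t) (w t) (v t))
    (htype : ∀ t, IsType A B C (u t) (w t) (v t) X)
    (hconj : ∀ t t' H K, HasBasis H A B C (u t) (w t) (v t) →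
      HasBasis K A B C (u t') (w t') (v t') →
      (subgroupConj B3Group H K ↔ t' = t ∨ t' = α t ∨ t' = β t ∨ t' = α (β t)))
    (hsurj : ∀ H u₀ w₀ v₀, HasBasis H A B C u₀ w₀ v₀ → IsType A B C u₀ w₀ v₀ X →
      ∃ t, ∀ K, HasBasis K A B C (u t) (w t) (v t) → subgroupConj B3Group H K) :
    4 * (Quotient.mk (subgroupConj B3Group) '' typeSet X A B C).ncard = Fintype.card T +
      (Finset.univ.filter fun t => α t = t).card + (Finset.univ.filter fun t => β t = t).card
      + (Finset.univ.filter fun t => α (β t) = t).card := by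
  choose Φ hΦ using hbasis
  rw [← four_mul_card_range (fun t => Quotient.mk (subgroupConj B3Group) (Φ t)) α β hα hβ hc]
  · congr 2
    ext x
    constructor
    · rintro ⟨H, ⟨u₀, w₀, v₀, hb, ht⟩, rfl⟩
      obtain ⟨t, ht⟩ := hsurj H u₀ w₀ v₀ hb ht
      exact ⟨t, (Quotient.sound (ht _ (hΦ t))).symm⟩
    · rintro ⟨t, rfl⟩
      exact ⟨_, ⟨_, _, _, hΦ t, htype t⟩, rfl⟩
  · intro t t'
    rw [← hconj t t' _ _ (hΦ t) (hΦ t')]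
    exact Quotient.eq

theorem two_mul_ncard_typeSet (u w v : T → ℤ) (α : T → T) (hα : Function.Involutive α)
    (hbasis : ∀ t, ∃ H, HasBasis H A B C (u t) (w t) (v t))
    (htype : ∀ t, IsType A B C (u t) (w t) (v t) X)
    (hconj : ∀ t t' H K, HasBasis H A B C (u t) (w t) (v t) →
      HasBasis K A B C (u t') (w t') (v t') →
      (subgroupConj B3Group H K ↔ t' = t ∨ t' = α t))
    (hsurj : ∀ H u₀ w₀ v₀, HasBasis H A B C u₀ w₀ v₀ → IsType A B C u₀ w₀ v₀ X →
      ∃ t, ∀ K, HasBasis K A B C (u t) (w t) (v t) → subgroupConj B3Group H K) :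
    2 * (Quotient.mk (subgroupConj B3Group) '' typeSet X A B C).ncard = Fintype.card T +
      (Finset.univ.filter fun t => α t = t).card := by
  have h := four_mul_ncard_typeSet u w v α id hα (fun _ => rfl) (fun _ => rfl) hbasis htype
    (fun t t' H K hH hK => by
      rw [hconj t t' H K hH hK]
      simp only [id]
      tauto) hsurj
  simp only [id, Finset.filter_true, Finset.card_univ] at h
  omega

end

/-- Besides w = 0 there is a solution of -w = w, namely B/2, exactly when B is even. -/
theorem card_neg_eq_self_prod (A B : ℕ) [NeZero A] [NeZero B] (P Q : ZMod A × ZMod A → Prop)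
    [DecidablePred P] [DecidablePred Q] : (Finset.univ.filter fun t : ZMod A × ZMod B × ZMod A =>
      -t.2.1 = t.2.1 ∧ if t.2.1 = 0 then P (t.1, t.2.2) else Q (t.1, t.2.2)).card =
      (Finset.univ.filter P).card + evenInd B * (Finset.univ.filter Q).card := by
  have h : ∀ w : ZMod B, ∑ u : ZMod A, ∑ v : ZMod A,
      (if -w = w ∧ if w = 0 then P (u, v) else Q (u, v) then 1 else 0) =
      if -w = w then (if w = 0 then (Finset.univ.filter P).card else (Finset.univ.filter Q).card)
        else 0 := by
    intro w
    rw [Finset.card_filter, Finset.card_filter, Fintype.sum_prod_type, Fintype.sum_prod_type]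
    by_cases h1 : -w = w <;> by_cases h2 : w = 0 <;> simp [h1, h2]
  simp_rw [Finset.card_filter _ (Finset.univ : Finset (ZMod A × ZMod B × ZMod A)),
    Fintype.sum_prod_type]
  rw [Finset.sum_comm]
  simp_rw [h]
  rw [← Finset.sum_filter, ← Finset.add_sum_erase _ _ (a := (0 : ZMod B)) (by simp)]
  congr 1
  · simp
  · rw [Finset.sum_congr rfl fun w hw => if_neg (Finset.ne_of_mem_erase hw), Finset.sum_const,
      Finset.card_erase_of_mem (by simp), card_neg_eq_self]
    simp

theorem card_graph {S R : Type} [Fintype S] [Fintype R] [DecidableEq S] [DecidableEq R]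
    (f : R → S) : (Finset.univ.filter fun t : S × R => t.1 = f t.2).card = Fintype.card R := by
  rw [Finset.card_filter, Fintype.sum_prod_type, Finset.sum_comm]
  simp

theorem card_filter_snd {S R : Type} [Fintype S] [Fintype R] (p : R → Prop) [DecidablePred p] :
    (Finset.univ.filter fun t : S × R => p t.2).card =
      Fintype.card S * (Finset.univ.filter p).card := by
  rw [← Finset.univ_product_univ, ← Finset.card_univ, ← Finset.card_product]
  congr 1
  ext
  simp

theorem card_filter_fst {S R : Type} [Fintype S] [Fintype R] (p : S → Prop) [DecidablePred p] :
    (Finset.univ.filter fun t : S × R => p t.1).card =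
      (Finset.univ.filter p).card * Fintype.card R := by
  rw [← Finset.univ_product_univ, ← Finset.card_univ, ← Finset.card_product]
  congr 1
  ext
  simp

theorem card_filter_prod {S R : Type} [Fintype S] [Fintype R] (p : S → Prop) (q : R → Prop)
    [DecidablePred p] [DecidablePred q] :
    (Finset.univ.filter fun t : S × R => p t.1 ∧ q t.2).card =
      (Finset.univ.filter p).card * (Finset.univ.filter q).card := by
  rw [← Finset.card_product]
  congr 1
  ext
  simp

/-- With B, C and w even, p has no effect, odd q negates u and v, and odd r negates w and v.
Reducing w modulo the second diagonal entry by m factors s changes v by -mu. -/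
theorem four_mul_ncard_typeSet_G1 (A B C : ℕ) [NeZero A] [NeZero B] [NeZero C] :
    4 * (Quotient.mk (subgroupConj B3Group) '' typeSet .G1 A (2 * B) (2 * C)).ncard =
      A ^ 2 * B + B * (evenInd A + 1) ^ 2 + 2 * (A * (evenInd A + 1 + evenInd B)) := by
  have hA : (0 : ℤ) < A := by exact_mod_cast Nat.pos_of_neZero A
  have hB : (0 : ℤ) < 2 * B := by have := Nat.pos_of_neZero B; omega
  have hC : (0 : ℤ) < 2 * C := by have := Nat.pos_of_neZero C; omega
  -- When w is nonzero, bringing -w back into range uses one factor s, which adds u to the third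
  -- entry.
  let ε : ZMod A × ZMod B × ZMod A → ZMod A := fun t => if t.2.1 = 0 then 0 else t.1
  rw [four_mul_ncard_typeSet (T := ZMod A × ZMod B × ZMod A) (fun t => residue t.1)
    (fun t => 2 * residue t.2.1) (fun t => residue t.2.2)
    (fun t => (t.1, -t.2.1, -t.2.2 + ε t)) (fun t => (-t.1, t.2.1, -t.2.2))]
  · have e1 : (Finset.univ.filter fun t : ZMod A × ZMod B × ZMod A =>
        ((t.1, -t.2.1, -t.2.2 + ε t) : ZMod A × ZMod B × ZMod A) = t).card =
        A * (evenInd A + 1 + evenInd B) := by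
      have := card_neg_eq_self_prod A B (fun x => -x.2 = x.2) (fun x => x.1 = x.2 + x.2)
      rw [card_graph fun x : ZMod A => x + x, card_filter_snd (S := ZMod A) fun x : ZMod A => -x = x,
        card_neg_eq_self, ZMod.card] at this
      rw [mul_add, mul_comm A (evenInd B), ← this]
      congr 1
      ext ⟨u, w, v⟩
      by_cases hw : w = 0
      · simp [ε, hw]
      · simp only [ε, hw, Finset.mem_filter, Finset.mem_univ, true_and, Prod.mk.injEq, if_false]
        refine and_congr Iff.rfl ⟨fun h => ?_, fun h => ?_⟩ <;> linear_combination h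
    have e2 : (Finset.univ.filter fun t : ZMod A × ZMod B × ZMod A =>
        ((-t.1, t.2.1, -t.2.2) : ZMod A × ZMod B × ZMod A) = t).card =
        B * (evenInd A + 1) ^ 2 := by
      have := card_filter_prod (S := ZMod A) (R := ZMod B × ZMod A) (fun x => -x = x)
        (fun x => -x.2 = x.2)
      rw [card_filter_snd (S := ZMod B) fun x : ZMod A => -x = x, card_neg_eq_self,
        ZMod.card] at this
      rw [show B * (evenInd A + 1) ^ 2 = (evenInd A + 1) * (B * (evenInd A + 1)) by ring, ← this]
      congr 1
      ext ⟨u, w, v⟩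
      simp
    have e3 : (Finset.univ.filter fun t : ZMod A × ZMod B × ZMod A =>
        ((-t.1, -t.2.1, - -t.2.2 + ε (-t.1, t.2.1, -t.2.2)) : ZMod A × ZMod B × ZMod A) = t).card =
        A * (evenInd A + 1 + evenInd B) := by
      have := card_neg_eq_self_prod A B (fun x => -x.1 = x.1) (fun x => x.1 = 0)
      rw [card_graph (fun _ => 0), ZMod.card,
        card_filter_fst (R := ZMod A) fun x : ZMod A => -x = x, card_neg_eq_self, ZMod.card] at this
      rw [show A * (evenInd A + 1 + evenInd B) = (evenInd A + 1) * A + evenInd B * A by ring,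
        ← this]
      congr 1
      ext ⟨u, w, v⟩
      by_cases hw : w = 0
      · simp [ε, hw]
      · simp only [ε, hw, Finset.mem_filter, Finset.mem_univ, true_and, Prod.mk.injEq, if_false]
        constructor
        · rintro ⟨h1, h2, h3⟩
          exact ⟨h2, by linear_combination -h3⟩
        · rintro ⟨h1, h2⟩
          exact ⟨by simp [h2], h1, by simp [h2]⟩
    rw [e1, e2, e3]
    simp [ZMod.card]
    ring
  · intro t
    simp only [ε, neg_neg, neg_eq_zero]
    ext <;> simp
  · intro t
    simp
  · intro t
    simp only [ε, neg_neg]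
    split_ifs <;> simp [add_comm]
  · intro t
    exact exists_hasBasis_of_even hA hB hC (even_two_mul _) (Or.inl (even_two_mul _))
  · intro t
    exact ⟨even_two_mul _, even_two_mul _, even_two_mul _⟩
  · rintro ⟨u, w, v⟩ ⟨u', w', v'⟩ H K hH hK
    rw [hH.conj_iff_of_even hK (even_two_mul _)]
    simp only [← ZMod.intCast_zmod_eq_zero_iff_dvd, altSign_add, altSign_two_mul, one_mul,
      Prod.mk.injEq, ε]
    push_cast
    simp only [residue_cast]
    constructor
    · rintro ⟨p, q, r, l, h1, h2, h3⟩
      have h2' : altSign r * residue w = residue w' + l * B := by linarith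
      rcases altSign_eq q with eq | eq <;> rcases altSign_eq r with er | er <;>
        rw [er] at h2' h3 <;> rw [eq] at h1 h3 <;>
        simp only [one_mul, neg_mul, residue_eq_iff, neg_residue_eq_iff] at h2' <;>
        obtain ⟨rfl, rfl⟩ := h2' <;> push_cast at h1 h3
      · left
        exact ⟨by linear_combination -h1, rfl, by linear_combination -h3⟩
      · right; left
        have hu : u' = u := by linear_combination -h1
        refine ⟨hu, rfl, ?_⟩
        subst hu
        split_ifs at h3 ⊢ <;> linear_combination -h3
      · right; right; left
        exact ⟨by linear_combination -h1, rfl, by linear_combination -h3⟩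
      · right; right; right
        have hu : u' = -u := by linear_combination -h1
        refine ⟨hu, rfl, ?_⟩
        subst hu
        split_ifs at h3 ⊢ <;> linear_combination -h3
    · rintro (⟨rfl, rfl, rfl⟩ | ⟨rfl, rfl, rfl⟩ | ⟨rfl, rfl, rfl⟩ | ⟨rfl, rfl, rfl⟩)
      · exact ⟨0, 0, 0, 0, by simp, by simp, by simp⟩
      · refine ⟨0, 0, 1, -(if w = 0 then 0 else 1), by simp, ?_, ?_⟩
        · simp only [altSign_one, residue_neg]
          split_ifs <;> ring
        · split_ifs <;> simp
      · exact ⟨0, 1, 0, 0, by simp, by simp, by simp⟩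
      · refine ⟨0, 1, 1, -(if w = 0 then 0 else 1), by simp, ?_, ?_⟩
        · simp only [altSign_one, residue_neg]
          split_ifs <;> ring
        · split_ifs <;> simp <;> ring
  · intro H u w v hH hX
    obtain ⟨w, rfl⟩ := hX.2.2.two_dvd
    obtain ⟨m, hm⟩ := exists_residue_eq B w
    refine ⟨((u : ZMod A), (w : ZMod B), ((v - m * u : ℤ) : ZMod A)), fun K hK => ?_⟩
    rw [hH.conj_iff_of_even hK (even_two_mul _)]
    refine ⟨0, 0, 0, m, ?_, ?_, ?_⟩
    · simp only [← ZMod.intCast_zmod_eq_zero_iff_dvd]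
      simp
    · simp
      linarith
    · simp only [← ZMod.intCast_zmod_eq_zero_iff_dvd]
      simp

end B3Group

/-! ### Conjugacy classes of type 𝒢₂ -/

namespace B3Group

theorem altSign_mul_of_odd {l : ℤ} (hl : ¬ Even l) (b : ℤ) : altSign (l * b) = altSign b := by
  simp [altSign, Int.even_mul, hl]

theorem intCast_parity_of_even {n : ℕ} {l : ℤ} (hl : Even l) :
    ((l : ℤ) : ZMod (parityModulus n)) = 0 := by
  obtain ⟨k, rfl⟩ := hl.two_dvd
  push_cast
  rw [two_eq_zero_parity, zero_mul]

theorem intCast_parity_of_odd {n : ℕ} {l : ℤ} (hl : ¬ Even l) :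
    ((l : ℤ) : ZMod (parityModulus n)) = 1 := by
  obtain ⟨k, rfl⟩ := Int.not_even_iff_odd.1 hl
  push_cast
  rw [two_eq_zero_parity, zero_mul, zero_add]

/-- Reduction of residue classes modulo `n` to those modulo `gcd(2, n)`. -/
def reduceParity (n : ℕ) : ZMod n →+* ZMod (parityModulus n) :=
  ZMod.castHom (parityModulus_dvd n) _

theorem reduceParity_intCast {n : ℕ} (x : ℤ) : reduceParity n x = (x : ZMod (parityModulus n)) :=
  map_intCast _ _

theorem cast_residue_eq_reduceParity {n : ℕ} [NeZero n] (x : ZMod n) :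
    ((residue x : ℤ) : ZMod (parityModulus n)) = reduceParity n x := by
  rw [← reduceParity_intCast, residue_cast]

theorem card_reduceParity_eq_zero (n : ℕ) [NeZero n] :
    (Finset.univ.filter fun x : ZMod n => reduceParity n x = 0).card * parityModulus n = n := by
  have h := AddSubgroup.card_mul_index (reduceParity n).toAddMonoidHom.ker
  rw [AddSubgroup.index_ker, AddMonoidHom.range_eq_top.2
    (ZMod.ringHom_surjective (reduceParity n))] at h
  rw [AddSubgroup.card_top, Nat.card_zmod, Nat.card_zmod] at h
  refine Eq.trans (congrArg (· * parityModulus n) ?_) h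
  rw [Nat.card_eq_fintype_card, Fintype.card_subtype]
  congr 1
  ext x
  simp [AddMonoidHom.mem_ker]

/-- The only solutions of -x = x are 0 and, for even n, n/2; the latter reduces to 0 when n/2 is
even. -/
theorem card_neg_eq_self_reduceParity (n : ℕ) [NeZero n] :
    (Finset.univ.filter fun x : ZMod n => -x = x ∧ reduceParity n x = 0).card * parityModulus n =
      1 + evenInd n + 2 * (evenInd n * evenInd (n / 2)) := by
  by_cases hn : Even n
  · obtain ⟨m, rfl⟩ := hn.two_dvd
    have : NeZero m := ⟨by rintro rfl; exact NeZero.ne (2 * 0) rfl⟩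
    have hm : reduceParity (2 * m) (m : ZMod (2 * m)) = 0 ↔ Even m := by
      rw [← Int.cast_natCast, reduceParity_intCast, ZMod.intCast_zmod_eq_zero_iff_dvd,
        parityModulus_even hn]
      rw [even_iff_two_dvd]
      norm_cast
    have hcard : (Finset.univ.filter fun x : ZMod (2 * m) =>
        -x = x ∧ reduceParity (2 * m) x = 0).card = 1 + evenInd m := by
      simp only [neg_eq_self_iff_of_even]
      by_cases he : Even m
      · rw [evenInd_even he]
        rw [show (Finset.univ.filter fun x : ZMod (2 * m) => (x = 0 ∨ x = (m : ZMod (2 * m))) ∧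
          reduceParity (2 * m) x = 0) = {0, (m : ZMod (2 * m))} by
            ext x
            simp only [Finset.mem_filter, Finset.mem_univ, true_and, Finset.mem_insert,
              Finset.mem_singleton, and_iff_left_iff_imp]
            rintro (rfl | rfl)
            exacts [map_zero _, hm.2 he], Finset.card_pair half_ne_zero.symm]
      · rw [evenInd_odd he]
        rw [show (Finset.univ.filter fun x : ZMod (2 * m) => (x = 0 ∨ x = (m : ZMod (2 * m))) ∧
          reduceParity (2 * m) x = 0) = {0} by
            ext x
            simp only [Finset.mem_filter, Finset.mem_univ, true_and, Finset.mem_singleton]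
            constructor
            · rintro ⟨rfl | rfl, h⟩
              exacts [rfl, absurd (hm.1 h) he]
            · rintro rfl
              exact ⟨Or.inl rfl, map_zero _⟩]
        simp
    rw [hcard, parityModulus_even hn, evenInd_even hn, Nat.mul_div_cancel_left m two_pos]
    ring
  · have hcard : (Finset.univ.filter fun x : ZMod n => -x = x ∧ reduceParity n x = 0).card = 1 := by
      simp only [neg_eq_self_iff_of_odd hn]
      rw [show (Finset.univ.filter fun x : ZMod n => x = 0 ∧ reduceParity n x = 0) = {0} by
        ext x
        simp +contextual]
      simp
    rw [hcard, parityModulus_odd hn, evenInd_odd hn]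
    simp

/-- For odd C, conjugation by q moves w by 2q, so w can be made 0, and p moves v by 2p, so v matters
modulo gcd(2, A). The conjugators preserving w = 0 have q = lB and generate the one involution on
(u, v). -/
theorem two_mul_ncard_typeSet_G2 (A B C : ℕ) [NeZero A] [NeZero B] (hC : ¬ Even C) :
    2 * (Quotient.mk (subgroupConj B3Group) '' typeSet .G2 A (2 * B) C).ncard =
      A * (evenInd A + 1) + (evenInd B * A + (1 - evenInd B) *
        (1 + evenInd A + 2 * (evenInd A * evenInd (A / 2)))) := by
  have hA0 : (0 : ℤ) < A := by exact_mod_cast Nat.pos_of_neZero A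
  have hB0 : (0 : ℤ) < 2 * B := by have := Nat.pos_of_neZero B; omega
  have hC0 : (0 : ℤ) < C := by exact_mod_cast Nat.pos_of_ne_zero (by rintro rfl; simp at hC)
  have hCz : ¬ Even (C : ℤ) := by exact_mod_cast hC
  rw [two_mul_ncard_typeSet (T := ZMod A × ZMod (parityModulus A)) (fun t => residue t.1)
    (fun _ => 0) (fun t => residue t.2)
    (fun t => ((altSign B : ℤ) * t.1, t.2 + reduceParity A t.1))]
  · rw [Fintype.card_prod, ZMod.card, ZMod.card]
    congr 1
    by_cases hB : Even B
    · have hBz : Even (B : ℤ) := by exact_mod_cast hB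
      rw [evenInd_even hB, altSign_even hBz]
      simp [Prod.ext_iff]
      rw [card_filter_fst (R := ZMod (parityModulus A)) fun x : ZMod A => reduceParity A x = 0,
        ZMod.card, card_reduceParity_eq_zero]
    · have hBz : ¬ Even (B : ℤ) := by exact_mod_cast hB
      rw [evenInd_odd hB, altSign_odd hBz, ← card_neg_eq_self_reduceParity]
      simp [Prod.ext_iff]
      rw [card_filter_fst (R := ZMod (parityModulus A)) fun x : ZMod A =>
        -x = x ∧ reduceParity A x = 0, ZMod.card]
  · rintro ⟨u, v⟩
    simp only [map_mul, reduceParity_intCast, altSign_cast_parity, one_mul, Prod.mk.injEq]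
    constructor
    · rw [← mul_assoc, ← Int.cast_mul, altSign_mul_self, Int.cast_one, one_mul]
    · linear_combination reduceParity A u * two_eq_zero_parity
  · intro t
    exact exists_hasBasis_of_even hA0 hB0 hC0 (even_two_mul _) (Or.inl Even.zero)
  · intro t
    exact ⟨even_two_mul _, hCz, Even.zero⟩
  · rintro ⟨u, v⟩ ⟨u', v'⟩ H K hH hK
    rw [hH.conj_iff_of_even hK (even_two_mul _)]
    simp only [altSign_odd hCz, zero_add, mul_zero, add_zero]
    constructor
    · rintro ⟨p, q, r, l, h1, h2, h3⟩
      obtain rfl : q = l * B := by linarith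
      have h3' := (exists_two_mul_add_iff _).1 ⟨p, h3.trans (dvd_of_eq (show _ =
        2 * p + (altSign (l * B + r) * residue v - l * residue u' - residue v') by ring))⟩
      rw [← ZMod.intCast_zmod_eq_zero_iff_dvd] at h1
      push_cast at h1 h3'
      rw [altSign_cast_parity, cast_residue_eq_reduceParity, residue_cast, residue_cast] at h3'
      rw [residue_cast, residue_cast] at h1
      by_cases hl : Even l
      · left
        rw [altSign_even (hl.mul_right _)] at h1
        rw [intCast_parity_of_even hl] at h3'
        ext
        · push_cast at h1
          linear_combination -h1
        · linear_combination -h3'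
      · right
        rw [altSign_mul_of_odd hl] at h1
        rw [intCast_parity_of_odd hl] at h3'
        have hu : u' = (altSign B : ℤ) * u := by linear_combination -h1
        subst hu
        rw [map_mul, reduceParity_intCast, altSign_cast_parity] at h3'
        ext
        · rfl
        · linear_combination -h3' - reduceParity A u * two_eq_zero_parity
    · have key : ∀ l : ℤ, u' = ((altSign (l * B) : ℤ) : ZMod A) * u →
          v' = v - l * reduceParity A u' → ∃ p q r l : ℤ, (A : ℤ) ∣ altSign q * residue u - residue u' ∧
          q - -1 * q = l * (2 * B) ∧ (A : ℤ) ∣ p + altSign (q + r) * residue v - -1 * p -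
            l * residue u' - residue v' := by
        intro l hu hv
        obtain ⟨p, hp⟩ := (exists_two_mul_add_iff (n := A)
          (altSign (l * B + 0) * residue v - l * residue u' - residue v')).2 (by
            push_cast
            rw [altSign_cast_parity, cast_residue_eq_reduceParity, residue_cast, residue_cast, hv]
            ring)
        refine ⟨p, l * B, 0, l, ?_, by ring, hp.trans (dvd_of_eq (by ring))⟩
        rw [← ZMod.intCast_zmod_eq_zero_iff_dvd]
        push_cast
        rw [residue_cast, residue_cast, hu, sub_self]
      rintro (h | h)
      · obtain ⟨rfl, rfl⟩ := Prod.ext_iff.1 h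
        exact key 0 (by simp) (by simp)
      · obtain ⟨rfl, rfl⟩ := Prod.ext_iff.1 h
        refine key 1 (by simp) ?_
        rw [map_mul, reduceParity_intCast, altSign_cast_parity]
        push_cast
        linear_combination reduceParity A u * two_eq_zero_parity
  · intro H u w v hH hX
    obtain ⟨w, rfl⟩ := hX.2.2.two_dvd
    refine ⟨(((altSign w * u : ℤ) : ZMod A), (v : ZMod (parityModulus A))), fun K hK => ?_⟩
    rw [hH.conj_iff_of_even hK (even_two_mul _)]
    obtain ⟨p, hp⟩ := (exists_two_mul_add_iff (n := A)
      (altSign (-w) * v - residue (v : ZMod (parityModulus A)))).2 (by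
        push_cast
        rw [altSign_cast_parity, residue_cast]
        ring)
    refine ⟨p, -w, 0, 0, ?_, ?_, ?_⟩
    · rw [← ZMod.intCast_zmod_eq_zero_iff_dvd]
      simp
    · simp [altSign_odd hCz]
      ring
    · simp only [altSign_add, altSign_two_mul, altSign_odd hCz, altSign_zero, mul_one]
      exact hp.trans (dvd_of_eq (by ring))

end B3Group

/-! ### Conjugacy classes of types ℬ₁, ℬ₂, ℬ₃ and ℬ₄ -/

namespace B3Group

/-- Here u ≡ 0 and w = 2j + 1. Since t reverses the first axis, v matters modulo gcd(2, A), and odd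
r acts by j ↦ -1 - j. -/
theorem two_mul_ncard_typeSet_B1_of_even_of_even (A B C : ℕ) [NeZero A] [NeZero B] [NeZero C] :
    2 * (Quotient.mk (subgroupConj B3Group) '' typeSet .B1 A (2 * B) (2 * C)).ncard =
      (evenInd A + 1) * (B + (1 - evenInd B)) := by
  have hA0 : (0 : ℤ) < A := by exact_mod_cast Nat.pos_of_neZero A
  have hB0 : (0 : ℤ) < 2 * B := by have := Nat.pos_of_neZero B; omega
  have hC0 : (0 : ℤ) < 2 * C := by have := Nat.pos_of_neZero C; omega
  have hw : ∀ x : ℤ, ¬ Even (2 * x + 1) := fun x => by simp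
  rw [two_mul_ncard_typeSet (T := ZMod B × ZMod (parityModulus A)) (fun _ => 0)
    (fun t => 2 * residue t.1 + 1) (fun t => residue t.2) (fun t => (-1 - t.1, t.2))]
  · simp [Prod.ext_iff]
    rw [card_filter_fst (R := ZMod (parityModulus A)) fun x : ZMod B => -1 - x = x,
      card_compl_eq_self, ZMod.card, parityModulus]
    ring
  · rintro ⟨j, v⟩
    simp
  · intro t
    exact exists_hasBasis_of_even hA0 hB0 hC0 (even_two_mul _) (Or.inr (by simp))
  · intro t
    exact Or.inl ⟨even_two_mul _, hw _, dvd_zero _⟩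
  · rintro ⟨j, v⟩ ⟨j', v'⟩ H K hH hK
    rw [hH.conj_iff_of_even hK (even_two_mul _)]
    simp only [altSign_two_mul, altSign_add, altSign_one]
    constructor
    · rintro ⟨p, q, r, l, -, h2, h3⟩
      have h3' := (exists_two_mul_add_iff _).1 ⟨p, h3.trans (dvd_of_eq (show _ =
        2 * p + (altSign q * altSign r * residue v - residue v') by ring))⟩
      push_cast at h3'
      rw [altSign_cast_parity, altSign_cast_parity, residue_cast, residue_cast] at h3'
      have hv : v' = v := by linear_combination -h3'
      subst hv
      rcases altSign_eq r with er | er <;> rw [er] at h2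
      · left
        rw [(residue_eq_iff.1 (show residue j = residue j' + l * B by linarith)).1]
      · right
        rw [(compl_residue_eq_iff.1 (show -(2 * residue j + 1) = 2 * residue j' + 1 + l * (2 * B) by
          linarith)).1]
    · rintro (h | h) <;> obtain ⟨rfl, h2⟩ := Prod.mk.inj h <;>
        obtain rfl := h2.symm
      · exact ⟨0, 0, 0, 0, by simp, by simp, by simp⟩
      · obtain ⟨p, hp⟩ := (exists_two_mul_add_iff (n := A) (-residue v - residue v)).2 (by
          push_cast
          rw [residue_cast]
          linear_combination -v * two_eq_zero_parity)
        refine ⟨p, 0, 1, -1, by simp, ?_, ?_⟩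
        · simp only [residue_compl, altSign_one]
          ring
        · simp only [altSign_zero, altSign_one]
          exact hp.trans (dvd_of_eq (by ring))
  · rintro H u w v hH (hX | hX)
    · obtain ⟨w, rfl⟩ := Int.not_even_iff_odd.1 hX.2.1
      obtain ⟨m, hm⟩ := exists_residue_eq B w
      refine ⟨((w : ZMod B), (v : ZMod (parityModulus A))), fun K hK => ?_⟩
      rw [hH.conj_iff_of_even hK (even_two_mul _)]
      obtain ⟨p, hp⟩ := (exists_two_mul_add_iff (n := A)
        (v - residue (v : ZMod (parityModulus A)))).2 (by simp)
      refine ⟨p, 0, 0, m, by simpa using hX.2.2, ?_, ?_⟩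
      · simp
        linarith
      · simp only [altSign_add, altSign_two_mul, altSign_one, altSign_zero]
        exact hp.trans (dvd_of_eq (by ring))
    · exact absurd (even_two_mul _) hX.1

/-- Conjugation by q makes w = 1. As t preserves the first axis, p has no effect and v is a full
residue modulo A, up to a sign which is trivial for even B. -/
theorem two_mul_ncard_typeSet_B1_of_even_of_odd (A B C : ℕ) [NeZero A] [NeZero B]
    (hC : ¬ Even C) :
    2 * (Quotient.mk (subgroupConj B3Group) '' typeSet .B1 A (2 * B) C).ncard =
      A + (evenInd B * A + (1 - evenInd B) * (evenInd A + 1)) := by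
  have hA0 : (0 : ℤ) < A := by exact_mod_cast Nat.pos_of_neZero A
  have hB0 : (0 : ℤ) < 2 * B := by have := Nat.pos_of_neZero B; omega
  have hC0 : (0 : ℤ) < C := by exact_mod_cast Nat.pos_of_ne_zero (by rintro rfl; simp at hC)
  have hCz : ¬ Even (C : ℤ) := by exact_mod_cast hC
  rw [two_mul_ncard_typeSet (T := ZMod A) (fun _ => 0) (fun _ => 1) (fun t => residue t)
    (fun t => (altSign B : ℤ) * t)]
  · rw [ZMod.card]
    congr 1
    by_cases hB : Even B
    · have hBz : Even (B : ℤ) := by exact_mod_cast hB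
      rw [evenInd_even hB, altSign_even hBz]
      simp
    · have hBz : ¬ Even (B : ℤ) := by exact_mod_cast hB
      rw [evenInd_odd hB, altSign_odd hBz, ← card_neg_eq_self]
      simp
  · intro v
    simp only
    rw [← mul_assoc, ← Int.cast_mul, altSign_mul_self, Int.cast_one, one_mul]
  · intro t
    exact exists_hasBasis_of_even hA0 hB0 hC0 (even_two_mul _) (Or.inr (by simp))
  · intro t
    exact Or.inl ⟨even_two_mul _, by simp, dvd_zero _⟩
  · rintro v v' H K hH hK
    rw [hH.conj_iff_of_even hK (even_two_mul _)]
    simp only [altSign_odd hCz, altSign_add, altSign_one, ← ZMod.intCast_zmod_eq_zero_iff_dvd]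
    constructor
    · rintro ⟨p, q, r, l, -, h2, h3⟩
      -- Preserving w = 1 ties q to r: an odd r must be compensated by q = lB + 1, so the two signs
      -- combine to that of lB.
      have hs : altSign q * altSign r = altSign (l * B) := by
        rcases altSign_eq r with er | er <;> rw [er] at h2 ⊢
        · obtain rfl : q = l * B := by linarith
          ring
        · obtain rfl : q = l * B + 1 := by linarith
          rw [altSign_add, altSign_one]
          ring
      rw [hs] at h3
      push_cast at h3
      rw [residue_cast, residue_cast] at h3
      by_cases hl : Even l
      · left
        rw [altSign_even (hl.mul_right _)] at h3
        push_cast at h3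
        linear_combination -h3
      · right
        rw [altSign_mul_of_odd hl] at h3
        linear_combination -h3
    · rintro (rfl | rfl)
      · exact ⟨0, 0, 0, 0, by simp, by simp, by simp⟩
      · exact ⟨0, B, 0, 1, by simp, by simp; ring, by simp⟩
  · rintro H u w v hH (hX | hX)
    · obtain ⟨w, rfl⟩ := Int.not_even_iff_odd.1 hX.2.1
      refine ⟨((altSign w * v : ℤ) : ZMod A), fun K hK => ?_⟩
      rw [hH.conj_iff_of_even hK (even_two_mul _)]
      refine ⟨0, -w, 0, 0, by simpa using hX.2.2.mul_left _, ?_, ?_⟩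
      · simp [altSign_odd hCz]
        ring
      · rw [← ZMod.intCast_zmod_eq_zero_iff_dvd]
        simp
    · exact absurd (even_two_mul _) hX.1

/-- Here v ≡ 0 and w = 2j. Since s reverses the first axis, u matters modulo gcd(2, A), and odd r
acts by j ↦ -j. -/
theorem two_mul_ncard_typeSet_B1_of_odd (A B C : ℕ) [NeZero A] (hB : ¬ Even B) [NeZero C] :
    2 * (Quotient.mk (subgroupConj B3Group) '' typeSet .B1 A B (2 * C)).ncard =
      (evenInd A + 1) * (B + 1) := by
  have hA0 : (0 : ℤ) < A := by exact_mod_cast Nat.pos_of_neZero A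
  have : NeZero B := ⟨by rintro rfl; simp at hB⟩
  have hB0 : (0 : ℤ) < B := by exact_mod_cast Nat.pos_of_neZero B
  have hC0 : (0 : ℤ) < 2 * C := by have := Nat.pos_of_neZero C; omega
  have hBz : ¬ Even (B : ℤ) := by exact_mod_cast hB
  rw [two_mul_ncard_typeSet (T := ZMod B × ZMod (parityModulus A)) (fun t => residue t.2)
    (fun t => 2 * residue t.1) (fun _ => 0) (fun t => (-t.1, t.2))]
  · simp [Prod.ext_iff]
    rw [card_filter_fst (R := ZMod (parityModulus A)) fun x : ZMod B => -x = x,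
      card_neg_eq_self, ZMod.card, parityModulus, evenInd_odd hB]
    ring
  · rintro ⟨j, v⟩
    simp
  · intro t
    exact exists_hasBasis_of_odd hA0 hB0 hC0 hBz (even_two_mul _) (by simp)
  · intro t
    exact Or.inr ⟨hBz, even_two_mul _, even_two_mul _, dvd_zero _⟩
  · rintro ⟨j, u⟩ ⟨j', u'⟩ H K hH hK
    rw [hH.conj_iff_of_odd hK hBz (even_two_mul _) (even_two_mul _)]
    simp only [altSign_two_mul]
    constructor
    · rintro ⟨p, q, r, k, h1, h2, -⟩
      have h1' := (exists_two_mul_add_iff _).1 ⟨p, h1.trans (dvd_of_eq (show _ =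
        2 * p + (altSign (q + r) * residue u - residue u') by ring))⟩
      push_cast at h1'
      rw [altSign_cast_parity, residue_cast, residue_cast] at h1'
      have hu : u' = u := by linear_combination -h1'
      subst hu
      rcases altSign_eq r with er | er <;> rw [er] at h2
      · left
        rw [(residue_eq_iff.1 (show residue j = residue j' + k * B by linarith)).1]
      · right
        rw [(neg_residue_eq_iff.1 (show -residue j = residue j' + k * B by linarith)).1]
    · rintro (h | h) <;> obtain ⟨rfl, h2⟩ := Prod.mk.inj h <;>
        obtain rfl := h2.symm
      · exact ⟨0, 0, 0, 0, by simp, by simp, by simp⟩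
      · obtain ⟨p, hp⟩ := (exists_two_mul_add_iff (n := A) (-residue u - residue u)).2 (by
          push_cast
          rw [residue_cast]
          linear_combination -u * two_eq_zero_parity)
        refine ⟨p, 0, 1, -(if j = 0 then 0 else 1), ?_, ?_, by simp⟩
        · simp only [zero_add, altSign_one]
          exact hp.trans (dvd_of_eq (by ring))
        · simp only [residue_neg, altSign_one]
          ring
  · rintro H u w v hH (hX | hX)
    · exact absurd hX.1 hBz
    · obtain ⟨w, rfl⟩ := hX.2.2.1.two_dvd
      obtain ⟨m, hm⟩ := exists_residue_eq B w
      refine ⟨((w : ZMod B), (u : ZMod (parityModulus A))), fun K hK => ?_⟩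
      rw [hH.conj_iff_of_odd hK hBz (even_two_mul _) (even_two_mul _)]
      obtain ⟨p, hp⟩ := (exists_two_mul_add_iff (n := A)
        (u - residue (u : ZMod (parityModulus A)))).2 (by simp)
      refine ⟨p, 0, 0, m, ?_, ?_, ?_⟩
      · simp only [add_zero, altSign_zero]
        exact hp.trans (dvd_of_eq (by ring))
      · simp
        linarith
      · simpa using hX.2.2.2

/-- As for ℬ₁, but u is half of the first diagonal entry, so the wrap-around in j ↦ -1 - j now
shifts v by u. -/
theorem two_mul_ncard_typeSet_B2_of_even_of_even (A B C : ℕ) [NeZero A] [NeZero B] [NeZero C] :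
    2 * (Quotient.mk (subgroupConj B3Group) '' typeSet .B2 (2 * A) (2 * B) (2 * C)).ncard =
      2 * B + 2 * ((1 - evenInd B) * evenInd A) := by
  have hA0 : (0 : ℤ) < 2 * A := by have := Nat.pos_of_neZero A; omega
  have hB0 : (0 : ℤ) < 2 * B := by have := Nat.pos_of_neZero B; omega
  have hC0 : (0 : ℤ) < 2 * C := by have := Nat.pos_of_neZero C; omega
  have hAd : ¬ (2 * A : ℤ) ∣ A := fun h => by
    have := Int.le_of_dvd (by omega) h
    omega
  have hw : ∀ x : ℤ, ¬ Even (2 * x + 1) := fun x => by simp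
  rw [two_mul_ncard_typeSet (T := ZMod B × ZMod 2) (fun _ => A)
    (fun t => 2 * residue t.1 + 1) (fun t => residue t.2) (fun t => (-1 - t.1, t.2 + A))]
  · simp [Prod.ext_iff]
    rw [card_filter_prod (S := ZMod B) (R := ZMod 2) (fun x => -1 - x = x) (fun _ => (A : ZMod 2) = 0),
      card_compl_eq_self]
    by_cases hA : Even A
    · have h : (A : ZMod 2) = 0 := (ZMod.natCast_eq_zero_iff _ _).2 hA.two_dvd
      simp [evenInd_even hA, h]
      ring
    · have h : ¬ (A : ZMod 2) = 0 := by
        rw [ZMod.natCast_eq_zero_iff, ← even_iff_two_dvd]; exact hA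
      simp [evenInd_odd hA, h]
      ring
  · rintro ⟨j, v⟩
    ext
    · simp
    · simp only
      linear_combination (A : ZMod 2) * two_eq_zero_mod_two
  · intro t
    exact exists_hasBasis_of_even hA0 hB0 hC0 (even_two_mul _) (Or.inr dvd_rfl)
  · intro t
    exact Or.inl ⟨even_two_mul _, hw _, hAd⟩
  · rintro ⟨j, v⟩ ⟨j', v'⟩ H K hH hK
    rw [hH.conj_iff_of_even hK (even_two_mul _)]
    simp only [altSign_two_mul, altSign_add, altSign_one]
    constructor
    · rintro ⟨p, q, r, l, -, h2, h3⟩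
      have h3' := (exists_two_mul_add_iff_mod_two _).1 ⟨p, h3.trans (dvd_of_eq (show _ =
        2 * p + (altSign q * altSign r * residue v - l * A - residue v') by ring))⟩
      push_cast at h3'
      rw [altSign_cast_mod_two, altSign_cast_mod_two, residue_cast, residue_cast] at h3'
      rcases altSign_eq r with er | er <;> rw [er] at h2
      · left
        obtain ⟨rfl, rfl⟩ := residue_eq_iff.1 (show residue j = residue j' + l * B by linarith)
        push_cast at h3'
        ext
        · rfl
        · linear_combination -h3'
      · right
        obtain ⟨rfl, rfl⟩ := compl_residue_eq_iff.1
          (show -(2 * residue j + 1) = 2 * residue j' + 1 + l * (2 * B) by linarith)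
        push_cast at h3'
        ext
        · rfl
        · linear_combination -h3'
    · rintro (h | h) <;> obtain ⟨rfl, rfl⟩ := Prod.ext_iff.1 h
      · exact ⟨0, 0, 0, 0, by simp, by simp, by simp⟩
      · obtain ⟨p, hp⟩ := (exists_two_mul_add_iff_mod_two (n := A)
          (-residue v + A - residue (v + (A : ZMod 2)))).2 (by
            push_cast
            rw [residue_cast, residue_cast]
            linear_combination -v * two_eq_zero_mod_two)
        refine ⟨p, 0, 1, -1, by simp, ?_, ?_⟩
        · simp only [residue_compl, altSign_one]
          ring
        · simp only [altSign_zero, altSign_one]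
          exact hp.trans (dvd_of_eq (by ring))
  · rintro H u w v hH (hX | hX)
    · obtain ⟨A', hA', hu⟩ := exists_half (hH.two_dvd_of_odd hX.1 hX.2.1) hX.2.2
      obtain rfl : A' = A := by linarith
      obtain ⟨w, rfl⟩ := Int.not_even_iff_odd.1 hX.2.1
      obtain ⟨m, hm⟩ := exists_residue_eq B w
      refine ⟨((w : ZMod B), ((v - m * A : ℤ) : ZMod 2)), fun K hK => ?_⟩
      rw [hH.conj_iff_of_even hK (even_two_mul _)]
      obtain ⟨p, hp⟩ := (exists_two_mul_add_iff_mod_two (n := A)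
        (v - m * A - residue ((v - m * A : ℤ) : ZMod 2))).2 (by
          rw [Int.cast_sub (v - m * A), residue_cast, sub_self])
      refine ⟨p, 0, 0, m, ?_, ?_, ?_⟩
      · rw [← dvd_neg]
        simpa using hu
      · simp
        linarith
      · simp only [altSign_add, altSign_two_mul, altSign_one, altSign_zero]
        exact hp.trans (dvd_of_eq (by ring))
    · exact absurd (even_two_mul _) hX.1

theorem two_mul_ncard_typeSet_B2_of_odd (A B C : ℕ) [NeZero A] (hB : ¬ Even B) [NeZero C] :
    2 * (Quotient.mk (subgroupConj B3Group) '' typeSet .B2 (2 * A) B (2 * C)).ncard =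
      2 * (B + 1) := by
  have hA0 : (0 : ℤ) < 2 * A := by have := Nat.pos_of_neZero A; omega
  have : NeZero B := ⟨by rintro rfl; simp at hB⟩
  have hB0 : (0 : ℤ) < B := by exact_mod_cast Nat.pos_of_neZero B
  have hC0 : (0 : ℤ) < 2 * C := by have := Nat.pos_of_neZero C; omega
  have hBz : ¬ Even (B : ℤ) := by exact_mod_cast hB
  have hAd : ¬ (2 * A : ℤ) ∣ A := fun h => by
    have := Int.le_of_dvd (by omega) h
    omega
  rw [two_mul_ncard_typeSet (T := ZMod B × ZMod 2) (fun t => residue t.2)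
    (fun t => 2 * residue t.1) (fun _ => A) (fun t => (-t.1, t.2))]
  · simp [Prod.ext_iff]
    rw [card_filter_fst (R := ZMod 2) fun x : ZMod B => -x = x,
      card_neg_eq_self, ZMod.card, evenInd_odd hB]
    ring
  · rintro ⟨j, v⟩
    simp
  · intro t
    exact exists_hasBasis_of_odd hA0 hB0 hC0 hBz (even_two_mul _) (by simp)
  · intro t
    exact Or.inr ⟨hBz, even_two_mul _, even_two_mul _, hAd⟩
  · rintro ⟨j, u⟩ ⟨j', u'⟩ H K hH hK
    rw [hH.conj_iff_of_odd hK hBz (even_two_mul _) (even_two_mul _)]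
    simp only [altSign_two_mul]
    constructor
    · rintro ⟨p, q, r, k, h1, h2, -⟩
      have h1' := (exists_two_mul_add_iff_mod_two _).1 ⟨p, h1.trans (dvd_of_eq (show _ =
        2 * p + (altSign (q + r) * residue u - residue u') by ring))⟩
      push_cast at h1'
      rw [altSign_cast_mod_two, residue_cast, residue_cast] at h1'
      have hu : u' = u := by linear_combination -h1'
      subst hu
      rcases altSign_eq r with er | er <;> rw [er] at h2
      · left
        rw [(residue_eq_iff.1 (show residue j = residue j' + k * B by linarith)).1]
      · right
        rw [(neg_residue_eq_iff.1 (show -residue j = residue j' + k * B by linarith)).1]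
    · rintro (h | h) <;> obtain ⟨rfl, h2⟩ := Prod.mk.inj h <;>
        obtain rfl := h2.symm
      · exact ⟨0, 0, 0, 0, by simp, by simp, by simp⟩
      · obtain ⟨p, hp⟩ := (exists_two_mul_add_iff_mod_two (n := A) (-residue u - residue u)).2 (by
          push_cast
          rw [residue_cast]
          linear_combination -u * two_eq_zero_mod_two)
        refine ⟨p, 0, 1, -(if j = 0 then 0 else 1), ?_, ?_, -1, ?_⟩
        · simp only [zero_add, altSign_one]
          exact hp.trans (dvd_of_eq (by ring))
        · simp only [residue_neg, altSign_one]
          ring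
        · simp only [zero_add, altSign_one]
          ring
  · rintro H u w v hH (hX | hX)
    · exact absurd hX.1 hBz
    · obtain ⟨A', hA', hv⟩ := exists_half (hH.dvd_of_even hX.1 hX.2.2.1 hX.2.1) hX.2.2.2
      obtain rfl : A' = A := by linarith
      obtain ⟨w, rfl⟩ := hX.2.2.1.two_dvd
      obtain ⟨m, hm⟩ := exists_residue_eq B w
      refine ⟨((w : ZMod B), (u : ZMod 2)), fun K hK => ?_⟩
      rw [hH.conj_iff_of_odd hK hBz (even_two_mul _) (even_two_mul _)]
      obtain ⟨p, hp⟩ := (exists_two_mul_add_iff_mod_two (n := A)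
        (u - residue (u : ZMod 2))).2 (by simp)
      refine ⟨p, 0, 0, m, ?_, ?_, ?_⟩
      · simp only [add_zero, altSign_zero]
        exact hp.trans (dvd_of_eq (by ring))
      · simp
        linarith
      · rw [← dvd_neg]
        simpa using hv


/-- As for ℬ₁ with w = 1, except that the factor s used by an odd l adds A to v. -/
theorem two_mul_ncard_typeSet_B2_of_even_of_odd (A B C : ℕ) [NeZero A] [NeZero B]
    (hC : ¬ Even C) :
    2 * (Quotient.mk (subgroupConj B3Group) '' typeSet .B2 (2 * A) (2 * B) C).ncard =
      2 * A + 2 * ((1 - evenInd B) * evenInd A) := by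
  have hA0 : (0 : ℤ) < 2 * A := by have := Nat.pos_of_neZero A; omega
  have hB0 : (0 : ℤ) < 2 * B := by have := Nat.pos_of_neZero B; omega
  have hC0 : (0 : ℤ) < C := by exact_mod_cast Nat.pos_of_ne_zero (by rintro rfl; simp at hC)
  have hCz : ¬ Even (C : ℤ) := by exact_mod_cast hC
  have hAd : ¬ (2 * A : ℤ) ∣ A := fun h => by
    have := Int.le_of_dvd (by omega) h
    omega
  have hdvd : ∀ x : ℤ, (2 * A : ℤ) ∣ x ↔ ((x : ℤ) : ZMod (2 * A)) = 0 := fun x => by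
    rw [ZMod.intCast_zmod_eq_zero_iff_dvd]
    push_cast
    rfl
  have hAA : (2 : ZMod (2 * A)) * A = 0 := by
    have := ZMod.natCast_self (2 * A)
    push_cast at this
    exact this
  have hpm : ∀ k : ℤ, ((altSign k : ℤ) : ZMod (2 * A)) * A = A := fun k => by
    rcases altSign_eq k with e | e <;> rw [e] <;> push_cast
    · ring
    · linear_combination -hAA
  rw [two_mul_ncard_typeSet (T := ZMod (2 * A)) (fun _ => A) (fun _ => 1) (fun t => residue t)
    (fun t => (altSign B : ℤ) * t + A)]
  · rw [ZMod.card]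
    congr 1
    by_cases hB : Even B
    · have hBz : Even (B : ℤ) := by exact_mod_cast hB
      rw [evenInd_even hB, altSign_even hBz]
      simp [half_ne_zero]
    · have hBz : ¬ Even (B : ℤ) := by exact_mod_cast hB
      rw [evenInd_odd hB, altSign_odd hBz]
      by_cases hA : Even A
      · rw [evenInd_even hA]
        obtain ⟨a, rfl⟩ := hA.two_dvd
        have e : (Finset.univ.filter fun x : ZMod (2 * (2 * a)) => -x = x).card = 2 := by
          rw [card_neg_eq_self, evenInd_even (even_two_mul _)]
        -- The fixed points solve 2x = 2a modulo 4a; subtracting a makes the equation homogeneous.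
        refine Eq.trans (Finset.card_bij (fun x _ => x - (a : ZMod (2 * (2 * a)))) ?_ ?_ ?_) e
        · intro x hx
          simp only [Finset.mem_filter, Finset.mem_univ, true_and] at hx ⊢
          push_cast at hx ⊢
          linear_combination hx
        · intro x _ y _ h
          exact sub_left_injective h
        · intro y hy
          refine ⟨y + a, ?_, by ring⟩
          simp only [Finset.mem_filter, Finset.mem_univ, true_and] at hy ⊢
          push_cast at hy ⊢
          linear_combination hy
      · rw [evenInd_odd hA, mul_zero, mul_zero, Finset.card_eq_zero, Finset.filter_eq_empty_iff]
        intro x _ hx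
        have h1 : ((A - 2 * residue x : ℤ) : ZMod (2 * A)) = 0 := by
          push_cast at hx ⊢
          rw [residue_cast]
          linear_combination hx
        rw [← hdvd] at h1
        obtain ⟨k, hk⟩ := h1
        exact hA ((Int.even_coe_nat A).1 ⟨residue x + A * k, by linarith⟩)
  · intro v
    simp only
    rw [mul_add, hpm, ← mul_assoc, ← Int.cast_mul, altSign_mul_self]
    linear_combination hAA
  · intro t
    exact exists_hasBasis_of_even hA0 hB0 hC0 (even_two_mul _) (Or.inr dvd_rfl)
  · intro t
    exact Or.inl ⟨even_two_mul _, by simp, hAd⟩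
  · rintro v v' H K hH hK
    rw [hH.conj_iff_of_even hK (even_two_mul _)]
    simp only [altSign_odd hCz, altSign_add, altSign_one, hdvd]
    constructor
    · rintro ⟨p, q, r, l, -, h2, h3⟩
      have hs : altSign q * altSign r = altSign (l * B) := by
        rcases altSign_eq r with er | er <;> rw [er] at h2 ⊢
        · obtain rfl : q = l * B := by linarith
          ring
        · obtain rfl : q = l * B + 1 := by linarith
          rw [altSign_add, altSign_one]
          ring
      rw [hs] at h3
      push_cast at h3
      rw [residue_cast, residue_cast] at h3
      by_cases hl : Even l
      · left
        rw [altSign_even (hl.mul_right _)] at h3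
        obtain ⟨k, rfl⟩ := hl.two_dvd
        push_cast at h3
        linear_combination -h3 - k * hAA
      · right
        rw [altSign_mul_of_odd hl] at h3
        obtain ⟨k, rfl⟩ := Int.not_even_iff_odd.1 hl
        push_cast at h3
        linear_combination -h3 - (k + 1) * hAA
    · rintro (rfl | rfl)
      · exact ⟨0, 0, 0, 0, by simp, by simp, by simp⟩
      · refine ⟨0, B, 0, 1, ?_, by simp; ring, ?_⟩
        · push_cast
          rw [hpm, sub_self]
        · simp
          linear_combination -hAA
  · rintro H u w v hH (hX | hX)
    · obtain ⟨A', hA', hu⟩ := exists_half (hH.two_dvd_of_odd hX.1 hX.2.1) hX.2.2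
      obtain rfl : A' = A := by linarith
      obtain ⟨w, rfl⟩ := Int.not_even_iff_odd.1 hX.2.1
      refine ⟨((altSign w * v : ℤ) : ZMod (2 * A)), fun K hK => ?_⟩
      rw [hH.conj_iff_of_even hK (even_two_mul _)]
      refine ⟨0, -w, 0, 0, ?_, ?_, ?_⟩
      · rw [hdvd] at hu ⊢
        push_cast at hu ⊢
        have hu' : (u : ZMod (2 * A)) = A := by linear_combination -hu
        rw [hu', hpm, sub_self]
      · simp [altSign_odd hCz]
        ring
      · rw [hdvd]
        simp
    · exact absurd (even_two_mul _) hX.1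

/-- Conjugation by q makes w = 0 and v follows u, so only u modulo gcd(2, A) remains and no
involution is left. -/
theorem ncard_typeSet_B3 (A B C : ℕ) [NeZero A] (hB : ¬ Even B) (hC : ¬ Even C) :
    2 * (Quotient.mk (subgroupConj B3Group) '' typeSet .B3 A B C).ncard = 2 * (evenInd A + 1) := by
  have hA0 : (0 : ℤ) < A := by exact_mod_cast Nat.pos_of_neZero A
  have hB0 : (0 : ℤ) < B := by exact_mod_cast Nat.pos_of_ne_zero (by rintro rfl; simp at hB)
  have hC0 : (0 : ℤ) < C := by exact_mod_cast Nat.pos_of_ne_zero (by rintro rfl; simp at hC)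
  have hBz : ¬ Even (B : ℤ) := by exact_mod_cast hB
  have hCz : ¬ Even (C : ℤ) := by exact_mod_cast hC
  rw [two_mul_ncard_typeSet (T := ZMod (parityModulus A)) (fun t => residue t) (fun _ => 0)
    (fun t => residue t) id]
  · simp only [id, Finset.filter_true, Finset.card_univ, ZMod.card]
    rw [parityModulus]
    ring
  · exact fun _ => rfl
  · intro t
    exact exists_hasBasis_of_odd hA0 hB0 hC0 hBz Even.zero (by simp [hCz])
  · intro t
    exact ⟨hBz, hCz, Even.zero, by simp⟩
  · intro u u' H K hH hK
    rw [hH.conj_iff_of_odd hK hBz Even.zero Even.zero]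
    constructor
    · rintro ⟨p, q, r, k, h1, -, -⟩
      have h1' := (exists_two_mul_add_iff _).1 ⟨p, h1.trans (dvd_of_eq (show _ =
        2 * p + (altSign (q + r) * residue u - residue u') by ring))⟩
      push_cast at h1'
      rw [altSign_cast_parity, residue_cast, residue_cast] at h1'
      left
      linear_combination -h1'
    · rintro (rfl | rfl) <;> exact ⟨0, 0, 0, 0, by simp, by simp, by simp⟩
  · rintro H u w v hH hX
    obtain ⟨w, rfl⟩ := hX.2.2.1.two_dvd
    refine ⟨(u : ZMod (parityModulus A)), fun K hK => ?_⟩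
    rw [hH.conj_iff_of_odd hK hBz (even_two_mul _) Even.zero]
    obtain ⟨p, hp⟩ := (exists_two_mul_add_iff (n := A)
      (altSign (-w) * u - residue (u : ZMod (parityModulus A)))).2 (by
        push_cast
        rw [altSign_cast_parity, residue_cast]
        ring)
    refine ⟨p, -w, 0, 0, ?_, ?_, ?_⟩
    · simp only [add_zero]
      exact hp.trans (dvd_of_eq (by ring))
    · simp [altSign_odd hCz]
      ring
    · have := dvd_add hp (hX.2.2.2.mul_left (altSign (-w)))
      simp only [add_zero, altSign_odd hCz]
      exact this.trans (dvd_of_eq (by ring))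

theorem ncard_typeSet_B4 (A B C : ℕ) [NeZero A] (hB : ¬ Even B) (hC : ¬ Even C) :
    2 * (Quotient.mk (subgroupConj B3Group) '' typeSet .B4 (2 * A) B C).ncard = 4 := by
  have hA0 : (0 : ℤ) < 2 * A := by have := Nat.pos_of_neZero A; omega
  have hB0 : (0 : ℤ) < B := by exact_mod_cast Nat.pos_of_ne_zero (by rintro rfl; simp at hB)
  have hC0 : (0 : ℤ) < C := by exact_mod_cast Nat.pos_of_ne_zero (by rintro rfl; simp at hC)
  have hBz : ¬ Even (B : ℤ) := by exact_mod_cast hB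
  have hCz : ¬ Even (C : ℤ) := by exact_mod_cast hC
  have hAd : ¬ (2 * A : ℤ) ∣ A := fun h => by
    have := Int.le_of_dvd (by omega) h
    omega
  rw [two_mul_ncard_typeSet (T := ZMod 2) (fun t => residue t) (fun _ => 0)
    (fun t => residue t + A) id]
  · simp
  · exact fun _ => rfl
  · intro t
    exact exists_hasBasis_of_odd hA0 hB0 hC0 hBz Even.zero (by simp [hCz])
  · intro t
    exact ⟨hBz, hCz, Even.zero, by simpa using hAd⟩
  · intro u u' H K hH hK
    rw [hH.conj_iff_of_odd hK hBz Even.zero Even.zero]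
    constructor
    · rintro ⟨p, q, r, k, h1, -, -⟩
      have h1' := (exists_two_mul_add_iff_mod_two _).1 ⟨p, h1.trans (dvd_of_eq (show _ =
        2 * p + (altSign (q + r) * residue u - residue u') by ring))⟩
      push_cast at h1'
      rw [altSign_cast_mod_two, residue_cast, residue_cast] at h1'
      left
      linear_combination -h1'
    · rintro (rfl | rfl) <;> exact ⟨0, 0, 0, 0, by simp, by simp, by simp⟩
  · rintro H u w v hH hX
    obtain ⟨A', hA', hv⟩ := exists_half (hH.dvd_of_odd hX.1 hX.2.2.1 hX.2.1) hX.2.2.2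
    obtain rfl : A' = A := by linarith
    obtain ⟨w, rfl⟩ := hX.2.2.1.two_dvd
    refine ⟨(u : ZMod 2), fun K hK => ?_⟩
    rw [hH.conj_iff_of_odd hK hBz (even_two_mul _) Even.zero]
    obtain ⟨p, hp⟩ := (exists_two_mul_add_iff_mod_two (n := A)
      (altSign (-w) * u - residue (u : ZMod 2))).2 (by
        push_cast
        rw [altSign_cast_mod_two, residue_cast]
        ring)
    refine ⟨p, -w, 0, 0, ?_, ?_, ?_⟩
    · simp only [add_zero]
      exact hp.trans (dvd_of_eq (by ring))
    · simp [altSign_odd hCz]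
      ring
    · have h := dvd_sub hp (hv.mul_left (altSign (-w)))
      have h2 : (2 * A : ℤ) ∣ (altSign (-w) - 1) * A := by
        rcases altSign_eq (-w) with e | e <;> rw [e]
        · simp
        · exact ⟨-1, by ring⟩
      have := dvd_add h h2
      simp only [add_zero, altSign_odd hCz]
      exact this.trans (dvd_of_eq (by ring))

end B3Group

/-! ### Dirichlet convolutions -/

/-- The arithmetic function `n ↦ n ^ k`, also for `k = 0`. -/
def powFun (k : ℕ) : ArithmeticFunction ℚ := ⟨fun n => if n = 0 then 0 else (n : ℚ) ^ k, if_pos rfl⟩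

theorem powFun_apply (k n : ℕ) [NeZero n] : powFun k n = (n : ℚ) ^ k := if_neg (NeZero.ne n)

/-- The indicator function of `{2}`. -/
def delta2 : ArithmeticFunction ℚ := ⟨fun n => if n = 2 then 1 else 0, rfl⟩

theorem delta2_mul_apply (f : ArithmeticFunction ℚ) (n : ℕ) :
    (delta2 * f) n = if Even n then f (n / 2) else 0 := by
  rw [ArithmeticFunction.mul_apply]
  split_ifs with h
  · obtain ⟨m, rfl⟩ := h.two_dvd
    rw [Nat.mul_div_cancel_left m two_pos]
    rcases Nat.eq_zero_or_pos m with rfl | hm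
    · simp
    · rw [Finset.sum_eq_single (2, m)]
      · simp [delta2]
      · rintro ⟨a, b⟩ hab hne
        have : a ≠ 2 := by
          rintro rfl
          rw [Nat.mem_divisorsAntidiagonal] at hab
          obtain rfl : b = m := Nat.eq_of_mul_eq_mul_left two_pos hab.1
          exact hne rfl
        simp [delta2, this]
      · intro h
        exact absurd (Nat.mem_divisorsAntidiagonal.2 ⟨rfl, by omega⟩) h
  · refine Finset.sum_eq_zero ?_
    rintro ⟨a, b⟩ hab
    have : a ≠ 2 := by
      rintro rfl
      rw [Nat.mem_divisorsAntidiagonal] at hab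
      exact h (hab.1 ▸ even_two_mul b)
    simp [delta2, this]

theorem delta2_mul_apply_two_mul (f : ArithmeticFunction ℚ) (n : ℕ) :
    (delta2 * f) (2 * n) = f n := by
  rw [delta2_mul_apply, if_pos (even_two_mul n), Nat.mul_div_cancel_left n two_pos]

theorem delta2_mul_apply_of_odd (f : ArithmeticFunction ℚ) {n : ℕ} (h : ¬ Even n) :
    (delta2 * f) n = 0 := by
  rw [delta2_mul_apply, if_neg h]

/-- Parity conditions thereby become factors in a convolution. -/
theorem delta2_mul_powFun_zero (n : ℕ) [NeZero n] : (delta2 * powFun 0) n = evenInd n := by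
  rw [delta2_mul_apply, evenInd]
  split_ifs with h
  · obtain ⟨m, rfl⟩ := h.two_dvd
    have : NeZero m := ⟨by rintro rfl; exact NeZero.ne (2 * 0) rfl⟩
    rw [Nat.mul_div_cancel_left m two_pos, powFun_apply]
    simp
  · simp

theorem delta2_mul_delta2_mul_powFun_zero (n : ℕ) [NeZero n] :
    (delta2 * (delta2 * powFun 0)) n = evenInd n * evenInd (n / 2) := by
  rw [delta2_mul_apply]
  split_ifs with h
  · obtain ⟨m, rfl⟩ := h.two_dvd
    have : NeZero m := ⟨by rintro rfl; exact NeZero.ne (2 * 0) rfl⟩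
    rw [Nat.mul_div_cancel_left m two_pos, delta2_mul_powFun_zero, evenInd_even h]
    simp
  · rw [evenInd_odd h]
    simp

theorem delta2_mul_powFun_one (n : ℕ) [NeZero n] :
    (delta2 * powFun 1) n = evenInd n * n / 2 := by
  rw [delta2_mul_apply, evenInd]
  split_ifs with h
  · obtain ⟨m, rfl⟩ := h.two_dvd
    have : NeZero m := ⟨by rintro rfl; exact NeZero.ne (2 * 0) rfl⟩
    rw [Nat.mul_div_cancel_left m two_pos, powFun_apply]
    push_cast
    ring
  · simp

theorem ArithmeticFunction.sub_apply' (f g : ArithmeticFunction ℚ) (n : ℕ) :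
    (f - g) n = f n - g n := by
  rw [sub_eq_add_neg, ArithmeticFunction.add_apply, ArithmeticFunction.neg_apply, sub_eq_add_neg]

theorem ArithmeticFunction.natCast_mul_apply (k : ℕ) (f : ArithmeticFunction ℚ) (n : ℕ) :
    ((k : ArithmeticFunction ℚ) * f) n = k * f n := by
  induction k with
  | zero => simp
  | succ k ih =>
    rw [Nat.cast_succ, add_mul, ArithmeticFunction.add_apply, ih, one_mul]
    push_cast
    ring

theorem ArithmeticFunction.two_mul_apply (f : ArithmeticFunction ℚ) (n : ℕ) :
    ((2 : ArithmeticFunction ℚ) * f) n = 2 * f n := by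
  exact_mod_cast natCast_mul_apply 2 f n

theorem ArithmeticFunction.three_mul_apply (f : ArithmeticFunction ℚ) (n : ℕ) :
    ((3 : ArithmeticFunction ℚ) * f) n = 3 * f n := by
  exact_mod_cast natCast_mul_apply 3 f n

theorem ArithmeticFunction.four_mul_apply (f : ArithmeticFunction ℚ) (n : ℕ) :
    ((4 : ArithmeticFunction ℚ) * f) n = 4 * f n := by
  exact_mod_cast natCast_mul_apply 4 f n

theorem atQuot_one (f : ℕ → ℕ) (n : ℕ) : atQuot f n 1 = f n := by simp [atQuot]

theorem atQuot_two_mul (f : ℕ → ℕ) (k : ℕ) {F : ArithmeticFunction ℚ} (hF : ∀ n, atQuot f n k = F n)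
    (n : ℕ) : atQuot f n (2 * k) = (delta2 * F) n := by
  rw [delta2_mul_apply, ← hF]
  unfold atQuot
  by_cases h : Even n
  · obtain ⟨m, rfl⟩ := h.two_dvd
    rw [if_pos h, Nat.mul_div_cancel_left m two_pos, Nat.mul_div_mul_left _ _ two_pos]
    simp only [Nat.mul_dvd_mul_iff_left two_pos]
  · rw [if_neg h, if_neg fun hd => h (even_iff_two_dvd.2 ((Dvd.intro _ rfl).trans hd))]

/-- Evaluating at n/2^k, with the convention of value 0 at non-integers, is convolution with `delta2
^ k`; this turns the stated formulas into ring identities. -/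
theorem atQuot_two_pow (f : ℕ → ℕ) {F : ArithmeticFunction ℚ} (hF : ∀ n, (f n : ℚ) = F n)
    (k n : ℕ) : atQuot f n (2 ^ k) = (delta2 ^ k * F) n := by
  induction k generalizing n with
  | zero => rw [pow_zero, atQuot_one, pow_zero, one_mul, hF]
  | succ k ih => rw [pow_succ', atQuot_two_mul f _ ih, ← mul_assoc, ← pow_succ']

theorem sum_eq_convolution {f g h : ℕ → ℚ} {F G H : ArithmeticFunction ℚ}
    (hF : ∀ n, n ≠ 0 → f n = F n) (hG : ∀ n, n ≠ 0 → g n = G n) (hH : ∀ n, n ≠ 0 → h n = H n)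
    (n : ℕ) : ∑ p ∈ n.divisorsAntidiagonal, ∑ q ∈ p.2.divisorsAntidiagonal, f p.1 * g q.1 * h q.2 =
      (F * (G * H)) n := by
  rw [ArithmeticFunction.mul_apply]
  refine Finset.sum_congr rfl fun p hp => ?_
  rw [ArithmeticFunction.mul_apply, Finset.mul_sum]
  refine Finset.sum_congr rfl fun q hq => ?_
  rw [hF _ (Nat.left_ne_zero_of_mem_divisorsAntidiagonal hp),
    hG _ (Nat.left_ne_zero_of_mem_divisorsAntidiagonal hq),
    hH _ (Nat.right_ne_zero_of_mem_divisorsAntidiagonal hq), mul_assoc]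

theorem powFun_zero_apply {n : ℕ} (hn : n ≠ 0) : (1 : ℚ) = powFun 0 n := by
  have : NeZero n := ⟨hn⟩
  rw [powFun_apply, pow_zero]

theorem powFun_apply' (k : ℕ) {n : ℕ} (hn : n ≠ 0) : (n : ℚ) ^ k = powFun k n := by
  have : NeZero n := ⟨hn⟩
  rw [powFun_apply]

theorem omega_eq (n : ℕ) : (omega n : ℚ) = (powFun 2 * (powFun 1 * powFun 0)) n := by
  rw [← sum_eq_convolution (f := fun n => (n : ℚ) ^ 2) (g := fun n => (n : ℚ) ^ 1) (h := fun _ => 1)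
    (fun _ => powFun_apply' 2) (fun _ => powFun_apply' 1) (fun _ => powFun_zero_apply)]
  simp [omega]

theorem sigma2_eq (n : ℕ) : (sigma2 n : ℚ) = (powFun 1 * (powFun 0 * powFun 0)) n := by
  rw [← sum_eq_convolution (f := fun n => (n : ℚ) ^ 1) (g := fun _ => 1) (h := fun _ => 1)
    (fun _ => powFun_apply' 1) (fun _ => powFun_zero_apply) (fun _ => powFun_zero_apply)]
  simp [sigma2]

theorem d3_eq (n : ℕ) : (d3 n : ℚ) = (powFun 0 * (powFun 0 * powFun 0)) n := by
  rw [← sum_eq_convolution (f := fun _ => 1) (g := fun _ => 1) (h := fun _ => 1)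
    (fun _ => powFun_zero_apply) (fun _ => powFun_zero_apply) (fun _ => powFun_zero_apply)]
  simp [d3]

/-! ### The number of conjugacy classes with given diagonal entries -/

theorem HasCount.biUnion {ι α : Type*} (s : Finset ι) (S : ι → Set α) (f : ι → ℚ)
    (hd : (s : Set ι).PairwiseDisjoint S) (h : ∀ i ∈ s, HasCount (S i) (f i)) :
    HasCount (⋃ i ∈ s, S i) (∑ i ∈ s, f i) := by
  classical
  induction s using Finset.induction_on with
  | empty => simp [HasCount]
  | insert a s ha ih =>
    obtain ⟨h1, h2⟩ := h a (Finset.mem_insert_self a s)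
    obtain ⟨h3, h4⟩ := ih (hd.subset (by simp)) fun i hi => h i (Finset.mem_insert_of_mem hi)
    rw [Finset.set_biUnion_insert, Finset.sum_insert ha]
    refine ⟨h1.union h3, ?_⟩
    rw [Set.ncard_union_eq _ h1 h3]
    · push_cast
      rw [h2, h4]
    · rw [Set.disjoint_iUnion₂_right]
      intro i hi
      exact hd (by simp) (by simp [hi]) fun h => ha (h ▸ hi)

theorem hasCount_empty {α : Type*} : HasCount (∅ : Set α) 0 := by simp [HasCount]

/-- Since `Set.ncard` is 0 on infinite sets, a nonzero count also yields finiteness. -/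
theorem hasCount_of_mul_ncard {α : Type*} {S : Set α} {k N : ℕ} {q : ℚ} (h : k * S.ncard = N)
    (hN : N ≠ 0) (hq : (N : ℚ) = k * q) : HasCount S q := by
  have hk : k ≠ 0 := by rintro rfl; omega
  refine ⟨Set.finite_of_ncard_ne_zero fun h0 => hN (by rw [← h, h0, mul_zero]), ?_⟩
  have : (k : ℚ) ≠ 0 := by exact_mod_cast hk
  apply mul_left_cancel₀ this
  rw [← hq, ← h]
  push_cast
  ring

/-- A sum of products of arithmetic functions in the three diagonal entries. -/
def FlatType.terms : FlatType →
    List (ArithmeticFunction ℚ × ArithmeticFunction ℚ × ArithmeticFunction ℚ)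
  -- The factors transcribe the orbit counts. An entry written as twice a parameter contributes
  -- `delta2 * f`, with `f` in the parameter; the indicators of even and odd entries are `delta2 *
  -- powFun 0` and `powFun 0 - delta2 * powFun 0`.
  | .G1 => [(powFun 2, delta2 * powFun 1, delta2 * powFun 0),
      (powFun 0 + 3 * (delta2 * powFun 0), delta2 * powFun 1, delta2 * powFun 0),
      (2 * powFun 1 + 4 * (delta2 * powFun 1), delta2 * powFun 0, delta2 * powFun 0),
      (2 * powFun 1, delta2 * (delta2 * powFun 0), delta2 * powFun 0)]
  | .G2 => [(powFun 1 + 2 * (delta2 * powFun 1), delta2 * powFun 0, powFun 0 - delta2 * powFun 0),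
      (powFun 1, delta2 * (delta2 * powFun 0), powFun 0 - delta2 * powFun 0),
      (powFun 0 + delta2 * powFun 0 + 2 * (delta2 * (delta2 * powFun 0)),
        delta2 * (powFun 0 - delta2 * powFun 0), powFun 0 - delta2 * powFun 0)]
  | .B1 => [(powFun 0 + delta2 * powFun 0, delta2 * (powFun 1 + powFun 0 - delta2 * powFun 0),
        delta2 * powFun 0),
      (powFun 1, delta2 * (powFun 0 + delta2 * powFun 0), powFun 0 - delta2 * powFun 0),
      (powFun 0 + delta2 * powFun 0, delta2 * (powFun 0 - delta2 * powFun 0),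
        powFun 0 - delta2 * powFun 0),
      -- The middle factor below is B + 1 for odd B and 0 for even B.
      (powFun 0 + delta2 * powFun 0,
        powFun 1 - 2 * (delta2 * powFun 1) + powFun 0 - delta2 * powFun 0, delta2 * powFun 0)]
  | .B2 => [(2 * (delta2 * powFun 0), delta2 * powFun 1, delta2 * powFun 0),
      (2 * (delta2 * (delta2 * powFun 0)), delta2 * (powFun 0 - delta2 * powFun 0),
        delta2 * powFun 0),
      (2 * (delta2 * powFun 1), delta2 * powFun 0, powFun 0 - delta2 * powFun 0),
      (2 * (delta2 * (delta2 * powFun 0)), delta2 * (powFun 0 - delta2 * powFun 0),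
        powFun 0 - delta2 * powFun 0),
      (2 * (delta2 * powFun 0), powFun 1 - 2 * (delta2 * powFun 1) + powFun 0 - delta2 * powFun 0,
        delta2 * powFun 0)]
  | .B3 => [(2 * (powFun 0 + delta2 * powFun 0), powFun 0 - delta2 * powFun 0,
      powFun 0 - delta2 * powFun 0)]
  | .B4 => [(4 * (delta2 * powFun 0), powFun 0 - delta2 * powFun 0, powFun 0 - delta2 * powFun 0)]

/-- The factor by which the terms exceed the number of conjugacy classes. -/
def FlatType.weight : FlatType → ℕ
  | .G1 => 4
  | _ => 2

/-- The number of conjugacy classes of subgroups of a given type with the diagonal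
entries `A`, `B`, `C`. -/
def FlatType.count (X : FlatType) (A B C : ℕ) : ℚ :=
  (X.terms.map fun t => t.1 A * t.2.1 B * t.2.2 C).sum / X.weight

theorem FlatType.sum_count (X : FlatType) (n : ℕ) :
    ∑ p ∈ n.divisorsAntidiagonal, ∑ q ∈ p.2.divisorsAntidiagonal, X.count p.1 q.1 q.2 =
      (X.terms.map fun t => t.1 * (t.2.1 * t.2.2)).sum n / X.weight := by
  simp only [FlatType.count, ← Finset.sum_div]
  congr 1
  generalize X.terms = L
  induction L with
  | nil => simp
  | cons t L ih =>
    simp only [List.map_cons, List.sum_cons, Finset.sum_add_distrib]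
    rw [ih, ArithmeticFunction.add_apply, sum_eq_convolution (fun _ _ => rfl) (fun _ _ => rfl)
      (fun _ _ => rfl)]

namespace B3Group

theorem typeSet_eq_empty {X : FlatType} {A B C : ℤ} (h : ∀ u w v, ¬ IsType A B C u w v X) :
    typeSet X A B C = ∅ :=
  Set.eq_empty_iff_forall_notMem.2 fun _ ⟨u, w, v, _, ht⟩ => h u w v ht

/-- For this type u or v is congruent to A/2, so A must be even. -/
theorem typeSet_B2_eq_empty {A : ℕ} (hA : ¬ Even A) (B C : ℤ) : typeSet .B2 A B C = ∅ := by
  have hhalf : ∀ x : ℤ, (A : ℤ) ∣ 2 * x → ¬ (A : ℤ) ∣ x → False := fun x h1 h2 => by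
    obtain ⟨A', h, -⟩ := exists_half h1 h2
    exact hA ((Int.even_coe_nat A).1 (h ▸ even_two_mul A'))
  refine Set.eq_empty_iff_forall_notMem.2 ?_
  rintro H ⟨u, w, v, h, hX | hX⟩
  · exact hhalf _ (h.two_dvd_of_odd hX.1 hX.2.1) hX.2.2
  · exact hhalf _ (h.dvd_of_even hX.1 hX.2.2.1 hX.2.1) hX.2.2.2

theorem typeSet_B4_eq_empty {A : ℕ} (hA : ¬ Even A) (B C : ℤ) : typeSet .B4 A B C = ∅ := by
  refine Set.eq_empty_iff_forall_notMem.2 ?_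
  rintro H ⟨u, w, v, h, hX⟩
  obtain ⟨A', h, -⟩ := exists_half (h.dvd_of_odd hX.1 hX.2.2.1 hX.2.1) hX.2.2.2
  exact hA ((Int.even_coe_nat A).1 (h ▸ even_two_mul A'))

end B3Group

namespace B3Group

theorem exists_eq_two_mul {n : ℕ} [NeZero n] (h : Even n) : ∃ m, ∃ _ : NeZero m, n = 2 * m := by
  obtain ⟨m, rfl⟩ := h.two_dvd
  exact ⟨m, ⟨by rintro rfl; exact NeZero.ne (2 * 0) rfl⟩, rfl⟩

/-- Idempotence linearizes (1 + e)² to 1 + 3e in the count for 𝒢₁. -/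
theorem evenInd_mul_self (n : ℕ) : (evenInd n : ℚ) * evenInd n = evenInd n := by
  unfold evenInd; split_ifs <;> simp

theorem hasCount_typeSet_G1 (A B C : ℕ) [NeZero A] [NeZero B] [NeZero C] :
    HasCount (Quotient.mk (subgroupConj B3Group) '' typeSet .G1 A B C)
      (FlatType.count .G1 A B C) := by
  by_cases h : Even B ∧ Even C
  · obtain ⟨B, _, rfl⟩ := exists_eq_two_mul h.1
    obtain ⟨C, _, rfl⟩ := exists_eq_two_mul h.2
    have hc := four_mul_ncard_typeSet_G1 A B C
    have hA := NeZero.ne A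
    refine hasCount_of_mul_ncard (by exact_mod_cast hc) (by positivity) ?_
    simp [-ArithmeticFunction.mul_apply, FlatType.count, FlatType.terms, FlatType.weight, delta2_mul_apply_two_mul, powFun_apply,
      delta2_mul_powFun_zero, delta2_mul_powFun_one, ArithmeticFunction.two_mul_apply,
      ArithmeticFunction.three_mul_apply, ArithmeticFunction.four_mul_apply]
    linear_combination (B : ℚ) * evenInd_mul_self A
  · rw [typeSet_eq_empty (X := .G1) fun u w v hX => h ⟨(Int.even_coe_nat B).1 hX.1, (Int.even_coe_nat C).1 hX.2.1⟩,
      Set.image_empty]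
    convert hasCount_empty
    rcases not_and_or.1 h with h | h <;>
    simp [-ArithmeticFunction.mul_apply, FlatType.count, FlatType.terms, delta2_mul_apply_of_odd _ h]

theorem hasCount_typeSet_G2 (A B C : ℕ) [NeZero A] [NeZero B] [NeZero C] :
    HasCount (Quotient.mk (subgroupConj B3Group) '' typeSet .G2 A B C)
      (FlatType.count .G2 A B C) := by
  by_cases hB : Even B
  · obtain ⟨B, _, rfl⟩ := exists_eq_two_mul hB
    by_cases hC : Even C
    · rw [typeSet_eq_empty (X := .G2) fun u w v hX => hX.2.1 ((Int.even_coe_nat C).2 hC), Set.image_empty]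
      convert hasCount_empty
      simp [-ArithmeticFunction.mul_apply, FlatType.count, FlatType.terms, ArithmeticFunction.sub_apply', powFun_apply,
        delta2_mul_powFun_zero, evenInd_even hC]
    · have hc := two_mul_ncard_typeSet_G2 A B C hC
      have hA := NeZero.ne A
      refine hasCount_of_mul_ncard (by exact_mod_cast hc) (by positivity) ?_
      simp [-ArithmeticFunction.mul_apply, FlatType.count, FlatType.terms, FlatType.weight, delta2_mul_apply_two_mul, powFun_apply,
        delta2_mul_powFun_zero, delta2_mul_powFun_one, ArithmeticFunction.two_mul_apply,
        ArithmeticFunction.sub_apply', delta2_mul_delta2_mul_powFun_zero, evenInd_odd hC,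
        Nat.cast_sub (evenInd_le_one B)]
      ring
  · rw [typeSet_eq_empty (X := .G2) fun u w v hX => hB ((Int.even_coe_nat B).1 hX.1), Set.image_empty]
    convert hasCount_empty
    simp [-ArithmeticFunction.mul_apply, FlatType.count, FlatType.terms, delta2_mul_apply_of_odd _ hB]

theorem hasCount_typeSet_B1 (A B C : ℕ) [NeZero A] [NeZero B] [NeZero C] :
    HasCount (Quotient.mk (subgroupConj B3Group) '' typeSet .B1 A B C)
      (FlatType.count .B1 A B C) := by
  have hA := NeZero.ne A
  by_cases hB : Even B <;> by_cases hC : Even C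
  · obtain ⟨B, _, rfl⟩ := exists_eq_two_mul hB
    obtain ⟨C, _, rfl⟩ := exists_eq_two_mul hC
    have hB := NeZero.ne B
    have hc := two_mul_ncard_typeSet_B1_of_even_of_even A B C
    refine hasCount_of_mul_ncard (by exact_mod_cast hc) (by positivity) ?_
    simp [-ArithmeticFunction.mul_apply, FlatType.count, FlatType.terms, FlatType.weight, delta2_mul_apply_two_mul, powFun_apply,
      delta2_mul_powFun_zero, ArithmeticFunction.two_mul_apply,
      ArithmeticFunction.sub_apply', Nat.cast_sub (evenInd_le_one B)]
    ring
  · obtain ⟨B, _, rfl⟩ := exists_eq_two_mul hB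
    have hc := two_mul_ncard_typeSet_B1_of_even_of_odd A B C hC
    refine hasCount_of_mul_ncard (by exact_mod_cast hc) (by positivity) ?_
    simp [-ArithmeticFunction.mul_apply, FlatType.count, FlatType.terms, FlatType.weight, delta2_mul_apply_two_mul, powFun_apply,
      delta2_mul_powFun_zero, ArithmeticFunction.two_mul_apply,
      ArithmeticFunction.sub_apply', Nat.cast_sub (evenInd_le_one B), delta2_mul_apply_of_odd _ hC]
    ring
  · obtain ⟨C, _, rfl⟩ := exists_eq_two_mul hC
    have hc := two_mul_ncard_typeSet_B1_of_odd A B C hB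
    refine hasCount_of_mul_ncard (by exact_mod_cast hc) (by positivity) ?_
    simp [-ArithmeticFunction.mul_apply, FlatType.count, FlatType.terms, FlatType.weight, delta2_mul_apply_two_mul, powFun_apply,
      delta2_mul_powFun_zero A, ArithmeticFunction.two_mul_apply,
      ArithmeticFunction.sub_apply', delta2_mul_apply_of_odd _ hB]
    ring
  · rw [typeSet_eq_empty (X := .B1) fun u w v hX => by
      rcases hX with hX | hX
      exacts [hB ((Int.even_coe_nat B).1 hX.1), hC ((Int.even_coe_nat C).1 hX.2.1)],
      Set.image_empty]
    convert hasCount_empty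
    simp [-ArithmeticFunction.mul_apply, FlatType.count, FlatType.terms, delta2_mul_apply_of_odd _ hB,
      delta2_mul_apply_of_odd _ hC]

theorem hasCount_typeSet_B2 (A B C : ℕ) [NeZero A] [NeZero B] [NeZero C] :
    HasCount (Quotient.mk (subgroupConj B3Group) '' typeSet .B2 A B C)
      (FlatType.count .B2 A B C) := by
  by_cases hA : Even A; swap
  · rw [typeSet_B2_eq_empty hA, Set.image_empty]
    convert hasCount_empty
    simp [-ArithmeticFunction.mul_apply, FlatType.count, FlatType.terms, ArithmeticFunction.two_mul_apply,
      delta2_mul_apply_of_odd _ hA]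
  obtain ⟨A, _, rfl⟩ := exists_eq_two_mul hA
  have hA := NeZero.ne A
  by_cases hB : Even B <;> by_cases hC : Even C
  · obtain ⟨B, _, rfl⟩ := exists_eq_two_mul hB
    obtain ⟨C, _, rfl⟩ := exists_eq_two_mul hC
    have hB := NeZero.ne B
    have hc := two_mul_ncard_typeSet_B2_of_even_of_even A B C
    refine hasCount_of_mul_ncard (by exact_mod_cast hc) (by positivity) ?_
    simp [-ArithmeticFunction.mul_apply, FlatType.count, FlatType.terms, FlatType.weight, delta2_mul_apply_two_mul, powFun_apply,
      delta2_mul_powFun_zero, ArithmeticFunction.two_mul_apply,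
      ArithmeticFunction.sub_apply', Nat.cast_sub (evenInd_le_one B)]
    ring
  · obtain ⟨B, _, rfl⟩ := exists_eq_two_mul hB
    have hc := two_mul_ncard_typeSet_B2_of_even_of_odd A B C hC
    refine hasCount_of_mul_ncard (by exact_mod_cast hc) (by positivity) ?_
    simp [-ArithmeticFunction.mul_apply, FlatType.count, FlatType.terms, FlatType.weight, delta2_mul_apply_two_mul, powFun_apply,
      delta2_mul_powFun_zero, ArithmeticFunction.two_mul_apply,
      ArithmeticFunction.sub_apply', Nat.cast_sub (evenInd_le_one B), delta2_mul_apply_of_odd _ hC]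
    ring
  · obtain ⟨C, _, rfl⟩ := exists_eq_two_mul hC
    have hc := two_mul_ncard_typeSet_B2_of_odd A B C hB
    refine hasCount_of_mul_ncard (by exact_mod_cast hc) (by positivity) ?_
    simp [-ArithmeticFunction.mul_apply, FlatType.count, FlatType.terms, FlatType.weight, delta2_mul_apply_two_mul, powFun_apply,
      ArithmeticFunction.two_mul_apply,
      ArithmeticFunction.sub_apply', delta2_mul_apply_of_odd _ hB]
  · rw [typeSet_eq_empty (X := .B2) fun u w v hX => by
      rcases hX with hX | hX
      exacts [hB ((Int.even_coe_nat B).1 hX.1), hC ((Int.even_coe_nat C).1 hX.2.1)],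
      Set.image_empty]
    convert hasCount_empty
    simp [-ArithmeticFunction.mul_apply, FlatType.count, FlatType.terms, delta2_mul_apply_of_odd _ hB,
      delta2_mul_apply_of_odd _ hC]

theorem hasCount_typeSet_B3 (A B C : ℕ) [NeZero A] [NeZero B] [NeZero C] :
    HasCount (Quotient.mk (subgroupConj B3Group) '' typeSet .B3 A B C)
      (FlatType.count .B3 A B C) := by
  by_cases h : Even B ∨ Even C
  · rw [typeSet_eq_empty (X := .B3) fun u w v hX => h.elim (fun h => hX.1 ((Int.even_coe_nat B).2 h))
      fun h => hX.2.1 ((Int.even_coe_nat C).2 h), Set.image_empty]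
    convert hasCount_empty
    rcases h with h | h <;>
    simp [-ArithmeticFunction.mul_apply, FlatType.count, FlatType.terms, ArithmeticFunction.sub_apply', powFun_apply,
      delta2_mul_powFun_zero, evenInd_even h]
  · obtain ⟨hB, hC⟩ := not_or.1 h
    have hc := ncard_typeSet_B3 A B C hB hC
    refine hasCount_of_mul_ncard (by exact_mod_cast hc) (by positivity) ?_
    simp [-ArithmeticFunction.mul_apply, FlatType.count, FlatType.terms, FlatType.weight, powFun_apply,
      delta2_mul_powFun_zero A, ArithmeticFunction.two_mul_apply,
      ArithmeticFunction.sub_apply', delta2_mul_apply_of_odd _ hC, delta2_mul_apply_of_odd _ hB]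
    ring

theorem hasCount_typeSet_B4 (A B C : ℕ) [NeZero A] [NeZero B] [NeZero C] :
    HasCount (Quotient.mk (subgroupConj B3Group) '' typeSet .B4 A B C)
      (FlatType.count .B4 A B C) := by
  by_cases hA : Even A; swap
  · rw [typeSet_B4_eq_empty hA, Set.image_empty]
    convert hasCount_empty
    simp [-ArithmeticFunction.mul_apply, FlatType.count, FlatType.terms, ArithmeticFunction.four_mul_apply,
      delta2_mul_apply_of_odd _ hA]
  obtain ⟨A, _, rfl⟩ := exists_eq_two_mul hA
  by_cases h : Even B ∨ Even C
  · rw [typeSet_eq_empty (X := .B4) fun u w v hX => h.elim (fun h => hX.1 ((Int.even_coe_nat B).2 h))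
      fun h => hX.2.1 ((Int.even_coe_nat C).2 h), Set.image_empty]
    convert hasCount_empty
    rcases h with h | h <;>
    simp [-ArithmeticFunction.mul_apply, FlatType.count, FlatType.terms, ArithmeticFunction.sub_apply', powFun_apply,
      delta2_mul_powFun_zero, evenInd_even h]
  · obtain ⟨hB, hC⟩ := not_or.1 h
    have hc := ncard_typeSet_B4 A B C hB hC
    refine hasCount_of_mul_ncard (by exact_mod_cast hc) (by positivity) ?_
    simp [-ArithmeticFunction.mul_apply, FlatType.count, FlatType.terms, FlatType.weight, powFun_apply, delta2_mul_apply_two_mul,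
      ArithmeticFunction.four_mul_apply,
      ArithmeticFunction.sub_apply', delta2_mul_apply_of_odd _ hC, delta2_mul_apply_of_odd _ hB]
    norm_num

theorem hasCount_typeSet (X : FlatType) (A B C : ℕ) [NeZero A] [NeZero B] [NeZero C] :
    HasCount (Quotient.mk (subgroupConj B3Group) '' typeSet X A B C) (X.count A B C) :=
  match X with
  | .G1 => hasCount_typeSet_G1 A B C
  | .G2 => hasCount_typeSet_G2 A B C
  | .B1 => hasCount_typeSet_B1 A B C
  | .B2 => hasCount_typeSet_B2 A B C
  | .B3 => hasCount_typeSet_B3 A B C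
  | .B4 => hasCount_typeSet_B4 A B C

theorem eq_of_subgroupConj {X Y : FlatType} {A B C A' B' C' : ℤ} {H K : Subgroup B3Group}
    (hH : H ∈ typeSet X A B C) (hK : K ∈ typeSet Y A' B' C') (h : subgroupConj B3Group H K) :
    A = A' ∧ B = B' ∧ C = C' := by
  obtain ⟨u, w, v, hH, -⟩ := hH
  obtain ⟨u', w', v', hK, -⟩ := hK
  obtain ⟨g, rfl⟩ := h
  obtain ⟨_, _, _, h⟩ := hH.map_conj g
  exact h.unique hK

/-- The subgroups are sorted by their diagonals, which run over the factorizations ABC = n.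
Different diagonals give disjoint sets of classes because the diagonal is a conjugacy invariant. -/
theorem hasCount_type (X : FlatType) (n : ℕ) (hn : 0 < n) :
    HasCount (Quotient.mk (subgroupConj B3Group) ''
      {H | H.index = n ∧ ∃ A B C, H ∈ typeSet X A B C})
      ((X.terms.map fun t => t.1 * (t.2.1 * t.2.2)).sum n / X.weight) := by
  rw [← FlatType.sum_count, Finset.sum_sigma']
  convert HasCount.biUnion (n.divisorsAntidiagonal.sigma fun p => p.2.divisorsAntidiagonal)
    (fun x => Quotient.mk (subgroupConj B3Group) '' typeSet X x.1.1 x.2.1 x.2.2)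
    (fun x => X.count x.1.1 x.2.1 x.2.2) ?_ ?_ using 1
  · ext x
    simp only [Set.mem_image, Set.mem_iUnion, Finset.mem_sigma, Nat.mem_divisorsAntidiagonal,
      Set.mem_ofPred_eq, exists_prop]
    constructor
    · rintro ⟨H, ⟨hi, A, B, C, hH⟩, rfl⟩
      obtain ⟨u, w, v, hb, -⟩ := id hH
      obtain ⟨A, rfl⟩ := Int.eq_ofNat_of_zero_le hb.A_pos.le
      obtain ⟨B, rfl⟩ := Int.eq_ofNat_of_zero_le hb.B_pos.le
      obtain ⟨C, rfl⟩ := Int.eq_ofNat_of_zero_le hb.C_pos.le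
      have h := hb.index_eq
      rw [hi] at h
      have h : n = A * B * C := by exact_mod_cast h
      have h0 : A * B * C ≠ 0 := by omega
      refine ⟨⟨(A, B * C), (B, C)⟩, ⟨⟨by rw [h, mul_assoc], by omega⟩, rfl, ?_⟩, H, hH, rfl⟩
      exact (mul_ne_zero_iff.1 (by rwa [mul_assoc] at h0)).2
    · rintro ⟨⟨⟨A, m⟩, B, C⟩, ⟨⟨h1, _⟩, h2, _⟩, H, hH, rfl⟩
      dsimp only at h1 h2 hH
      subst h2 h1
      refine ⟨H, ⟨?_, _, _, _, hH⟩, rfl⟩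
      obtain ⟨u, w, v, hb, -⟩ := id hH
      have h := hb.index_eq
      rw [mul_assoc] at h
      exact_mod_cast h
  · rintro ⟨⟨A, m⟩, B, C⟩ hx ⟨⟨A', m'⟩, B', C'⟩ hy hne
    refine Set.disjoint_left.2 ?_
    rintro _ ⟨H, hH, rfl⟩ ⟨K, hK, hKH⟩
    obtain ⟨h1, h2, h3⟩ := eq_of_subgroupConj hK hH (Quotient.exact hKH)
    simp only [Finset.coe_sigma, Set.mem_sigma_iff, Finset.mem_coe,
      Nat.mem_divisorsAntidiagonal] at hx hy
    dsimp only at h1 h2 h3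
    norm_cast at h1 h2 h3
    subst h1 h2 h3
    obtain ⟨-, rfl, -⟩ := hx
    obtain ⟨-, rfl, -⟩ := hy
    exact hne rfl
  · rintro ⟨⟨A, m⟩, B, C⟩ hx
    simp only [Finset.mem_sigma, Nat.mem_divisorsAntidiagonal] at hx
    obtain ⟨⟨h1, h2⟩, rfl, h4⟩ := hx
    have : NeZero A := ⟨by rintro rfl; simp at h1; omega⟩
    have : NeZero B := ⟨by rintro rfl; simp at h4⟩
    have : NeZero C := ⟨by rintro rfl; simp at h4⟩
    exact hasCount_typeSet X A B C

/-- Both counts run over the subgroups with a basis of type `X`: one by the isomorphism criterion,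
the other by the classification of coverings. Positivity of n excludes infinite index, which
`Subgroup.index` records as 0. -/
theorem classNumberEq {X : FlatType} {M : Type} [TopologicalSpace M]
    (φ : Nonempty (M ≃ₜ Orb (model X))) (n : ℕ) (hn : 0 < n) {c : ℚ}
    (hc : (X.terms.map fun t => t.1 * (t.2.1 * t.2.2)).sum n = X.weight * c) :
    ClassNumberEq M B3 n c := by
  obtain ⟨φ⟩ := φ
  obtain ⟨q, hq⟩ := exists_isQuotientCoveringMap
  have h := hasCount_type X n hn
  have hw : (X.weight : ℚ) ≠ 0 := by cases X <;> simp [-ArithmeticFunction.mul_apply, FlatType.weight]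
  rw [hc, mul_div_cancel_left₀ _ hw] at h
  constructor
  · intro x m
    obtain ⟨e⟩ := nonempty_fundamentalGroup_mulEquiv (isQuotientCoveringMap (model X)) φ.symm x
    obtain ⟨g⟩ := nonempty_fundamentalGroup_mulEquiv hq (Homeomorph.refl _) m
    rw [hasCount_subgroupClasses_congr e g]
    unfold subgroupClasses
    convert h using 3
    ext H
    refine and_congr_right fun hi => nonempty_mulEquiv_model_iff (by omega) X
  · rw [hasCount_coveringClasses_iff hq]
    convert h using 3
    ext H
    refine and_congr_right fun hi => ?_
    rw [← hasType_iff (by omega)]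
    exact ⟨fun ⟨ψ⟩ => ⟨(ψ.trans φ).symm⟩, fun ⟨ψ⟩ => ⟨ψ.symm.trans φ.symm⟩⟩

end B3Group

/-! ### Closed forms of the convolutions -/

/-- The Dirichlet convolution with summands `a² b` over the factorizations `abc`. -/
def omegaFun : ArithmeticFunction ℚ := powFun 2 * (powFun 1 * powFun 0)

/-- The Dirichlet convolution with summands `a` over the factorizations `abc`. -/
def sigmaFun : ArithmeticFunction ℚ := powFun 1 * (powFun 0 * powFun 0)

/-- The Dirichlet convolution with summands `1` over the factorizations `abc`. -/
def dFun : ArithmeticFunction ℚ := powFun 0 * (powFun 0 * powFun 0)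

/-- An identity of polynomials in `delta2` and the functions `powFun k`, as are the five that
follow. -/
theorem FlatType.sum_terms_G1 :
    (FlatType.G1.terms.map fun t => t.1 * (t.2.1 * t.2.2)).sum =
      delta2 ^ 2 * omegaFun + 3 * (delta2 ^ 2 * sigmaFun) +
        ((9 : ℕ) : ArithmeticFunction ℚ) * (delta2 ^ 3 * sigmaFun) := by
  simp only [FlatType.terms, List.map_cons, List.map_nil, List.sum_cons, List.sum_nil, omegaFun,
    sigmaFun]
  push_cast
  ring

theorem FlatType.sum_terms_G2 :
    (FlatType.G2.terms.map fun t => t.1 * (t.2.1 * t.2.2)).sum =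
      delta2 ^ 1 * sigmaFun + 2 * (delta2 ^ 2 * sigmaFun) - 3 * (delta2 ^ 3 * sigmaFun) +
        delta2 ^ 1 * dFun - delta2 ^ 2 * dFun + delta2 ^ 3 * dFun - 3 * (delta2 ^ 4 * dFun) +
        2 * (delta2 ^ 5 * dFun) := by
  simp only [FlatType.terms, List.map_cons, List.map_nil, List.sum_cons, List.sum_nil, dFun,
    sigmaFun]
  ring

theorem FlatType.sum_terms_B1 :
    (FlatType.B1.terms.map fun t => t.1 * (t.2.1 * t.2.2)).sum =
      2 * (delta2 ^ 1 * sigmaFun - delta2 ^ 3 * sigmaFun + delta2 ^ 1 * dFun -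
        delta2 ^ 3 * dFun) := by
  simp only [FlatType.terms, List.map_cons, List.map_nil, List.sum_cons, List.sum_nil, dFun,
    sigmaFun]
  ring

theorem FlatType.sum_terms_B2 :
    (FlatType.B2.terms.map fun t => t.1 * (t.2.1 * t.2.2)).sum =
      2 * (2 * (delta2 ^ 2 * sigmaFun) - 2 * (delta2 ^ 3 * sigmaFun) + delta2 ^ 2 * dFun -
        delta2 ^ 4 * dFun) := by
  simp only [FlatType.terms, List.map_cons, List.map_nil, List.sum_cons, List.sum_nil, dFun,
    sigmaFun]
  ring

theorem FlatType.sum_terms_B3 :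
    (FlatType.B3.terms.map fun t => t.1 * (t.2.1 * t.2.2)).sum =
      2 * (delta2 ^ 0 * dFun - delta2 ^ 1 * dFun - delta2 ^ 2 * dFun + delta2 ^ 3 * dFun) := by
  simp only [FlatType.terms, List.map_cons, List.map_nil, List.sum_cons, List.sum_nil, dFun]
  ring

theorem FlatType.sum_terms_B4 :
    (FlatType.B4.terms.map fun t => t.1 * (t.2.1 * t.2.2)).sum =
      2 * (2 * (delta2 ^ 1 * dFun) - 4 * (delta2 ^ 2 * dFun) + 2 * (delta2 ^ 3 * dFun)) := by
  simp only [FlatType.terms, List.map_cons, List.map_nil, List.sum_cons, List.sum_nil, dFun]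
  ring

end

theorem theorem2 (n : ℕ) (hn : 0 < n) :
    ClassNumberEq G1 B3 n
      (1 / 4 * (atQuot omega n 4 + 3 * atQuot sigma2 n 4 + 9 * atQuot sigma2 n 8)) ∧
    ClassNumberEq G2 B3 n
      (1 / 2 * (atQuot sigma2 n 2 + 2 * atQuot sigma2 n 4 - 3 * atQuot sigma2 n 8
        + atQuot d3 n 2 - atQuot d3 n 4 + atQuot d3 n 8
        - 3 * atQuot d3 n 16 + 2 * atQuot d3 n 32)) ∧
    ClassNumberEq B1 B3 n
      (atQuot sigma2 n 2 - atQuot sigma2 n 8 + atQuot d3 n 2 - atQuot d3 n 8) ∧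
    ClassNumberEq B2 B3 n
      (2 * atQuot sigma2 n 4 - 2 * atQuot sigma2 n 8 + atQuot d3 n 4 - atQuot d3 n 16) ∧
    ClassNumberEq B3 B3 n
      (atQuot d3 n 1 - atQuot d3 n 2 - atQuot d3 n 4 + atQuot d3 n 8) ∧
    ClassNumberEq B4 B3 n
      (2 * atQuot d3 n 2 - 4 * atQuot d3 n 4 + 2 * atQuot d3 n 8) := by
  have hω (k : ℕ) : (delta2 ^ k * omegaFun) n = atQuot omega n (2 ^ k) :=
    (atQuot_two_pow omega omega_eq k n).symm
  have hσ (k : ℕ) : (delta2 ^ k * sigmaFun) n = atQuot sigma2 n (2 ^ k) :=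
    (atQuot_two_pow sigma2 sigma2_eq k n).symm
  have hd (k : ℕ) : (delta2 ^ k * dFun) n = atQuot d3 n (2 ^ k) :=
    (atQuot_two_pow d3 d3_eq k n).symm
  refine ⟨B3Group.classNumberEq nonempty_homeomorph_G1 n hn ?_,
    B3Group.classNumberEq nonempty_homeomorph_G2 n hn ?_,
    B3Group.classNumberEq nonempty_homeomorph_B1 n hn ?_,
    B3Group.classNumberEq nonempty_homeomorph_B2 n hn ?_,
    B3Group.classNumberEq nonempty_homeomorph_B3 n hn ?_,
    B3Group.classNumberEq nonempty_homeomorph_B4 n hn ?_⟩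
  · rw [FlatType.sum_terms_G1]
    simp only [ArithmeticFunction.add_apply, ArithmeticFunction.three_mul_apply,
      ArithmeticFunction.natCast_mul_apply, hω, hσ, FlatType.weight]
    norm_num
    ring
  · rw [FlatType.sum_terms_G2]
    simp only [ArithmeticFunction.add_apply, ArithmeticFunction.sub_apply',
      ArithmeticFunction.two_mul_apply, ArithmeticFunction.three_mul_apply, hσ, hd,
      FlatType.weight]
    norm_num
    ring
  · rw [FlatType.sum_terms_B1]
    simp only [ArithmeticFunction.add_apply, ArithmeticFunction.sub_apply',
      ArithmeticFunction.two_mul_apply, hσ, hd, FlatType.weight]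
    norm_num
  · rw [FlatType.sum_terms_B2]
    simp only [ArithmeticFunction.add_apply, ArithmeticFunction.sub_apply',
      ArithmeticFunction.two_mul_apply, hσ, hd, FlatType.weight]
    norm_num
  · rw [FlatType.sum_terms_B3]
    simp only [ArithmeticFunction.add_apply, ArithmeticFunction.sub_apply',
      ArithmeticFunction.two_mul_apply, hd, FlatType.weight]
    norm_num
  · rw [FlatType.sum_terms_B4]
    simp only [ArithmeticFunction.add_apply, ArithmeticFunction.sub_apply',
      ArithmeticFunction.two_mul_apply, ArithmeticFunction.four_mul_apply, hd, FlatType.weight]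
    norm_num
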